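/- Let $Q$ be a finite-dimensional smooth manifold without boundary and $k\ge 0$ an integer. A *discretization map* on a smooth manifold $M$ is a smooth map $R=(R^1,R^2)\colon U\to M\times M$, where $U\subset TM$ is an open neighbourhood of the zero section, such that for every $x\in M$ one has $R(0_x)=(x,x)$ and $T_{0_x}(R^2|_{T_xM})-T_{0_x}(R^1|_{T_xM})=\mathrm{id}_{T_xM}$. Let $T^{(k)}Q$ be the manifold of $k$-jets $j^{(k)}_0c$ at $0$ of smooth curves $c$ in $Q$, and let $\Phi^{(k)}\colon T(T^{(k)}Q)\to T^{(k)}(TQ)$ be the canonical identification, which sends $j_0^{(1)}\bigl(s\mapsto j_0^{(k)}(t\mapsto c(s,t))\bigr)$ to $j_0^{(k)}\bigl(t\mapsto j_0^{(1)}(s\mapsto c(s,t))\bigr)$ for smooth two-parameter families $c$. Given a discretization map $R_d\colon U\to Q\times Q$ on $Q$, put $$R_d^{(k)}=T^{(k)}R_d\circ\Phi^{(k)}\colon U^{(k)}\to T^{(k)}Q\times T^{(k)}Q,\qquad T^{(k)}R_d(j_0^{(k)}\gamma)=j_0^{(k)}(R_d\circ\gamma),$$ where $U^{(k)}\subset T(T^{(k)}Q)$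 is the set of $X$ for which $\Phi^{(k)}(X)$ is based at a point of $U$. For a manifold $M$ let $\alpha\colon T(T^*M)\to T^*(TM)$ be the canonical isomorphism, $(q,p,\dot q,\dot p)\mapsto(q,\dot q,\dot p,p)$ in induced coordinates; let $\Phi\colon T^*M\times T^*M\to T^*(M\times M)$ be the map $(q_0,p_0;q_1,p_1)\mapsto(q_0,q_1,-p_0,p_1)$; and, for a map $R$ from an open subset $V$ of $TM$ to $M\times M$, let $\widehat R(\beta_v)=\beta_v\circ(T_vR)^{-1}\in T^*_{R(v)}(M\times M)$ for $\beta_v\in T_v^*(TM)$ at the points $v\in V$ where $T_vR$ is invertible. The cotangent lift of $R$ is $R^{T^*}=\Phi^{-1}\circ\widehat R\circ\alpha$, defined on the set of $X\in T(T^*M)$ such that $\alpha(X)$ is a covector at a point $v\in V$ where $T_vR$ is invertible. **Statement.** If $R_d$ is a discretization map on $Q$, then: 1. the cotangent lift $(R_d^{(k)})^{T^*}=\Phi^{-1}\circ\widehat{R_d^{(k)}}\circ\alpha$, a map from its domain in $T(T^*(T^{(k)}Q))$ to $T^*(T^{(k)}Q)\times T^*(T^{(k)}Q)$, is a discretization map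 on $T^*(T^{(k)}Q)$; 2. it yields symplectic integrators for the Hamiltonian dynamics on $T^*(T^{(k)}Q)$. Let $\omega=dq\wedge dp$ be the canonical symplectic form of $T^*(T^{(k)}Q)$, let $H\colon T^*(T^{(k)}Q)\to\mathbb R$ be smooth, and let $X_H=\sharp_\omega(dH)$ be its Hamiltonian vector field, $\omega(X_H,\cdot)=dH$. Every point of $T^*(T^{(k)}Q)$ has open neighbourhoods $W$, $N$ and there is $\varepsilon>0$ such that for all $h\in(-\varepsilon,\varepsilon)$ and $z_0\in W$ there is exactly one $z_1=:\psi_h(z_0)$ for which $$(R_d^{(k)})^{T^*}(X)=(z_0,z_1),\qquad X=h\,X_H(z)\ \text{ with } z \text{ the base point of } X,\ z\in N,$$ holds for some $X$ in the domain of $(R_d^{(k)})^{T^*}$. Moreover $(h,z_0)\mapsto\psi_h(z_0)$ is smooth on $(-\varepsilon,\varepsilon)\times W$, $\psi_0=\mathrm{id}$, $\frac{d}{dh}\big|_{h=0}\psi_h(z_0)=X_H(z_0)$ for $z_0\in W$, and $\psi_h^*\omega=\omega$ on $W$ for every $h\in(-\varepsilon,\varepsilon)$. -/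

import Mathlib

open scoped Manifold ContDiff Topology
open Bundle Set

noncomputable section

/-! ### Higher-order tangent bundles -/

section CurveCalculus

variable {E F A : Type*} [NormedAddCommGroup E] [NormedSpace ℝ E]
  [NormedAddCommGroup F] [NormedSpace ℝ F] [NormedAddCommGroup A] [NormedSpace ℝ A]

/-- The polynomial curve `t ↦ ∑ i, t ^ i • a i` with Taylor coefficients `a` at `0`. -/
def taylorCurve {k : ℕ} (a : Fin (k + 1) → E) (t : ℝ) : E :=
  ∑ i : Fin (k + 1), t ^ (i : ℕ) • a i

/-- The Taylor coefficients `f⁽ⁱ⁾(0) / i!`, `0 ≤ i ≤ k`, of a curve in a vector space. -/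
def taylorCoeffs (k : ℕ) (f : ℝ → E) (i : Fin (k + 1)) : E :=
  ((i : ℕ).factorial : ℝ)⁻¹ • iteratedDeriv i f 0

theorem taylorCurve_zero {k : ℕ} (a : Fin (k + 1) → E) : taylorCurve a 0 = a 0 := by
  unfold taylorCurve
  rw [Finset.sum_eq_single 0]
  · simp
  · intro i _ hi
    have : (i : ℕ) ≠ 0 := fun h => hi (Fin.ext h)
    simp [this]
  · simp

theorem contDiff_taylorCurve_uncurry {k : ℕ} :
    ContDiff ℝ ∞ (fun p : (Fin (k + 1) → E) × ℝ => taylorCurve p.1 p.2) := by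
  unfold taylorCurve
  fun_prop

theorem contDiff_taylorCurve {k : ℕ} (a : Fin (k + 1) → E) : ContDiff ℝ ∞ (taylorCurve a) := by
  unfold taylorCurve
  fun_prop

theorem taylorCoeffs_taylorCurve {k : ℕ} (a : Fin (k + 1) → E) :
    taylorCoeffs k (taylorCurve a) = a := by
  funext i
  have h : iteratedDeriv (i : ℕ) (taylorCurve a) 0 = ((i : ℕ).factorial : ℝ) • a i := by
    unfold taylorCurve
    rw [iteratedDeriv_fun_sum (fun j _ => by fun_prop), Finset.sum_eq_single i]
    · rw [iteratedDeriv_smul_const (by fun_prop), iteratedDeriv_pow]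
      simp [Nat.descFactorial_self]
    · intro j _ hj
      rw [iteratedDeriv_smul_const (by fun_prop), iteratedDeriv_pow]
      have hne : (j : ℕ) ≠ i := fun h => hj (Fin.ext h)
      rcases lt_or_gt_of_ne hne with h | h
      · simp [Nat.descFactorial_of_lt h]
      · have : (j : ℕ) - i ≠ 0 := by omega
        simp [this]
    · simp
  unfold taylorCoeffs
  rw [h, smul_smul, inv_mul_cancel₀ (by positivity), one_smul]

theorem taylorCoeffs_eq_iff {k : ℕ} {f g : ℝ → E} :
    taylorCoeffs k f = taylorCoeffs k g ↔
      ∀ i ≤ k, iteratedDeriv i f 0 = iteratedDeriv i g 0 := by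
  constructor
  · intro h i hi
    have := congrFun h ⟨i, by omega⟩
    exact smul_right_injective E (inv_ne_zero (by positivity : ((i.factorial : ℕ) : ℝ) ≠ 0)) this
  · intro h
    funext i
    simp only [taylorCoeffs, h i (by omega)]

theorem taylorCoeffs_congr {k : ℕ} {f g : ℝ → E} (h : f =ᶠ[𝓝 0] g) :
    taylorCoeffs k f = taylorCoeffs k g :=
  taylorCoeffs_eq_iff.2 fun i _ => h.iteratedDeriv_eq i

theorem iteratedDeriv_comp_congr {f₁ f₂ : ℝ → E} {g : E → F} {k : ℕ}
    (h₁ : ContDiffAt ℝ ∞ f₁ 0) (h₂ : ContDiffAt ℝ ∞ f₂ 0) (hg : ContDiffAt ℝ ∞ g (f₁ 0))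
    (h : ∀ i ≤ k, iteratedDeriv i f₁ 0 = iteratedDeriv i f₂ 0) :
    ∀ i ≤ k, iteratedDeriv i (g ∘ f₁) 0 = iteratedDeriv i (g ∘ f₂) 0 := by
  intro i hi
  have h0 : f₁ 0 = f₂ 0 := by simpa using h 0 (Nat.zero_le _)
  have hF : ∀ j ≤ k, iteratedFDeriv ℝ j f₁ 0 = iteratedFDeriv ℝ j f₂ 0 := by
    intro j hj
    simp only [iteratedFDeriv_eq_equiv_comp, Function.comp_apply, h j hj]
  have hi' : ((i : ℕ) : ℕ∞ω) ≤ ∞ := by exact_mod_cast le_top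
  rw [iteratedDeriv_eq_equiv_comp, iteratedDeriv_eq_equiv_comp, Function.comp_apply,
    Function.comp_apply, iteratedFDeriv_comp hg h₁ hi', iteratedFDeriv_comp (h0 ▸ hg) h₂ hi', h0]
  congr 1
  unfold FormalMultilinearSeries.taylorComp
  refine Finset.sum_congr rfl fun c _ => ?_
  ext
  simp only [FormalMultilinearSeries.compAlongOrderedFinpartition_apply]
  congr 1
  funext m
  simp only [OrderedFinpartition.applyOrderedFinpartition_apply, ftaylorSeries]
  rw [hF _ ((c.partSize_le m).trans hi)]

theorem taylorCoeffs_comp_congr {f₁ f₂ : ℝ → E} {g : E → F} {k : ℕ}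
    (h₁ : ContDiffAt ℝ ∞ f₁ 0) (h₂ : ContDiffAt ℝ ∞ f₂ 0) (hg : ContDiffAt ℝ ∞ g (f₁ 0))
    (h : taylorCoeffs k f₁ = taylorCoeffs k f₂) :
    taylorCoeffs k (g ∘ f₁) = taylorCoeffs k (g ∘ f₂) :=
  taylorCoeffs_eq_iff.2 (iteratedDeriv_comp_congr h₁ h₂ hg (taylorCoeffs_eq_iff.1 h))

theorem contDiffOn_iteratedDeriv_param (i : ℕ) : ∀ {f : A × ℝ → F} {S : Set (A × ℝ)},
    IsOpen S → ContDiffOn ℝ ∞ f S →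
    ContDiffOn ℝ ∞ (fun p : A × ℝ => iteratedDeriv i (fun t => f (p.1, t)) p.2) S := by
  induction i with
  | zero => intro f S _ hf; simpa using hf
  | succ i ih =>
    intro f S hS hf
    have h1 : ContDiffOn ℝ ∞ (fun p : A × ℝ => fderiv ℝ f p ((0 : A), (1 : ℝ))) S :=
      (hf.fderiv_of_isOpen hS (by simp)).clm_apply contDiffOn_const
    refine (ih hS h1).congr fun p hp => ?_
    rw [iteratedDeriv_succ']
    refine Filter.EventuallyEq.iteratedDeriv_eq i ?_
    have hc : ContinuousAt (fun t : ℝ => (p.1, t)) p.2 := by fun_prop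
    filter_upwards [hc (hS.mem_nhds hp)] with t ht
    have hd : HasFDerivAt f (fderiv ℝ f (p.1, t)) (p.1, t) :=
      ((hf.contDiffAt (hS.mem_nhds ht)).differentiableAt (by simp)).hasFDerivAt
    have hl : HasDerivAt (fun t : ℝ => (p.1, t)) ((0 : A), (1 : ℝ)) t :=
      (hasDerivAt_const t p.1).prodMk (hasDerivAt_id t)
    exact (hd.comp_hasDerivAt t hl).deriv

theorem contDiffOn_taylorCoeffs_param {k : ℕ} {f : A × ℝ → F} {S : Set (A × ℝ)}
    (hS : IsOpen S) (hf : ContDiffOn ℝ ∞ f S) :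
    ContDiffOn ℝ ∞ (fun a : A => taylorCoeffs k (fun t => f (a, t))) {a | (a, (0 : ℝ)) ∈ S} := by
  rw [contDiffOn_pi]
  intro i
  have h := contDiffOn_iteratedDeriv_param (i : ℕ) hS hf
  have hc : ContDiffOn ℝ ∞ (fun a : A => (a, (0 : ℝ))) {a | (a, (0 : ℝ)) ∈ S} := by fun_prop
  exact contDiffOn_const.smul (h.comp hc fun a ha => ha)

end CurveCalculus

section Jets

variable {E H : Type*} [NormedAddCommGroup E] [NormedSpace ℝ E] [TopologicalSpace H]
  (I : ModelWithCorners ℝ E H) (Q : Type*) [TopologicalSpace Q] [ChartedSpace H Q]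

/-- Curves in `Q` that are smooth at `0`. -/
abbrev SmoothCurve := {c : ℝ → Q // ContMDiffAt 𝓘(ℝ, ℝ) I ∞ c 0}

/-- The relation `c ∼ₖ d` at `0`: same value, and (in a chart around it) same derivatives
up to order `k`. -/
def jetSetoid (k : ℕ) : Setoid (SmoothCurve I Q) where
  r c d := c.1 0 = d.1 0 ∧ ∀ i ≤ k,
    iteratedDeriv i (extChartAt I (c.1 0) ∘ c.1) 0 = iteratedDeriv i (extChartAt I (c.1 0) ∘ d.1) 0
  iseqv :=
    { refl := fun _ => ⟨rfl, fun _ _ => rfl⟩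
      symm := by
        rintro c d ⟨h0, h⟩
        exact ⟨h0.symm, fun i hi => by rw [← h0]; exact (h i hi).symm⟩
      trans := by
        rintro c d e ⟨h0, h⟩ ⟨h0', h'⟩
        refine ⟨h0.trans h0', fun i hi => (h i hi).trans ?_⟩
        rw [h0]
        exact h' i hi }

/-- The `k`-th order tangent bundle `T⁽ᵏ⁾Q`: `k`-jets at `0` of smooth curves in `Q`. -/
def HigherTangentBundle (k : ℕ) : Type _ := Quotient (jetSetoid I Q k)

variable {Q}

/-- The `k`-jet at `0` of a curve `c` (of the constant curve `c 0` if `c` is not smooth at `0`,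
a case of no importance). -/
def jet (k : ℕ) (c : ℝ → Q) : HigherTangentBundle I Q k :=
  open Classical in
  Quotient.mk (jetSetoid I Q k)
    (if h : ContMDiffAt 𝓘(ℝ, ℝ) I ∞ c 0 then ⟨c, h⟩ else ⟨fun _ => c 0, contMDiffAt_const⟩)

namespace HigherTangentBundle

variable {I} {k : ℕ}

/-- The projection `T⁽ᵏ⁾Q → Q`. -/
def proj (z : HigherTangentBundle I Q k) : Q :=
  Quotient.lift (s := jetSetoid I Q k) (fun c : SmoothCurve I Q => c.1 0) (fun _ _ h => h.1) z

/-- A smooth curve representing the jet `z`. -/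
def curve (z : HigherTangentBundle I Q k) : ℝ → Q := (Quotient.out z).1

theorem contMDiffAt_curve (z : HigherTangentBundle I Q k) :
    ContMDiffAt 𝓘(ℝ, ℝ) I ∞ z.curve 0 := (Quotient.out z).2

theorem jet_curve (z : HigherTangentBundle I Q k) : jet I k z.curve = z := by
  unfold jet
  rw [dif_pos z.contMDiffAt_curve]
  exact Quotient.out_eq z

theorem proj_jet (c : ℝ → Q) : (jet I k c).proj = c 0 := by
  unfold jet
  split_ifs <;> rfl

theorem curve_zero (z : HigherTangentBundle I Q k) : z.curve 0 = z.proj := by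
  conv_rhs => rw [← z.jet_curve, proj_jet]

theorem jet_eq_jet_iff {c d : ℝ → Q} (hc : ContMDiffAt 𝓘(ℝ, ℝ) I ∞ c 0)
    (hd : ContMDiffAt 𝓘(ℝ, ℝ) I ∞ d 0) :
    jet I k c = jet I k d ↔ c 0 = d 0 ∧
      taylorCoeffs k (extChartAt I (c 0) ∘ c) = taylorCoeffs k (extChartAt I (c 0) ∘ d) := by
  unfold jet
  rw [dif_pos hc, dif_pos hd, taylorCoeffs_eq_iff]
  exact Quotient.eq (r := jetSetoid I Q k)

section

variable [IsManifold I ∞ Q]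

theorem contDiffAt_extChartAt_comp {c : ℝ → Q} (hc : ContMDiffAt 𝓘(ℝ, ℝ) I ∞ c 0) {x : Q}
    (hx : c 0 ∈ (chartAt H x).source) : ContDiffAt ℝ ∞ (extChartAt I x ∘ c) 0 :=
  contMDiffAt_iff_contDiffAt.1 ((contMDiffAt_extChartAt' hx).comp 0 hc)

end

variable [I.Boundaryless]

theorem isOpen_coordChange_source (x y : Q) :
    IsOpen ((extChartAt I x).symm ≫ extChartAt I y).source := by
  rw [PartialEquiv.trans_source, PartialEquiv.symm_source]
  exact (continuousOn_extChartAt_symm x).isOpen_inter_preimage (isOpen_extChartAt_target x)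
    (isOpen_extChartAt_source y)

theorem taylorCoeffs_symm_taylorCurve (x : Q) {a : Fin (k + 1) → E}
    (ha : a 0 ∈ (extChartAt I x).target) :
    taylorCoeffs k (extChartAt I x ∘ (extChartAt I x).symm ∘ taylorCurve a) = a := by
  conv_rhs => rw [← taylorCoeffs_taylorCurve a]
  refine taylorCoeffs_congr ?_
  have : ∀ᶠ t in 𝓝 (0 : ℝ), taylorCurve a t ∈ (extChartAt I x).target :=
    (contDiff_taylorCurve a).continuous.continuousAt.eventually_mem
      ((isOpen_extChartAt_target x).mem_nhds (by rwa [taylorCurve_zero]))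
  filter_upwards [this] with t ht
  simp only [Function.comp_apply, (extChartAt I x).right_inv ht]

variable [IsManifold I ∞ Q]

theorem taylorCoeffs_chart_congr {c d : ℝ → Q} (hc : ContMDiffAt 𝓘(ℝ, ℝ) I ∞ c 0)
    (hd : ContMDiffAt 𝓘(ℝ, ℝ) I ∞ d 0) (h0 : c 0 = d 0) {x y : Q}
    (hx : c 0 ∈ (chartAt H x).source) (hy : c 0 ∈ (chartAt H y).source)
    (h : taylorCoeffs k (extChartAt I x ∘ c) = taylorCoeffs k (extChartAt I x ∘ d)) :
    taylorCoeffs k (extChartAt I y ∘ c) = taylorCoeffs k (extChartAt I y ∘ d) := by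
  have hxe : c 0 ∈ (extChartAt I x).source := by rwa [extChartAt_source]
  have hye : c 0 ∈ (extChartAt I y).source := by rwa [extChartAt_source]
  have key : ∀ e : ℝ → Q, ContMDiffAt 𝓘(ℝ, ℝ) I ∞ e 0 → c 0 = e 0 →
      extChartAt I y ∘ e =ᶠ[𝓝 0]
        (extChartAt I y ∘ (extChartAt I x).symm) ∘ (extChartAt I x ∘ e) := by
    intro e he h0
    have : ∀ᶠ t in 𝓝 (0 : ℝ), e t ∈ (extChartAt I x).source :=
      he.continuousAt.eventually_mem ((isOpen_extChartAt_source x).mem_nhds (h0 ▸ hxe))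
    filter_upwards [this] with t ht
    simp only [Function.comp_apply, (extChartAt I x).left_inv ht]
  rw [taylorCoeffs_congr (key c hc rfl), taylorCoeffs_congr (key d hd h0)]
  refine taylorCoeffs_comp_congr (contDiffAt_extChartAt_comp hc hx)
    (contDiffAt_extChartAt_comp hd (h0 ▸ hx)) ?_ h
  refine (contDiffOn_ext_coord_change y x).contDiffAt
    ((isOpen_coordChange_source x y).mem_nhds ?_)
  rw [PartialEquiv.trans_source, PartialEquiv.symm_source]
  refine ⟨(extChartAt I x).map_source hxe, ?_⟩
  rw [mem_preimage, Function.comp_apply, (extChartAt I x).left_inv hxe]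
  exact hye

theorem jet_eq_jet_iff_chart {c d : ℝ → Q} (hc : ContMDiffAt 𝓘(ℝ, ℝ) I ∞ c 0)
    (hd : ContMDiffAt 𝓘(ℝ, ℝ) I ∞ d 0) {x : Q} (hx : c 0 ∈ (chartAt H x).source) :
    jet I k c = jet I k d ↔ c 0 = d 0 ∧
      taylorCoeffs k (extChartAt I x ∘ c) = taylorCoeffs k (extChartAt I x ∘ d) := by
  rw [jet_eq_jet_iff hc hd]
  exact and_congr_right fun h0 =>
    ⟨taylorCoeffs_chart_congr hc hd h0 (mem_chart_source H _) hx,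
      taylorCoeffs_chart_congr hc hd h0 hx (mem_chart_source H _)⟩

theorem contMDiffAt_symm_taylorCurve (x : Q) {a : Fin (k + 1) → E}
    (ha : a 0 ∈ (extChartAt I x).target) :
    ContMDiffAt 𝓘(ℝ, ℝ) I ∞ ((extChartAt I x).symm ∘ taylorCurve a) 0 := by
  refine ContMDiffAt.comp 0 ?_ (contDiff_taylorCurve a).contMDiff.contMDiffAt
  rw [taylorCurve_zero]
  exact (contMDiffOn_extChartAt_symm x).contMDiffAt ((isOpen_extChartAt_target x).mem_nhds ha)

/-- The chart of `T⁽ᵏ⁾Q` induced by the chart of `Q` around `x`: a jet is sent to the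
Taylor coefficients at `0` of the coordinate expression of a representing curve. -/
def jetChart (k : ℕ) (x : Q) : PartialEquiv (HigherTangentBundle I Q k) (Fin (k + 1) → E) where
  toFun z := taylorCoeffs k (extChartAt I x ∘ z.curve)
  invFun a := jet I k ((extChartAt I x).symm ∘ taylorCurve a)
  source := {z | z.proj ∈ (chartAt H x).source}
  target := {a | a 0 ∈ (extChartAt I x).target}
  map_source' z hz := by
    have : z.proj ∈ (extChartAt I x).source := by rwa [extChartAt_source]
    simpa [taylorCoeffs, curve_zero] using (extChartAt I x).map_source this
  map_target' a ha := by
    have := (extChartAt I x).map_target ha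
    rw [extChartAt_source] at this
    simpa [proj_jet, taylorCurve_zero] using this
  left_inv' z hz := by
    have hz' : z.curve 0 ∈ (chartAt H x).source := by rw [curve_zero]; exact hz
    have hze : z.curve 0 ∈ (extChartAt I x).source := by rwa [extChartAt_source]
    have h0 : taylorCoeffs k (extChartAt I x ∘ z.curve) 0 = extChartAt I x (z.curve 0) := by
      simp [taylorCoeffs]
    have ht : taylorCoeffs k (extChartAt I x ∘ z.curve) 0 ∈ (extChartAt I x).target := by
      rw [h0]; exact (extChartAt I x).map_source hze
    conv_rhs => rw [← z.jet_curve]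
    refine Eq.symm ((jet_eq_jet_iff_chart z.contMDiffAt_curve
      (contMDiffAt_symm_taylorCurve x ht) hz').2 ⟨?_, ?_⟩)
    · simp only [Function.comp_apply, taylorCurve_zero]
      rw [h0, (extChartAt I x).left_inv hze]
    · rw [taylorCoeffs_symm_taylorCurve x ht]
  right_inv' a ha := by
    have hs := contMDiffAt_symm_taylorCurve x ha
    have hz : ((extChartAt I x).symm ∘ taylorCurve a) 0 ∈ (chartAt H x).source := by
      rw [← extChartAt_source I]
      simpa [taylorCurve_zero] using (extChartAt I x).map_target ha
    have := ((jet_eq_jet_iff_chart (k := k) hs (contMDiffAt_curve _) hz).1 (jet_curve _).symm).2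
    rw [← this, taylorCoeffs_symm_taylorCurve x ha]

theorem jetChart_coordChange_source (x y : Q) :
    ((jetChart (I := I) k x).symm.trans (jetChart k y)).source =
      {a | a 0 ∈ ((extChartAt I x).symm ≫ extChartAt I y).source} := by
  ext a
  simp [jetChart, PartialEquiv.trans_source, proj_jet, taylorCurve_zero]

theorem contDiffOn_jetChart_coordChange (x y : Q) :
    ContDiffOn ℝ ∞ ((jetChart (I := I) k x).symm.trans (jetChart k y))
      ((jetChart (I := I) k x).symm.trans (jetChart k y)).source := by
  rw [jetChart_coordChange_source]
  let S : Set ((Fin (k + 1) → E) × ℝ) :=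
    (fun p => taylorCurve p.1 p.2) ⁻¹' ((extChartAt I x).symm ≫ extChartAt I y).source
  have hS : IsOpen S :=
    (isOpen_coordChange_source x y).preimage contDiff_taylorCurve_uncurry.continuous
  have hf : ContDiffOn ℝ ∞ (fun p : (Fin (k + 1) → E) × ℝ =>
      (extChartAt I y ∘ (extChartAt I x).symm) (taylorCurve p.1 p.2)) S :=
    (contDiffOn_ext_coord_change y x).comp contDiff_taylorCurve_uncurry.contDiffOn fun p hp => hp
  have h := contDiffOn_taylorCoeffs_param (k := k) hS hf
  have hset : {a : Fin (k + 1) → E | (a, (0 : ℝ)) ∈ S} =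
      {a | a 0 ∈ ((extChartAt I x).symm ≫ extChartAt I y).source} := by
    ext a; simp [S, taylorCurve_zero]
  rw [hset] at h
  refine h.congr fun a ha => ?_
  have hax : a 0 ∈ (extChartAt I x).target := by
    have := ha.1; simpa using this
  have hs := contMDiffAt_symm_taylorCurve x hax
  have hz : ((extChartAt I x).symm ∘ taylorCurve a) 0 ∈ (chartAt H y).source := by
    have := ha.2
    rw [← extChartAt_source I]
    simpa [taylorCurve_zero] using this
  exact (((jet_eq_jet_iff_chart (k := k) hs (contMDiffAt_curve _) hz).1 (jet_curve _).symm).2).symm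

variable (I Q k) in
/-- The atlas of `T⁽ᵏ⁾Q` induced by the charts of `Q`. -/
def chartedSpaceCore : ChartedSpaceCore (Fin (k + 1) → E) (HigherTangentBundle I Q k) where
  atlas := range (jetChart k)
  chartAt z := jetChart k z.proj
  mem_chart_source z := mem_chart_source H z.proj
  chart_mem_atlas z := mem_range_self _
  open_source := by
    rintro _ _ ⟨x, rfl⟩ ⟨y, rfl⟩
    rw [jetChart_coordChange_source]
    exact (isOpen_coordChange_source x y).preimage (continuous_apply 0)
  continuousOn_toFun := by
    rintro _ _ ⟨x, rfl⟩ ⟨y, rfl⟩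
    exact (contDiffOn_jetChart_coordChange x y).continuousOn

instance : TopologicalSpace (HigherTangentBundle I Q k) :=
  (chartedSpaceCore I Q k).toTopologicalSpace

instance : ChartedSpace (Fin (k + 1) → E) (HigherTangentBundle I Q k) :=
  (chartedSpaceCore I Q k).toChartedSpace

instance : IsManifold 𝓘(ℝ, Fin (k + 1) → E) ∞ (HigherTangentBundle I Q k) := by
  refine isManifold_of_contDiffOn _ _ _ fun e e' he he' => ?_
  obtain ⟨_, he⟩ := mem_iUnion.1 he
  obtain ⟨⟨x, rfl⟩, rfl⟩ := mem_iUnion.1 he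
  obtain ⟨_, he'⟩ := mem_iUnion.1 he'
  obtain ⟨⟨y, rfl⟩, rfl⟩ := mem_iUnion.1 he'
  have h := contDiffOn_jetChart_coordChange (I := I) (k := k) x y
  simp only [modelWithCornersSelf_coe, modelWithCornersSelf_coe_symm, range_id, inter_univ,
    preimage_id, Function.id_comp, Function.comp_id]
  exact h

end HigherTangentBundle

end Jets

/-! ### Discretization maps -/

section Discretization

variable {E H : Type*} [NormedAddCommGroup E] [NormedSpace ℝ E] [TopologicalSpace H]
  (I : ModelWithCorners ℝ E H) {M : Type*} [TopologicalSpace M] [ChartedSpace H M]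

/-- Tangent vectors at `x` as vectors of the model space, by means of the preferred chart at `x`
(this is how Mathlib defines tangent spaces). -/
def tangentCoord (x : M) : TangentSpace I x ≃L[ℝ] E := ContinuousLinearEquiv.refl ℝ E

/-- The velocity `j₀⁽¹⁾c` at `0` of a curve `c`, as a point of the tangent bundle. -/
def velocity (c : ℝ → M) : TangentBundle I M :=
  ⟨c 0, mfderiv 𝓘(ℝ, ℝ) I c 0 (1 : ℝ)⟩

/-- `R` is a discretization map on `M`, defined on the neighbourhood `U` of the zero section
of `TM`. The tangent spaces of `M` at `(R 0ₓ).1`, `(R 0ₓ).2` and `x` coincide by `map_zero`;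
the last condition is written in coordinates of the preferred chart at this point. -/
structure IsDiscretizationMap [IsManifold I ∞ M] (U : Set (TangentBundle I M))
    (R : TangentBundle I M → M × M) : Prop where
  isOpen : IsOpen U
  zero_mem : ∀ x : M, (⟨x, 0⟩ : TangentBundle I M) ∈ U
  contMDiffOn : ContMDiffOn I.tangent (I.prod I) ∞ R U
  map_zero : ∀ x : M, R ⟨x, 0⟩ = (x, x)
  mfderiv_sub : ∀ (x : M) (v : E),
    tangentCoord I _ (mfderiv 𝓘(ℝ, E) I
        (fun w : E => (R ⟨x, (tangentCoord I x).symm w⟩).2) 0 v) -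
      tangentCoord I _ (mfderiv 𝓘(ℝ, E) I
        (fun w : E => (R ⟨x, (tangentCoord I x).symm w⟩).1) 0 v) = v

end Discretization

/-! ### The lift of a discretization map to the higher-order tangent bundle -/

section HigherLift

variable {E H : Type*} [NormedAddCommGroup E] [NormedSpace ℝ E] [TopologicalSpace H]
  (I : ModelWithCorners ℝ E H) {Q : Type*} [TopologicalSpace Q] [ChartedSpace H Q]
  {E' H' : Type*} [NormedAddCommGroup E'] [NormedSpace ℝ E'] [TopologicalSpace H']
  {I' : ModelWithCorners ℝ E' H'} {Q' : Type*} [TopologicalSpace Q'] [ChartedSpace H' Q']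

/-- `T⁽ᵏ⁾F : T⁽ᵏ⁾Q' → T⁽ᵏ⁾Q`, `j₀⁽ᵏ⁾c ↦ j₀⁽ᵏ⁾(F ∘ c)`, at the jets based at points around which
`F` is smooth. -/
def higherTangentMap (k : ℕ) (F : Q' → Q) (z : HigherTangentBundle I' Q' k) :
    HigherTangentBundle I Q k :=
  jet I k (F ∘ z.curve)

variable [I.Boundaryless] [IsManifold I ∞ Q] (k : ℕ)

/-- A two-parameter family `c` in `Q` with `X = j₀⁽¹⁾(s ↦ j₀⁽ᵏ⁾(t ↦ c s t))`: in the preferred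
chart, if `z` has Taylor coefficients `a` and `X` is the tangent vector `b` at `z`, then `c s` is
the polynomial curve with coefficients `a + s • b`. -/
def higherTangentFamily
    (X : TangentBundle 𝓘(ℝ, Fin (k + 1) → E) (HigherTangentBundle I Q k)) (s t : ℝ) : Q :=
  (extChartAt I X.proj.proj).symm
    (taylorCurve (extChartAt 𝓘(ℝ, Fin (k + 1) → E) X.proj X.proj +
      s • tangentCoord 𝓘(ℝ, Fin (k + 1) → E) X.proj X.2) t)

/-- The natural equivalence `Φ⁽ᵏ⁾ : T(T⁽ᵏ⁾Q) → T⁽ᵏ⁾(TQ)`, which sends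
`j₀⁽¹⁾(s ↦ j₀⁽ᵏ⁾(t ↦ c s t))` to `j₀⁽ᵏ⁾(t ↦ j₀⁽¹⁾(s ↦ c s t))`. -/
def higherFlip (X : TangentBundle 𝓘(ℝ, Fin (k + 1) → E) (HigherTangentBundle I Q k)) :
    HigherTangentBundle I.tangent (TangentBundle I Q) k :=
  jet I.tangent k fun t => velocity I fun s => higherTangentFamily I k X s t

/-- `R⁽ᵏ⁾ = T⁽ᵏ⁾R ∘ Φ⁽ᵏ⁾ : T(T⁽ᵏ⁾Q) → T⁽ᵏ⁾Q × T⁽ᵏ⁾Q`. -/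
def higherLift (R : TangentBundle I Q → Q × Q)
    (X : TangentBundle 𝓘(ℝ, Fin (k + 1) → E) (HigherTangentBundle I Q k)) :
    HigherTangentBundle I Q k × HigherTangentBundle I Q k :=
  (higherTangentMap I k (fun v => (R v).1) (higherFlip I k X),
    higherTangentMap I k (fun v => (R v).2) (higherFlip I k X))

/-- The domain of `R⁽ᵏ⁾` if `U` is the domain of `R`: the vectors `X` for which `Φ⁽ᵏ⁾ X` is a jet
of curves in `U`. -/
def higherLiftDomain (U : Set (TangentBundle I Q)) :
    Set (TangentBundle 𝓘(ℝ, Fin (k + 1) → E) (HigherTangentBundle I Q k)) :=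
  {X | (higherFlip I k X).proj ∈ U}

end HigherLift

/-! ### The cotangent bundle and the cotangent lift of a discretization map -/

section Cotangent

variable {E H : Type*} [NormedAddCommGroup E] [NormedSpace ℝ E] [TopologicalSpace H]
  (I : ModelWithCorners ℝ E H)

/-- The cotangent bundle `T*M`. -/
abbrev CotangentBundle (M : Type*) [TopologicalSpace M] [ChartedSpace H M] :=
  TotalSpace (E →L[ℝ] ℝ) (fun x : M => TangentSpace I x →L[ℝ] Trivial M ℝ x)

/-- The model of the manifold `T*M`. -/
abbrev cotangentModel : ModelWithCorners ℝ (E × (E →L[ℝ] ℝ)) (ModelProd H (E →L[ℝ] ℝ)) :=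
  I.prod 𝓘(ℝ, E →L[ℝ] ℝ)

variable {M : Type*} [TopologicalSpace M] [ChartedSpace H M]

/-- A covector at `x` in the coordinates of the preferred chart at `x`. -/
def CotangentBundle.momentum (z : CotangentBundle I M) : E →L[ℝ] ℝ :=
  ContinuousLinearMap.comp (z.2 : TangentSpace I z.proj →L[ℝ] ℝ)
    ((tangentCoord I z.proj).symm : E →L[ℝ] TangentSpace I z.proj)

/-- The covector at `x` with the given coordinates in the preferred chart at `x`. -/
def CotangentBundle.ofMomentum (x : M) (p : E →L[ℝ] ℝ) : CotangentBundle I M :=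
  ⟨x, p.comp (tangentCoord I x : TangentSpace I x →L[ℝ] E)⟩

theorem CotangentBundle.ofMomentum_momentum (z : CotangentBundle I M) :
    CotangentBundle.ofMomentum I z.proj (CotangentBundle.momentum I z) = z := rfl

theorem CotangentBundle.momentum_ofMomentum (x : M) (p : E →L[ℝ] ℝ) :
    CotangentBundle.momentum I (CotangentBundle.ofMomentum I x p) = p := rfl

variable [IsManifold I ∞ M]

/-- The canonical isomorphism `α : T(T*M) → T*(TM)`, in the induced coordinates
`(q, p, q̇, ṗ) ↦ (q, q̇, ṗ, p)`, that is, the covector `ṗ dq + p dq̇` at `(q, q̇)`. -/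
def tulczyjew (X : TangentBundle (cotangentModel I) (CotangentBundle I M)) :
    CotangentBundle I.tangent (TangentBundle I M) :=
  CotangentBundle.ofMomentum I.tangent
    (⟨X.proj.proj, (tangentCoord I X.proj.proj).symm
      (tangentCoord (cotangentModel I) X.proj X.2).1⟩ : TangentBundle I M)
    ((tangentCoord (cotangentModel I) X.proj X.2).2.coprod (CotangentBundle.momentum I X.proj))

/-- The map `Φ : T*M × T*M → T*(M × M)`, `(q₀, p₀; q₁, p₁) ↦ (q₀, q₁, -p₀, p₁)`. -/
def twistedProd :
    CotangentBundle I M × CotangentBundle I M ≃ CotangentBundle (I.prod I) (M × M) where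
  toFun z := CotangentBundle.ofMomentum (I.prod I) (z.1.proj, z.2.proj)
    ((-CotangentBundle.momentum I z.1).coprod (CotangentBundle.momentum I z.2))
  invFun β :=
    (CotangentBundle.ofMomentum I β.proj.1
        (-(CotangentBundle.momentum (I.prod I) β).comp (ContinuousLinearMap.inl ℝ E E)),
      CotangentBundle.ofMomentum I β.proj.2
        ((CotangentBundle.momentum (I.prod I) β).comp (ContinuousLinearMap.inr ℝ E E)))
  left_inv z := by
    simp only [CotangentBundle.momentum_ofMomentum, ContinuousLinearMap.coprod_comp_inl,
      ContinuousLinearMap.coprod_comp_inr, neg_neg]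
    rfl
  right_inv β := by
    simp only [CotangentBundle.momentum_ofMomentum, neg_neg]
    rw [← ContinuousLinearMap.comp_coprod, ContinuousLinearMap.coprod_inl_inr,
      ContinuousLinearMap.comp_id]
    rfl

/-- The cotangent lift `F̂ = T*(F⁻¹) : T*N → T*P` of a local diffeomorphism `F : N → P`, that is,
`βₓ ↦ βₓ ∘ (TₓF)⁻¹`. -/
def cotangentLiftOfMap {E₁ H₁ E₂ H₂ : Type*} [NormedAddCommGroup E₁] [NormedSpace ℝ E₁]
    [TopologicalSpace H₁] [NormedAddCommGroup E₂] [NormedSpace ℝ E₂] [TopologicalSpace H₂]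
    (I₁ : ModelWithCorners ℝ E₁ H₁) (I₂ : ModelWithCorners ℝ E₂ H₂)
    {N P : Type*} [TopologicalSpace N] [ChartedSpace H₁ N] [TopologicalSpace P]
    [ChartedSpace H₂ P] (F : N → P) (β : CotangentBundle I₁ N) : CotangentBundle I₂ P :=
  ⟨F β.proj, ContinuousLinearMap.comp (β.2 : TangentSpace I₁ β.proj →L[ℝ] ℝ)
    (mfderiv I₁ I₂ F β.proj).inverse⟩

/-- The cotangent lift `R^{T*} = Φ⁻¹ ∘ R̂ ∘ α : T(T*M) → T*M × T*M` of `R : TM → M × M`. -/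
def cotangentLift (R : TangentBundle I M → M × M)
    (X : TangentBundle (cotangentModel I) (CotangentBundle I M)) :
    CotangentBundle I M × CotangentBundle I M :=
  (twistedProd I).symm (cotangentLiftOfMap I.tangent (I.prod I) R (tulczyjew I X))

/-- The domain of `R^{T*}`: the vectors `X` for which `α X` is a covector at a point of the
domain `U` of `R` at which the tangent map of `R` is invertible. -/
def cotangentLiftDomain (U : Set (TangentBundle I M)) (R : TangentBundle I M → M × M) :
    Set (TangentBundle (cotangentModel I) (CotangentBundle I M)) :=
  {X | (tulczyjew I X).proj ∈ U ∧
    (mfderiv I.tangent (I.prod I) R (tulczyjew I X).proj).IsInvertible}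

end Cotangent

/-! ### Hamiltonian dynamics and symplectic integrators -/

section Hamiltonian

variable {E H : Type*} [NormedAddCommGroup E] [NormedSpace ℝ E] [TopologicalSpace H]
  (I : ModelWithCorners ℝ E H) {M : Type*} [TopologicalSpace M] [ChartedSpace H M]

variable (E) in
/-- The bilinear form `dq ∧ dp` on `E × E*`, that is, `((a, α), (b, β)) ↦ β a - α b`. -/
def stdSymplecticForm : (E × (E →L[ℝ] ℝ)) →L[ℝ] (E × (E →L[ℝ] ℝ)) →L[ℝ] ℝ :=
  let T : (E × (E →L[ℝ] ℝ)) →L[ℝ] (E × (E →L[ℝ] ℝ)) →L[ℝ] ℝ :=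
    ((ContinuousLinearMap.compL ℝ (E × (E →L[ℝ] ℝ)) E ℝ).flip
      (ContinuousLinearMap.fst ℝ E (E →L[ℝ] ℝ))).comp (ContinuousLinearMap.snd ℝ E (E →L[ℝ] ℝ))
  T.flip - T

theorem stdSymplecticForm_apply (X Y : E × (E →L[ℝ] ℝ)) :
    stdSymplecticForm E X Y = Y.2 X.1 - X.2 Y.1 := rfl

variable [IsManifold I ∞ M]

/-- The canonical symplectic form `ω = dq ∧ dp` of `T*M` at `z`. -/
def symplecticForm (z : CotangentBundle I M) (X Y : TangentSpace (cotangentModel I) z) : ℝ :=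
  stdSymplecticForm E (tangentCoord (cotangentModel I) z X) (tangentCoord (cotangentModel I) z Y)

/-- The Hamiltonian vector field `♯(dF)` of `F : T*M → ℝ`, that is, the vector field `X` with
`ω(X, Y) = dF(Y)` for all `Y`. -/
def hamiltonianVectorField (F : CotangentBundle I M → ℝ) (z : CotangentBundle I M) :
    TangentSpace (cotangentModel I) z :=
  (tangentCoord (cotangentModel I) z).symm ((stdSymplecticForm E).inverse
    (ContinuousLinearMap.comp (mfderiv (cotangentModel I) 𝓘(ℝ, ℝ) F z)
      ((tangentCoord (cotangentModel I) z).symm : E × (E →L[ℝ] ℝ) →L[ℝ] _)))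

theorem isInvertible_of_nondegenerate {V : Type*} [NormedAddCommGroup V] [NormedSpace ℝ V]
    [FiniteDimensional ℝ V] (f : V →L[ℝ] V →L[ℝ] ℝ) (hf : ∀ x, (∀ y, f x y = 0) → x = 0) :
    f.IsInvertible := by
  have hd : Module.finrank ℝ V = Module.finrank ℝ (V →L[ℝ] ℝ) := by
    rw [← (LinearMap.toContinuousLinearMap (𝕜 := ℝ) (E := V) (F' := ℝ)).finrank_eq]
    exact (Subspace.dual_finrank_eq).symm
  have hi : Function.Injective f := (injective_iff_map_eq_zero f).2 fun x hx => hf x fun y => by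
    rw [hx, zero_apply]
  exact ⟨(LinearEquiv.ofInjectiveOfFinrankEq f.toLinearMap hi hd).toContinuousLinearEquiv,
    ContinuousLinearMap.ext fun _ => rfl⟩

theorem isInvertible_stdSymplecticForm [FiniteDimensional ℝ E] :
    (stdSymplecticForm E).IsInvertible := by
  refine isInvertible_of_nondegenerate _ fun X hX => ?_
  simp only [stdSymplecticForm_apply] at hX
  refine Prod.ext ?_ ?_
  · by_contra hne
    have hn : ‖X.1‖ ≠ 0 := norm_ne_zero_iff.2 hne
    obtain ⟨g, -, hg⟩ := exists_dual_vector ℝ X.1 hn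
    have h := hX (0, g)
    simp only [map_zero, sub_zero] at h
    rw [hg] at h
    exact hn (by simpa using h)
  · ext b
    simpa using hX (b, 0)

theorem symplecticForm_hamiltonianVectorField [FiniteDimensional ℝ E]
    (F : CotangentBundle I M → ℝ) (z : CotangentBundle I M)
    (Y : TangentSpace (cotangentModel I) z) :
    symplecticForm I z (hamiltonianVectorField I F z) Y =
      mfderiv (cotangentModel I) 𝓘(ℝ, ℝ) F z Y := by
  obtain ⟨A, hA⟩ := isInvertible_stdSymplecticForm (E := E)
  unfold symplecticForm hamiltonianVectorField
  rw [ContinuousLinearEquiv.apply_symm_apply, ← hA, ContinuousLinearMap.inverse_equiv]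
  erw [A.apply_symm_apply]
  rfl

/-- The equation of the numerical scheme with time step `h` generated by a discretization map
`S : V → T*M × T*M` of `T*M` and a Hamiltonian `F`: there is `X = S⁻¹(z₀, z₁)` with
`X = h • ♯(dF)` at the base point of `X`. The base point of `X` is required to lie in `N`, to
select a local inverse of `S`. -/
def SchemeStep (V : Set (TangentBundle (cotangentModel I) (CotangentBundle I M)))
    (S : TangentBundle (cotangentModel I) (CotangentBundle I M) →
      CotangentBundle I M × CotangentBundle I M)
    (F : CotangentBundle I M → ℝ) (N : Set (CotangentBundle I M)) (h : ℝ)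
    (z₀ z₁ : CotangentBundle I M) : Prop :=
  ∃ X ∈ V, S X = (z₀, z₁) ∧ X.proj ∈ N ∧ X.2 = h • hamiltonianVectorField I F X.proj

/-- For the Hamiltonian `F`, the scheme of `S` is a symplectic integrator: around each point of
`T*M`, for small time steps `h`, the equation of the scheme has exactly one solution
`z₁ = ψ h z₀`, where `ψ` is smooth, approximates the flow of the Hamiltonian vector field to first
order in `h`, and each `ψ h` preserves the canonical symplectic form. -/
def GeneratesSymplecticIntegrator
    (V : Set (TangentBundle (cotangentModel I) (CotangentBundle I M)))
    (S : TangentBundle (cotangentModel I) (CotangentBundle I M) →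
      CotangentBundle I M × CotangentBundle I M)
    (F : CotangentBundle I M → ℝ) : Prop :=
  ∀ z : CotangentBundle I M, ∃ ε > (0 : ℝ), ∃ W N : Set (CotangentBundle I M),
    IsOpen W ∧ z ∈ W ∧ IsOpen N ∧ z ∈ N ∧
    ∃ ψ : ℝ → CotangentBundle I M → CotangentBundle I M,
      ContMDiffOn (𝓘(ℝ, ℝ).prod (cotangentModel I)) (cotangentModel I) ∞
        (fun p : ℝ × CotangentBundle I M => ψ p.1 p.2) (Ioo (-ε) ε ×ˢ W) ∧
      (∀ h ∈ Ioo (-ε) ε, ∀ z₀ ∈ W, ∀ z₁, SchemeStep I V S F N h z₀ z₁ ↔ z₁ = ψ h z₀) ∧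
      (∀ z₀ ∈ W, velocity (cotangentModel I) (fun h => ψ h z₀) =
        ⟨z₀, hamiltonianVectorField I F z₀⟩) ∧
      (∀ h ∈ Ioo (-ε) ε, ∀ z₀ ∈ W, ∀ Y Y' : TangentSpace (cotangentModel I) z₀,
        symplecticForm I (ψ h z₀)
          (mfderiv (cotangentModel I) (cotangentModel I) (ψ h) z₀ Y)
          (mfderiv (cotangentModel I) (cotangentModel I) (ψ h) z₀ Y') =
        symplecticForm I z₀ Y Y')

end Hamiltonian

end

/-! The proof has three independent parts: `T⁽ᵏ⁾` preserves discretization maps, the cotangent lift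
preserves them on any boundaryless manifold with complete model space, and the scheme of a cotangent
lift is symplectic on any manifold with finite-dimensional model space. The theorem applies the last
two to `T⁽ᵏ⁾Q`. Write `r` for the expression of the map in a chart. The conditions on it are `r(x,
0) = (x, x)` and `D(r² - r¹)(x, 0)(0, v) = v`.

Lift to `T⁽ᵏ⁾Q` (`IsDiscretizationMap.higherLift`). The charts of `T⁽ᵏ⁾Q` record Taylor
coefficients, and in them `R⁽ᵏ⁾` sends `(a, b)` to the coefficients of `t ↦ r(a(t), b(t))`, where
`a(t)` and `b(t)` are the polynomial curves. For `b = 0` this curve is `(a(t), a(t))`.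
Differentiation in `b` commutes with taking Taylor coefficients (`fderiv_taylorCoeffs_param`), so
the difference of the two components of the derivative consists of the coefficients of `D(r² -
r¹)(a(t), 0)(0, b(t)) = b(t)`, which are `b`.

Cotangent lift (`IsDiscretizationMap.cotangentLift`). The images `(q₀, p₀)`, `(q₁, p₁)` of `(q, p,
q̇, ṗ)` satisfy `(q₀, q₁) = r(q, q̇)` and `p₁ dq₁ - p₀ dq₀ = ṗ dq + p dq̇`, where `dq₀`, `dq₁` are
the derivatives of the components of `r` (`localCotangentLift_apply_fderiv`). At `q̇ = ṗ = 0` this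
forces `p₀ = p₁ = p`. Differentiating it on the zero section gives the condition on the derivative:
the second derivatives of `r` that appear cancel, because `D(r² - r¹)(x, 0)(0, v)` does not depend
on `x`.

Symplecticity (`stdSymplecticForm_localScheme`). For `(q̇, ṗ) = h ♯(dH)`, that is, `q̇ = h ∂H/∂p`
and `ṗ = -h ∂H/∂q`, the form `ṗ dq + p dq̇` is the differential of `h (p ∂H/∂p - H)`. Hence the two
maps from the base point `(q, p)` to `(q₀, p₀)` and to `(q₁, p₁)` pull the Liouville form back to
forms that differ by an exact one, and so they pull `ω` back to the same form. For `h = 0` the first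
map is the identity, so the inverse function theorem solves for the base point smoothly in `h` and
`z₀` (`exists_local_solution`). The step `ψ_h` is the second map after the inverse of the first, so
it preserves `ω`. Its derivative at `h = 0` comes from the discretization condition of the lift
(`hasDerivAt_localScheme`).

The remaining work is the passage to fixed charts. Tangent vectors and covectors at `x` are given in
the preferred chart at `x`, which varies with `x`. `coordDeriv` converts them to one chart, and
`tulczyjew_coord`, `symplecticForm_coord`, `hamiltonianVectorField_coord`, `cotangentLift_coord` and
`higherLift_coord` show that each construction has the expected expression there. -/

noncomputable section

/-! ### Changes of coordinates -/

section CoordDeriv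

variable {E H : Type*} [NormedAddCommGroup E] [NormedSpace ℝ E] [TopologicalSpace H]
  (I : ModelWithCorners ℝ E H) {M : Type*} [TopologicalSpace M] [ChartedSpace H M]
  {E' G : Type*} [NormedAddCommGroup E'] [NormedSpace ℝ E'] [TopologicalSpace G]
  (J : ModelWithCorners ℝ E' G) {N : Type*} [TopologicalSpace N] [ChartedSpace G N]

/-- The derivative at the point `m` of the change of coordinates from the chart at `x` to the chart
at `y`. -/
def coordDeriv (x y m : M) : E →L[ℝ] E :=
  fderiv ℝ (extChartAt I y ∘ (extChartAt I x).symm) (extChartAt I x m)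

/-- The derivative of a map, in the coordinates of the preferred charts at a point and at its
image. -/
def mfderivCoord (f : M → N) (m : M) :
    E →L[ℝ] E' := mfderiv I J f m

variable {I J}
variable [I.Boundaryless] [J.Boundaryless]

theorem eventually_mem_extChartAt {x y m : M} (hx : m ∈ (extChartAt I x).source)
    (hy : m ∈ (extChartAt I y).source) :
    ∀ᶠ q in 𝓝 (extChartAt I x m),
      q ∈ (extChartAt I x).target ∧ (extChartAt I x).symm q ∈ (extChartAt I y).source := by
  refine (HigherTangentBundle.isOpen_coordChange_source (I := I) x y).mem_nhds
    ⟨(extChartAt I x).map_source hx, ?_⟩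
  rw [mem_preimage]
  change (extChartAt I x).symm (extChartAt I x m) ∈ _
  rwa [(extChartAt I x).left_inv hx]

theorem coordDeriv_self {x m : M} (hm : m ∈ (extChartAt I x).source) :
    coordDeriv I x x m = ContinuousLinearMap.id ℝ E := by
  have h : extChartAt I x ∘ (extChartAt I x).symm =ᶠ[𝓝 (extChartAt I x m)] id := by
    filter_upwards [(isOpen_extChartAt_target (I := I) x).mem_nhds
      ((extChartAt I x).map_source hm)] with q hq
    exact (extChartAt I x).right_inv hq
  rw [coordDeriv, h.fderiv_eq, fderiv_id]

variable [IsManifold I ∞ M] [IsManifold J ∞ N]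

theorem contDiffAt_coordChange {x y m : M} (hx : m ∈ (extChartAt I x).source)
    (hy : m ∈ (extChartAt I y).source) :
    ContDiffAt ℝ ∞ (extChartAt I y ∘ (extChartAt I x).symm) (extChartAt I x m) :=
  (contDiffOn_ext_coord_change y x).contDiffAt (eventually_mem_extChartAt hx hy)

theorem coordDeriv_comp {x y w m : M} (hx : m ∈ (extChartAt I x).source)
    (hy : m ∈ (extChartAt I y).source) (hw : m ∈ (extChartAt I w).source) :
    (coordDeriv I y w m).comp (coordDeriv I x y m) = coordDeriv I x w m := by
  have h : extChartAt I w ∘ (extChartAt I x).symm =ᶠ[𝓝 (extChartAt I x m)]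
      (extChartAt I w ∘ (extChartAt I y).symm) ∘ (extChartAt I y ∘ (extChartAt I x).symm) := by
    filter_upwards [eventually_mem_extChartAt hx hy] with q hq
    simp only [Function.comp_apply]
    rw [(extChartAt I y).left_inv hq.2]
  have hval : (extChartAt I y ∘ (extChartAt I x).symm) (extChartAt I x m) = extChartAt I y m := by
    rw [Function.comp_apply, (extChartAt I x).left_inv hx]
  have l := fderiv_comp (extChartAt I x m) (g := extChartAt I w ∘ (extChartAt I y).symm)
    (f := extChartAt I y ∘ (extChartAt I x).symm)
    (by rw [hval]; exact (contDiffAt_coordChange hy hw).differentiableAt (by simp))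
    ((contDiffAt_coordChange hx hy).differentiableAt (by simp))
  unfold coordDeriv
  rw [h.fderiv_eq, l, hval]

theorem coordDeriv_comp_symm {x y m : M} (hx : m ∈ (extChartAt I x).source)
    (hy : m ∈ (extChartAt I y).source) :
    (coordDeriv I y x m).comp (coordDeriv I x y m) = ContinuousLinearMap.id ℝ E := by
  rw [coordDeriv_comp hx hy hx, coordDeriv_self hx]

theorem coordDeriv_coordDeriv {x y m : M} (hx : m ∈ (extChartAt I x).source)
    (hy : m ∈ (extChartAt I y).source) (v : E) :
    coordDeriv I y x m (coordDeriv I x y m v) = v :=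
  DFunLike.congr_fun (coordDeriv_comp_symm hx hy) v

theorem isInvertible_coordDeriv {x y m : M} (hx : m ∈ (extChartAt I x).source)
    (hy : m ∈ (extChartAt I y).source) : (coordDeriv I x y m).IsInvertible :=
  ContinuousLinearMap.IsInvertible.of_inverse (coordDeriv_comp_symm hy hx)
    (coordDeriv_comp_symm hx hy)

omit [J.Boundaryless] in
theorem contDiffAt_written {f : M → N} {m x : M} {y : N} (hf : ContMDiffAt I J ∞ f m)
    (hx : m ∈ (extChartAt I x).source) (hy : f m ∈ (extChartAt J y).source) :
    ContDiffAt ℝ ∞ (extChartAt J y ∘ f ∘ (extChartAt I x).symm) (extChartAt I x m) := by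
  rw [← contMDiffAt_iff_contDiffAt]
  have h1 : ContMDiffAt 𝓘(ℝ, E) I ∞ (extChartAt I x).symm (extChartAt I x m) :=
    (contMDiffOn_extChartAt_symm x).contMDiffAt
      ((isOpen_extChartAt_target x).mem_nhds ((extChartAt I x).map_source hx))
  have hm : (extChartAt I x).symm (extChartAt I x m) = m := (extChartAt I x).left_inv hx
  refine ContMDiffAt.comp (I' := J) _ ?_ (ContMDiffAt.comp (I' := I) _ (by rwa [hm]) h1)
  simp only [Function.comp_apply, hm]
  exact contMDiffAt_extChartAt' (by rwa [extChartAt_source] at hy)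

/-- Both sides are, by the chain rule, the derivative of `f` read from the preferred chart at `m` to
the chart at `y`. This is the dictionary between `mfderiv`, which uses preferred charts, and
derivatives in fixed charts. -/
theorem fderiv_written_comp {f : M → N} {m x : M} {y : N} (hf : ContMDiffAt I J ∞ f m)
    (hx : m ∈ (extChartAt I x).source) (hy : f m ∈ (extChartAt J y).source) :
    (fderiv ℝ (extChartAt J y ∘ f ∘ (extChartAt I x).symm) (extChartAt I x m)).comp
      (coordDeriv I m x m) = (coordDeriv J (f m) y (f m)).comp (mfderivCoord I J f m) := by
  have hm := mem_extChartAt_source (I := I) m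
  have hfm := mem_extChartAt_source (I := J) (f m)
  have hd : MDifferentiableAt I J f m := hf.mdifferentiableAt (by simp)
  have h0 : mfderivCoord I J f m =
      fderiv ℝ (extChartAt J (f m) ∘ f ∘ (extChartAt I m).symm) (extChartAt I m m) := by
    have h : HasFDerivWithinAt (extChartAt J (f m) ∘ f ∘ (extChartAt I m).symm)
      (mfderivCoord I J f m) (range I) (extChartAt I m m) := hd.hasMFDerivAt.2
    rw [I.range_eq_univ, hasFDerivWithinAt_univ] at h
    exact h.fderiv.symm
  have e1 : (extChartAt I x ∘ (extChartAt I m).symm) (extChartAt I m m) = extChartAt I x m := by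
    simp
  have e2 : (extChartAt J (f m) ∘ f ∘ (extChartAt I m).symm) (extChartAt I m m) =
      extChartAt J (f m) (f m) := by simp
  rw [h0]
  unfold coordDeriv
  have l1 := fderiv_comp (extChartAt I m m)
    (g := extChartAt J y ∘ f ∘ (extChartAt I x).symm) (f := extChartAt I x ∘ (extChartAt I m).symm)
    (by rw [e1]; exact (contDiffAt_written hf hx hy).differentiableAt (by simp))
    ((contDiffAt_coordChange hm hx).differentiableAt (by simp))
  have l2 := fderiv_comp (extChartAt I m m)
    (f := extChartAt J (f m) ∘ f ∘ (extChartAt I m).symm)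
    (g := extChartAt J y ∘ (extChartAt J (f m)).symm)
    (by rw [e2]; exact (contDiffAt_coordChange hfm hy).differentiableAt (by simp))
    ((contDiffAt_written hf hm hfm).differentiableAt (by simp))
  rw [e1] at l1
  rw [e2] at l2
  rw [← l1, ← l2]
  refine Filter.EventuallyEq.fderiv_eq ?_
  have c1 : ContinuousAt (extChartAt I m).symm (extChartAt I m m) :=
    continuousAt_extChartAt_symm m
  have c2 : ContinuousAt (f ∘ (extChartAt I m).symm) (extChartAt I m m) :=
    ContinuousAt.comp (by simpa using hf.continuousAt) c1
  filter_upwards [c1 ((isOpen_extChartAt_source (I := I) x).mem_nhds (by simpa using hx)),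
    c2 ((isOpen_extChartAt_source (I := J) (f m)).mem_nhds (by simp))] with q h1 h2
  simp only [mem_preimage, Function.comp_apply] at h1 h2 ⊢
  rw [(extChartAt I x).left_inv h1, (extChartAt J (f m)).left_inv h2]

end CoordDeriv

/-! ### Charts of tangent and cotangent bundles -/

section BundleCharts

variable {E H : Type*} [NormedAddCommGroup E] [NormedSpace ℝ E] [TopologicalSpace H]
  {I : ModelWithCorners ℝ E H} {M : Type*} [TopologicalSpace M] [ChartedSpace H M]
  [IsManifold I ∞ M]

theorem mem_tangent_extChartAt_source {p v : TangentBundle I M} :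
    v ∈ (extChartAt I.tangent p).source ↔ v.proj ∈ (extChartAt I p.proj).source := by
  rw [extChartAt_source, extChartAt_source]
  exact TangentBundle.mem_chart_source_iff v p

theorem mem_tangent_extChartAt_target {p : TangentBundle I M} {w : E × E} :
    w ∈ (extChartAt I.tangent p).target ↔ w.1 ∈ (extChartAt I p.proj).target := by
  rw [FiberBundle.extChartAt_target]
  simp only [mem_prod, mem_univ, and_true, mem_inter_iff, and_iff_left_iff_imp]
  intro h
  have := (extChartAt I p.proj).map_target h
  rwa [extChartAt_source] at this

variable [I.Boundaryless]

/-- A tangent vector at `v.proj` is stored in the preferred chart there, so the fibre coordinate in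
the chart of `p` is obtained by one change of coordinates at the base point. Only the base point of
`p` matters. -/
theorem tangent_extChartAt_apply (p v : TangentBundle I M) :
    extChartAt I.tangent p v =
      (extChartAt I p.proj v.proj, coordDeriv I v.proj p.proj v.proj v.2) := by
  rw [FiberBundle.extChartAt]
  unfold coordDeriv
  rw [← fderivWithin_univ, ← I.range_eq_univ]
  rfl

theorem tangent_extChartAt_symm_apply (p : TangentBundle I M) {w : E × E}
    (hw : w.1 ∈ (extChartAt I p.proj).target) :
    (extChartAt I.tangent p).symm w =
      ⟨(extChartAt I p.proj).symm w.1, coordDeriv I p.proj ((extChartAt I p.proj).symm w.1)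
        ((extChartAt I p.proj).symm w.1) w.2⟩ := by
  have hm := (extChartAt I p.proj).map_target hw
  have hm' := mem_extChartAt_source (I := I) ((extChartAt I p.proj).symm w.1)
  -- The chart is injective on its source, so the two vectors may be compared by their coordinates.
  refine (extChartAt I.tangent p).injOn ((extChartAt I.tangent p).map_target
    (mem_tangent_extChartAt_target.2 hw)) (mem_tangent_extChartAt_source.2 hm) ?_
  rw [(extChartAt I.tangent p).right_inv (mem_tangent_extChartAt_target.2 hw),
    tangent_extChartAt_apply]
  refine Prod.ext ((extChartAt I p.proj).right_inv hw).symm ?_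
  exact (coordDeriv_coordDeriv hm hm' w.2).symm

omit [I.Boundaryless] in
theorem mem_cotangent_extChartAt_source {p v : CotangentBundle I M} :
    v ∈ (extChartAt (cotangentModel I) p).source ↔ v.proj ∈ (extChartAt I p.proj).source := by
  rw [extChartAt_source, extChartAt_source, FiberBundle.chartedSpace_chartAt]
  simp only [mfld_simps]
  exact ⟨fun h => h.2, fun h => ⟨⟨h, mem_univ _⟩, h⟩⟩

omit [I.Boundaryless] in
theorem mem_cotangent_extChartAt_target {p : CotangentBundle I M} {w : E × (E →L[ℝ] ℝ)} :
    w ∈ (extChartAt (cotangentModel I) p).target ↔ w.1 ∈ (extChartAt I p.proj).target := by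
  rw [FiberBundle.extChartAt_target]
  simp only [mem_prod, mem_univ, and_true, mem_inter_iff, and_iff_left_iff_imp]
  intro h
  have := (extChartAt I p.proj).map_target h
  rw [extChartAt_source] at this
  exact ⟨this, mem_univ _⟩

/-- Covectors are contravariant: a vector given in the chart of `p` is first moved to the preferred
chart at `z.proj`, where the momentum of `z` is evaluated on it. -/
theorem cotangent_extChartAt_apply (p z : CotangentBundle I M)
    (hz : z.proj ∈ (extChartAt I p.proj).source) :
    extChartAt (cotangentModel I) p z = (extChartAt I p.proj z.proj,
      (CotangentBundle.momentum I z).comp (coordDeriv I p.proj z.proj z.proj)) := by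
  rw [FiberBundle.extChartAt]
  refine Prod.ext rfl ?_
  have h := TangentBundle.symmL_trivializationAt_eq_core (I := I) (b₀ := p.proj) (b := z.proj)
    (by rwa [extChartAt_source] at hz)
  have h2 : (tangentBundleCore I M).coordChange (achart H p.proj) (achart H z.proj) z.proj
    = coordDeriv I p.proj z.proj z.proj := by
    rw [tangentBundleCore_coordChange_achart, I.range_eq_univ, fderivWithin_univ]
    rfl
  ext v
  have h3 := DFunLike.congr_fun h v
  rw [h2] at h3
  change (trivializationAt ℝ (Trivial M ℝ) p.proj).continuousLinearMapAt ℝ z.proj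
    (z.2 ((trivializationAt E (TangentSpace I) p.proj).symmL ℝ z.proj v)) = z.2 _
  rw [h3]
  exact DFunLike.congr_fun (Trivial.continuousLinearMapAt_trivialization ℝ M ℝ z.proj) _

theorem cotangent_extChartAt_symm_apply (p : CotangentBundle I M) {w : E × (E →L[ℝ] ℝ)}
    (hw : w.1 ∈ (extChartAt I p.proj).target) :
    (extChartAt (cotangentModel I) p).symm w =
      CotangentBundle.ofMomentum I ((extChartAt I p.proj).symm w.1)
        (w.2.comp (coordDeriv I ((extChartAt I p.proj).symm w.1) p.proj
        ((extChartAt I p.proj).symm w.1))) := by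
  have hm := (extChartAt I p.proj).map_target hw
  have hm' := mem_extChartAt_source (I := I) ((extChartAt I p.proj).symm w.1)
  refine (extChartAt (cotangentModel I) p).injOn ((extChartAt (cotangentModel I) p).map_target
    (mem_cotangent_extChartAt_target.2 hw)) (mem_cotangent_extChartAt_source.2 hm) ?_
  rw [(extChartAt (cotangentModel I) p).right_inv (mem_cotangent_extChartAt_target.2 hw),
    cotangent_extChartAt_apply _ _ hm, CotangentBundle.momentum_ofMomentum]
  refine Prod.ext ((extChartAt I p.proj).right_inv hw).symm ?_
  change w.2 = (w.2.comp (coordDeriv I ((extChartAt I p.proj).symm w.1) p.proj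
        ((extChartAt I p.proj).symm w.1))).comp (coordDeriv I p.proj
        ((extChartAt I p.proj).symm w.1) ((extChartAt I p.proj).symm w.1))
  rw [ContinuousLinearMap.comp_assoc, coordDeriv_comp_symm hm hm', ContinuousLinearMap.comp_id]

theorem coordDeriv_prod {M' E' H' : Type*} [NormedAddCommGroup E'] [NormedSpace ℝ E']
    [TopologicalSpace H'] {I' : ModelWithCorners ℝ E' H'} [TopologicalSpace M']
    [ChartedSpace H' M'] [IsManifold I' ∞ M'] [I'.Boundaryless] {x y m : M × M'}
    (hx : m ∈ (extChartAt (I.prod I') x).source) (hy : m ∈ (extChartAt (I.prod I') y).source) :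
    coordDeriv (I.prod I') x y m =
      (coordDeriv I x.1 y.1 m.1).prodMap (coordDeriv I' x.2 y.2 m.2) := by
  simp only [extChartAt_prod, PartialEquiv.prod_source, mem_prod] at hx hy
  have h1 := ((contDiffAt_coordChange hx.1 hy.1).differentiableAt (by simp)).hasFDerivAt
  have h2 := ((contDiffAt_coordChange hx.2 hy.2).differentiableAt (by simp)).hasFDerivAt
  have h : HasFDerivAt (extChartAt (I.prod I') y ∘ (extChartAt (I.prod I') x).symm)
      ((coordDeriv I x.1 y.1 m.1).prodMap (coordDeriv I' x.2 y.2 m.2))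
      (extChartAt (I.prod I') x m) := by
    rw [extChartAt_prod, extChartAt_prod]
    exact HasFDerivAt.prodMap (extChartAt I x.1 m.1, extChartAt I' x.2 m.2) h1 h2
  exact h.fderiv

end BundleCharts

/-! ### Canonical transformations of vector spaces -/

section LocalSymplectic

variable {E V F : Type*} [NormedAddCommGroup E] [NormedSpace ℝ E] [NormedAddCommGroup V]
  [NormedSpace ℝ V] [NormedAddCommGroup F] [NormedSpace ℝ F]

theorem fderiv_fderiv_symm {f : V → F} {z : V} (hf : ContDiffAt ℝ ∞ f z) (u v : V) :
    fderiv ℝ (fderiv ℝ f) z u v = fderiv ℝ (fderiv ℝ f) z v u :=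
  (hf.isSymmSndFDerivAt (by
    rw [minSmoothness_of_isRCLikeNormedField]; exact WithTop.coe_le_coe.2 (le_top : (2 : ℕ∞) ≤ ⊤))) u v

theorem ContDiffAt.hasFDerivAt_fderiv {f : V → F} {z : V} (hf : ContDiffAt ℝ ∞ f z) :
    HasFDerivAt (fderiv ℝ f) (fderiv ℝ (fderiv ℝ f) z) z :=
  ((hf.fderiv_right (m := ∞) (by simp)).differentiableAt (by simp)).hasFDerivAt

/-- The derivative of the pullback of the Liouville form `p dq` by `Z`. -/
theorem hasFDerivAt_pullback_liouville {Z : V → E × (E →L[ℝ] ℝ)} {z : V}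
    (hZ : ContDiffAt ℝ ∞ Z z) (u v : V) :
    fderiv ℝ (fun y => (Z y).2 (fderiv ℝ Z y v).1) z u =
      (fderiv ℝ Z z u).2 (fderiv ℝ Z z v).1 + (Z z).2 (fderiv ℝ (fderiv ℝ Z) z u v).1 := by
  have h1 := (hZ.differentiableAt (by simp)).hasFDerivAt
  have h2 := hZ.hasFDerivAt_fderiv
  have h := h1.snd.clm_apply ((h2.clm_apply (hasFDerivAt_const v z)).fst)
  rw [h.fderiv]
  simp [add_comm]

theorem differentiableAt_pullback_liouville {Z : V → E × (E →L[ℝ] ℝ)} {z : V}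
    (hZ : ContDiffAt ℝ ∞ Z z) (v : V) :
    DifferentiableAt ℝ (fun y => (Z y).2 (fderiv ℝ Z y v).1) z :=
  ((hZ.differentiableAt (by simp)).hasFDerivAt.snd.clm_apply
    ((hZ.hasFDerivAt_fderiv.clm_apply (hasFDerivAt_const v z)).fst)).differentiableAt

/-- If the pullbacks of the Liouville form by two maps differ by an exact form, then the pullbacks
of the symplectic form coincide. -/
theorem stdSymplecticForm_eq_of_liouville {Z₀ Z₁ : V → E × (E →L[ℝ] ℝ)} {S : V → ℝ} {z : V}
    (h₀ : ContDiffAt ℝ ∞ Z₀ z) (h₁ : ContDiffAt ℝ ∞ Z₁ z) (hS : ContDiffAt ℝ ∞ S z)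
    (h : ∀ᶠ y in 𝓝 z, ∀ v,
      (Z₁ y).2 (fderiv ℝ Z₁ y v).1 = (Z₀ y).2 (fderiv ℝ Z₀ y v).1 + fderiv ℝ S y v) (u v : V) :
    stdSymplecticForm E (fderiv ℝ Z₁ z u) (fderiv ℝ Z₁ z v) =
      stdSymplecticForm E (fderiv ℝ Z₀ z u) (fderiv ℝ Z₀ z v) := by
  have key : ∀ u v : V,
      (fderiv ℝ Z₁ z u).2 (fderiv ℝ Z₁ z v).1 + (Z₁ z).2 (fderiv ℝ (fderiv ℝ Z₁) z u v).1 =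
      (fderiv ℝ Z₀ z u).2 (fderiv ℝ Z₀ z v).1 + (Z₀ z).2 (fderiv ℝ (fderiv ℝ Z₀) z u v).1 +
        fderiv ℝ (fderiv ℝ S) z u v := by
    intro u v
    have hS2 : HasFDerivAt (fun y => fderiv ℝ S y v) _ z :=
      hS.hasFDerivAt_fderiv.clm_apply (hasFDerivAt_const v z)
    have e : (fun y => (Z₁ y).2 (fderiv ℝ Z₁ y v).1) =ᶠ[𝓝 z]
        (fun y => (Z₀ y).2 (fderiv ℝ Z₀ y v).1) + fun y => fderiv ℝ S y v := by
      filter_upwards [h] with y hy using hy v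
    rw [← hasFDerivAt_pullback_liouville h₁, ← hasFDerivAt_pullback_liouville h₀, e.fderiv_eq,
      fderiv_add (differentiableAt_pullback_liouville h₀ v) hS2.differentiableAt, hS2.fderiv]
    simp
  -- Antisymmetrizing `key` in `u` and `v` gives the exterior derivative. All second derivatives are
  -- symmetric and drop out, leaving `dq ∧ dp`.
  have a := key u v
  have b := key v u
  rw [fderiv_fderiv_symm h₁ v u, fderiv_fderiv_symm h₀ v u, fderiv_fderiv_symm hS v u] at b
  simp only [stdSymplecticForm_apply]
  linarith

/-- Compatibility of the changes of coordinates `K` of `T*E` and `G` of `TE` induced by a change of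
coordinates `g` of `E`. -/
theorem coprod_comp_fderiv_of_canonical {g : E → E} {K : E × (E →L[ℝ] ℝ) → E × (E →L[ℝ] ℝ)}
    {q : E} {p : E →L[ℝ] ℝ} (hg : ContDiffAt ℝ ∞ g q) (hK : ContDiffAt ℝ ∞ K (q, p))
    (h1 : ∀ᶠ y in 𝓝 (q, p), (K y).1 = g y.1)
    (h2 : ∀ᶠ y in 𝓝 (q, p), (K y).2.comp (fderiv ℝ g y.1) = y.2)
    {G : E × E → E × E} (q' : E) (p' : E →L[ℝ] ℝ)
    (hG : G =ᶠ[𝓝 (q, q')] fun w => (g w.1, fderiv ℝ g w.1 w.2)) :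
    (fderiv ℝ K (q, p) (q', p')).1 = fderiv ℝ g q q' ∧
    ((fderiv ℝ K (q, p) (q', p')).2.coprod (K (q, p)).2).comp (fderiv ℝ G (q, q')) =
      p'.coprod p := by
  have hK' := (hK.differentiableAt (by simp)).hasFDerivAt
  have hg' := (hg.differentiableAt (by simp)).hasFDerivAt
  have hfst : HasFDerivAt (fun y : E × (E →L[ℝ] ℝ) => g y.1)
      ((fderiv ℝ g q).comp (ContinuousLinearMap.fst ℝ E (E →L[ℝ] ℝ))) (q, p) :=
    HasFDerivAt.comp (q, p) hg' hasFDerivAt_fst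
  have e1 := (hfst.congr_of_eventuallyEq h1).unique hK'.fst
  have hD : HasFDerivAt (fun y : E × (E →L[ℝ] ℝ) => fderiv ℝ g y.1)
      ((fderiv ℝ (fderiv ℝ g) q).comp (ContinuousLinearMap.fst ℝ E (E →L[ℝ] ℝ))) (q, p) :=
    HasFDerivAt.comp (q, p) hg.hasFDerivAt_fderiv hasFDerivAt_fst
  have e2 := ((hK'.snd.clm_comp hD).congr_of_eventuallyEq
    (h2.mono fun y hy => hy.symm)).unique hasFDerivAt_snd
  have p2 := h2.self_of_nhds
  have hGd : HasFDerivAt (fun w : E × E => (g w.1, fderiv ℝ g w.1 w.2)) _ (q, q') :=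
    HasFDerivAt.prodMk (hg'.comp (q, q') hasFDerivAt_fst)
      ((hg.hasFDerivAt_fderiv.comp (q, q') hasFDerivAt_fst).clm_apply hasFDerivAt_snd)
  refine ⟨by simpa using (DFunLike.congr_fun e1 (q', p')).symm, ?_⟩
  rw [(hGd.congr_of_eventuallyEq hG).fderiv]
  ext a
  -- This is the derivative of `h2` in the direction `(q', p')`. It contains `D²g(q', a)`, while the
  -- derivative of `G` produces `D²g(a, q')`; the two agree by symmetry.
  · have e3 := DFunLike.congr_fun (DFunLike.congr_fun e2 (q', p')) a
    have s := fderiv_fderiv_symm hg a q'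
    simp at e3 ⊢
    rw [s, ← e3, add_comm]
  · simpa using DFunLike.congr_fun p2 a

end LocalSymplectic

/-! ### Cotangent lifts of discretization maps in a vector space -/

section LocalLift

variable {E : Type*} [NormedAddCommGroup E] [NormedSpace ℝ E]

/-- The cotangent lift of a map `r : E × E → E × E` in coordinates. -/
def localCotangentLift (r : E × E → E × E)
    (y : (E × (E →L[ℝ] ℝ)) × (E × (E →L[ℝ] ℝ))) :
    (E × (E →L[ℝ] ℝ)) × (E × (E →L[ℝ] ℝ)) :=
  (((r (y.1.1, y.2.1)).1, -(((y.2.2.coprod y.1.2).comp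
      (fderiv ℝ r (y.1.1, y.2.1)).inverse).comp (ContinuousLinearMap.inl ℝ E E))),
    ((r (y.1.1, y.2.1)).2, ((y.2.2.coprod y.1.2).comp
      (fderiv ℝ r (y.1.1, y.2.1)).inverse).comp (ContinuousLinearMap.inr ℝ E E)))

variable {r : E × E → E × E} {y : (E × (E →L[ℝ] ℝ)) × (E × (E →L[ℝ] ℝ))}

/-- Inversion of continuous linear maps is smooth at invertible ones, over a complete space.
Everything else in the formula is a composition of smooth maps with linear operations. -/
theorem contDiffAt_localCotangentLift [CompleteSpace E]
    (hr : ContDiffAt ℝ ∞ r (y.1.1, y.2.1)) (hi : (fderiv ℝ r (y.1.1, y.2.1)).IsInvertible) :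
    ContDiffAt ℝ ∞ (localCotangentLift r) y := by
  have hv : ContDiffAt ℝ ∞ (fun y : (E × (E →L[ℝ] ℝ)) × (E × (E →L[ℝ] ℝ)) => (y.1.1, y.2.1)) y := by
    fun_prop
  have h1 : ContDiffAt ℝ ∞ (fun y : (E × (E →L[ℝ] ℝ)) × (E × (E →L[ℝ] ℝ)) => r (y.1.1, y.2.1)) y :=
    hr.comp y hv
  have h2 : ContDiffAt ℝ ∞ (fun y : (E × (E →L[ℝ] ℝ)) × (E × (E →L[ℝ] ℝ)) =>
      fderiv ℝ r (y.1.1, y.2.1)) y :=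
    (hr.fderiv_right (m := ∞) (by simp)).comp y hv
  have h3 : ContDiffAt ℝ ∞ (fun y : (E × (E →L[ℝ] ℝ)) × (E × (E →L[ℝ] ℝ)) =>
      (fderiv ℝ r (y.1.1, y.2.1)).inverse) y := by
    obtain ⟨e, he⟩ := hi
    have := contDiffAt_map_inverse (𝕜 := ℝ) (n := ∞) e
    rw [he] at this
    exact this.comp y h2
  have h4 : ContDiffAt ℝ ∞ (fun y : (E × (E →L[ℝ] ℝ)) × (E × (E →L[ℝ] ℝ)) =>
      y.2.2.coprod y.1.2) y := by
    have : (fun y : (E × (E →L[ℝ] ℝ)) × (E × (E →L[ℝ] ℝ)) => y.2.2.coprod y.1.2) = fun y =>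
        y.2.2.comp (ContinuousLinearMap.fst ℝ E E) +
          y.1.2.comp (ContinuousLinearMap.snd ℝ E E) := by
      funext y; ext <;> simp
    rw [this]
    exact (contDiffAt_snd.snd.clm_comp contDiffAt_const).add
      (contDiffAt_fst.snd.clm_comp contDiffAt_const)
  have h5 := h4.clm_comp h3
  exact (h1.fst.prodMk (h5.clm_comp contDiffAt_const).neg).prodMk
    (h1.snd.prodMk (h5.clm_comp contDiffAt_const))

/-- The covector `(-p₀, p₁)` is `(ṗ, p) ∘ (Dr)⁻¹`, and evaluating it on `Dr w` cancels the inverse.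
The momentum identities of the lift are all derived from this one, never from the inverse itself. -/
theorem localCotangentLift_apply_fderiv (hi : (fderiv ℝ r (y.1.1, y.2.1)).IsInvertible)
    (w : E × E) :
    (localCotangentLift r y).2.2 (fderiv ℝ r (y.1.1, y.2.1) w).2 -
      (localCotangentLift r y).1.2 (fderiv ℝ r (y.1.1, y.2.1) w).1 =
      y.2.2 w.1 + y.1.2 w.2 := by
  obtain ⟨e, he⟩ := hi
  unfold localCotangentLift
  rw [← he, ContinuousLinearMap.inverse_equiv]
  simp only [ContinuousLinearMap.coe_comp, Function.comp_apply, neg_apply,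
    sub_neg_eq_add, ← map_add]
  simp

theorem eventually_isInvertible_fderiv {V F : Type*} [NormedAddCommGroup V] [NormedSpace ℝ V]
    [CompleteSpace V] [NormedAddCommGroup F] [NormedSpace ℝ F] {f : V → F} {v : V}
    (hf : ContDiffAt ℝ ∞ f v) (hi : (fderiv ℝ f v).IsInvertible) :
    ∀ᶠ w in 𝓝 v, (fderiv ℝ f w).IsInvertible := by
  obtain ⟨e, he⟩ := hi
  have hc : ContinuousAt (fderiv ℝ f) v := (hf.fderiv_right (m := ∞) (by simp)).continuousAt
  exact hc (he ▸ e.nhds)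

/-- The conditions on the coordinate expression `r` of a discretization map, at the zero vector
at `q`. -/
structure IsLocalDiscretization (r : E × E → E × E) (q : E) : Prop where
  contDiffAt : ContDiffAt ℝ ∞ r (q, 0)
  apply_zero : ∀ᶠ x in 𝓝 q, r (x, 0) = (x, x)
  fderiv_sub : ∀ᶠ x in 𝓝 q, ∀ v : E, (fderiv ℝ r (x, 0) (0, v)).2 - (fderiv ℝ r (x, 0) (0, v)).1 = v

namespace IsLocalDiscretization

variable {q : E}

/-- The identity `r(x, 0) = (x, x)`, differentiated in `x`. -/
theorem fderiv_left (h : IsLocalDiscretization r q) (a : E) : fderiv ℝ r (q, 0) (a, 0) = (a, a) := by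
  have h1 : HasFDerivAt (fun x : E => r (x, 0)) _ q :=
    HasFDerivAt.comp q (h.contDiffAt.differentiableAt (by simp)).hasFDerivAt
      (hasFDerivAt_prodMk_left q (0 : E))
  have h2 : HasFDerivAt (fun x : E => (x, x)) _ q :=
    (hasFDerivAt_id (𝕜 := ℝ) q).prodMk (hasFDerivAt_id q)
  have := DFunLike.congr_fun ((h2.congr_of_eventuallyEq h.apply_zero).unique h1) a
  simpa using this.symm

theorem fderiv_apply (h : IsLocalDiscretization r q) (a b : E) :
    fderiv ℝ r (q, 0) (a, b) =
      (a + (fderiv ℝ r (q, 0) (0, b)).1, a + (fderiv ℝ r (q, 0) (0, b)).1 + b) := by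
  have h1 : ((a, b) : E × E) = (a, 0) + (0, b) := by simp
  have h2 := h.fderiv_sub.self_of_nhds b
  rw [h1, map_add, h.fderiv_left]
  refine Prod.ext rfl ?_
  simp only [Prod.snd_add]
  rw [sub_eq_iff_eq_add'.1 h2]
  abel

/-- With `A b` the first component of `Dr(0, b)`, the derivative is `(a, b) ↦ (a + A b, a + A b +
b)`. The difference of the components recovers `b`, and then the first one recovers `a`; no
assumption on `A` is needed. -/
theorem isInvertible_fderiv (h : IsLocalDiscretization r q) :
    (fderiv ℝ r (q, 0)).IsInvertible := by
  let A : E →L[ℝ] E := (ContinuousLinearMap.fst ℝ E E).comp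
    ((fderiv ℝ r (q, 0)).comp (ContinuousLinearMap.inr ℝ E E))
  let δ : E × E →L[ℝ] E := ContinuousLinearMap.snd ℝ E E - ContinuousLinearMap.fst ℝ E E
  have hA : ∀ b, (fderiv ℝ r (q, 0) (0, b)).1 = A b := fun b => rfl
  refine ContinuousLinearMap.IsInvertible.of_inverse
    (g := (ContinuousLinearMap.fst ℝ E E - A.comp δ).prod δ) ?_ ?_
  · refine ContinuousLinearMap.ext fun w => ?_
    change fderiv ℝ r (q, 0) (w.1 - A (w.2 - w.1), w.2 - w.1) = w
    rw [h.fderiv_apply, hA]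
    ext <;> simp
  · refine ContinuousLinearMap.ext fun w => ?_
    change ((fderiv ℝ r (q, 0) (w.1, w.2)).1 - A ((fderiv ℝ r (q, 0) (w.1, w.2)).2 -
      (fderiv ℝ r (q, 0) (w.1, w.2)).1), (fderiv ℝ r (q, 0) (w.1, w.2)).2 -
      (fderiv ℝ r (q, 0) (w.1, w.2)).1) = w
    rw [h.fderiv_apply, hA]
    ext <;> simp

/-- Testing the identity of `localCotangentLift_apply_fderiv` on `(a, 0)`, which `Dr` sends to `(a,
a)`, gives `p₁ = p₀`. Testing it on `(0, b)` then gives `p₀ b = p b`. -/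
theorem localCotangentLift_zero (h : IsLocalDiscretization r q) (p : E →L[ℝ] ℝ) :
    localCotangentLift r ((q, p), 0) = ((q, p), (q, p)) := by
  have key := localCotangentLift_apply_fderiv (y := ((q, p), 0)) h.isInvertible_fderiv
  have h0 : r (q, 0) = (q, q) := h.apply_zero.self_of_nhds
  have e1 : ∀ a, (localCotangentLift r ((q, p), 0)).2.2 a =
      (localCotangentLift r ((q, p), 0)).1.2 a := by
    intro a
    have := key (a, 0)
    simp only [Prod.fst_zero, Prod.snd_zero, h.fderiv_left, zero_apply, map_zero, add_zero] at this
    linarith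
  have e2 : ∀ b, (localCotangentLift r ((q, p), 0)).1.2 b = p b := by
    intro b
    have := key (0, b)
    simp only [Prod.fst_zero, Prod.snd_zero, zero_apply, zero_add] at this
    rw [e1, ← map_sub, h.fderiv_sub.self_of_nhds] at this
    exact this
  refine Prod.ext (Prod.ext ?_ (ContinuousLinearMap.ext e2))
    (Prod.ext ?_ (ContinuousLinearMap.ext fun a => (e1 a).trans (e2 a)))
  · change (r (q, 0)).1 = q
    rw [h0]
  · change (r (q, 0)).2 = q
    rw [h0]

/-- The position part is the condition on `r` itself. The momentum part is the derivative of the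
identity of `localCotangentLift_apply_fderiv` for the fixed test vector `(a, 0)`. -/
theorem fderiv_localCotangentLift_sub [CompleteSpace E] (h : IsLocalDiscretization r q)
    (p : E →L[ℝ] ℝ) (w : E × (E →L[ℝ] ℝ)) :
    (fderiv ℝ (localCotangentLift r) ((q, p), 0) (0, w)).2 -
      (fderiv ℝ (localCotangentLift r) ((q, p), 0) (0, w)).1 = w := by
  set y₀ : (E × (E →L[ℝ] ℝ)) × (E × (E →L[ℝ] ℝ)) := ((q, p), 0) with hy₀
  have hs := ((contDiffAt_localCotangentLift (y := y₀) h.contDiffAt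
    h.isInvertible_fderiv).differentiableAt (by simp)).hasFDerivAt
  have hr := (h.contDiffAt.differentiableAt (by simp)).hasFDerivAt
  have hv : HasFDerivAt (fun y : (E × (E →L[ℝ] ℝ)) × (E × (E →L[ℝ] ℝ)) => (y.1.1, y.2.1)) _ y₀ :=
    (hasFDerivAt_fst (𝕜 := ℝ) (p := y₀)).fst.prodMk (hasFDerivAt_snd (𝕜 := ℝ) (p := y₀)).fst
  have hrv := HasFDerivAt.comp y₀ (g := r) hr hv
  have hDr := HasFDerivAt.comp y₀ (g := fderiv ℝ r) h.contDiffAt.hasFDerivAt_fderiv hv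
  -- The identity to be differentiated holds only where `Dr` is invertible, so a whole neighbourhood
  -- of `y₀` is required.
  have hev : ∀ᶠ y in 𝓝 y₀, (fderiv ℝ r (y.1.1, y.2.1)).IsInvertible :=
    hv.continuousAt (eventually_isInvertible_fderiv h.contDiffAt h.isInvertible_fderiv)
  refine Prod.ext ?_ (ContinuousLinearMap.ext fun a => ?_)
  · have e1 := DFunLike.congr_fun (hs.fst.fst.unique hrv.fst) (0, w)
    have e2 := DFunLike.congr_fun (hs.snd.fst.unique hrv.snd) (0, w)
    have := h.fderiv_sub.self_of_nhds w.1
    simp at e1 e2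
    simp only [Prod.fst_sub]
    rw [e1, e2]
    exact this
  · have hw := hDr.clm_apply (hasFDerivAt_const ((a, 0) : E × E) y₀)
    have hl := (hs.snd.snd.clm_apply hw.snd).sub (hs.fst.snd.clm_apply hw.fst)
    have hrt : HasFDerivAt (fun y : (E × (E →L[ℝ] ℝ)) × (E × (E →L[ℝ] ℝ)) => y.2.2 a) _ y₀ :=
      (hasFDerivAt_snd (𝕜 := ℝ) (p := y₀)).snd.clm_apply (hasFDerivAt_const a y₀)
    -- The right-hand side of the identity is `ṗ a`, whose derivative along `(0, w)` is `w.2 a`. The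
    -- left-hand side gives the wanted difference, plus `p` applied to second derivatives of `r`.
    have e := DFunLike.congr_fun ((hrt.congr_of_eventuallyEq (hev.mono fun y hy => by
      simpa using localCotangentLift_apply_fderiv hy (a, 0))).unique hl) (0, w)
    have hsym := fderiv_fderiv_symm h.contDiffAt (0, w.1) (a, 0)
    -- The components of `Dr(x, 0)(0, w.1)` differ by the constant `w.1`, so their derivatives in
    -- `x` coincide. Since `p₀ = p₁ = p` at `y₀`, the two second-order terms cancel.
    have hconst : (fderiv ℝ (fderiv ℝ r) (q, 0) (a, 0) (0, w.1)).2 =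
        (fderiv ℝ (fderiv ℝ r) (q, 0) (a, 0) (0, w.1)).1 := by
      have h1 := HasFDerivAt.comp q (g := fderiv ℝ r) h.contDiffAt.hasFDerivAt_fderiv
        (hasFDerivAt_prodMk_left (𝕜 := ℝ) q (0 : E))
      have h2 := h1.clm_apply (hasFDerivAt_const ((0, w.1) : E × E) q)
      have h3 := h2.snd.sub h2.fst
      have h4 := DFunLike.congr_fun (((hasFDerivAt_const w.1 q).congr_of_eventuallyEq
        (h.fderiv_sub.mono fun x hx => hx w.1)).unique h3) a
      simp at h4
      exact (sub_eq_zero.1 h4.symm)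
    simp only [hy₀] at e ⊢
    simp [h.fderiv_left] at e
    rw [h.localCotangentLift_zero p, hsym, hconst] at e
    simp only [Prod.snd_sub, sub_apply]
    linarith

end IsLocalDiscretization

end LocalLift

/-! ### Coordinate expressions on the cotangent bundle -/

section CotangentCoord

variable {E H : Type*} [NormedAddCommGroup E] [NormedSpace ℝ E] [TopologicalSpace H]
  {I : ModelWithCorners ℝ E H} {M : Type*} [TopologicalSpace M] [ChartedSpace H M]
  [IsManifold I ∞ M] [I.Boundaryless]

omit [IsManifold I ∞ M] [I.Boundaryless] in
theorem fderiv_coordChange_eq (x y : M) {q : E} (hq : q ∈ (extChartAt I x).target) :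
    fderiv ℝ (extChartAt I y ∘ (extChartAt I x).symm) q =
      coordDeriv I x y ((extChartAt I x).symm q) := by
  rw [coordDeriv, (extChartAt I x).right_inv hq]

theorem tangent_coordChange_apply (p p' : TangentBundle I M) {w : E × E}
    (h : w.1 ∈ (extChartAt I p.proj).target)
    (h' : (extChartAt I p.proj).symm w.1 ∈ (extChartAt I p'.proj).source) :
    (extChartAt I.tangent p' ∘ (extChartAt I.tangent p).symm) w =
      ((extChartAt I p'.proj ∘ (extChartAt I p.proj).symm) w.1,
        fderiv ℝ (extChartAt I p'.proj ∘ (extChartAt I p.proj).symm) w.1 w.2) := by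
  rw [Function.comp_apply, tangent_extChartAt_symm_apply p h, tangent_extChartAt_apply,
    fderiv_coordChange_eq _ _ h]
  refine Prod.ext rfl ?_
  exact DFunLike.congr_fun (coordDeriv_comp ((extChartAt I p.proj).map_target h)
    (mem_extChartAt_source _) h') w.2

theorem cotangent_coordChange_apply (z z' : CotangentBundle I M) {w : E × (E →L[ℝ] ℝ)}
    (h : w.1 ∈ (extChartAt I z.proj).target)
    (h' : (extChartAt I z.proj).symm w.1 ∈ (extChartAt I z'.proj).source) :
    (extChartAt (cotangentModel I) z' ∘ (extChartAt (cotangentModel I) z).symm) w =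
      ((extChartAt I z'.proj ∘ (extChartAt I z.proj).symm) w.1,
        w.2.comp (coordDeriv I z'.proj z.proj ((extChartAt I z.proj).symm w.1))) := by
  rw [Function.comp_apply, cotangent_extChartAt_symm_apply z h, cotangent_extChartAt_apply _ _ h',
    CotangentBundle.momentum_ofMomentum]
  refine Prod.ext rfl ?_
  exact (ContinuousLinearMap.comp_assoc _ _ _).trans (congrArg w.2.comp
    (coordDeriv_comp h' (mem_extChartAt_source _) ((extChartAt I z.proj).map_target h)))

theorem cotangent_extChartAt_self (z : CotangentBundle I M) :
    extChartAt (cotangentModel I) z z =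
      (extChartAt I z.proj z.proj, CotangentBundle.momentum I z) := by
  rw [cotangent_extChartAt_apply z z (mem_extChartAt_source _),
    coordDeriv_self (mem_extChartAt_source _), ContinuousLinearMap.comp_id]

/-- Near a point, changes of coordinates of `T*M` are the cotangent lifts of changes of coordinates
of `M`. -/
theorem eventually_cotangent_coordChange (z z' : CotangentBundle I M)
    (h : z.proj ∈ (extChartAt I z'.proj).source) :
    ∀ᶠ w in 𝓝 (extChartAt (cotangentModel I) z z),
      ((extChartAt (cotangentModel I) z' ∘ (extChartAt (cotangentModel I) z).symm) w).1 =
        (extChartAt I z'.proj ∘ (extChartAt I z.proj).symm) w.1 ∧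
      ((extChartAt (cotangentModel I) z' ∘ (extChartAt (cotangentModel I) z).symm) w).2.comp
        (fderiv ℝ (extChartAt I z'.proj ∘ (extChartAt I z.proj).symm) w.1) = w.2 := by
  rw [cotangent_extChartAt_self]
  have hc : ContinuousAt (Prod.fst : E × (E →L[ℝ] ℝ) → E)
    (extChartAt I z.proj z.proj, CotangentBundle.momentum I z) := continuousAt_fst
  filter_upwards [hc (eventually_mem_extChartAt (mem_extChartAt_source z.proj) h)] with w hw
  rw [cotangent_coordChange_apply z z' hw.1 hw.2, fderiv_coordChange_eq _ _ hw.1]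
  refine ⟨rfl, ?_⟩
  rw [ContinuousLinearMap.comp_assoc,
    coordDeriv_comp_symm ((extChartAt I z.proj).map_target hw.1) hw.2, ContinuousLinearMap.comp_id]

/-- The canonical isomorphism `α` in the coordinates of an arbitrary chart. -/
theorem tulczyjew_coord (X : TangentBundle (cotangentModel I) (CotangentBundle I M))
    (z : CotangentBundle I M) (h : X.proj.proj ∈ (extChartAt I z.proj).source) :
    coordDeriv I X.proj.proj z.proj X.proj.proj (tulczyjew I X).proj.2 =
      (coordDeriv (cotangentModel I) X.proj z X.proj X.2).1 ∧
    ((coordDeriv (cotangentModel I) X.proj z X.proj X.2).2.coprod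
        (extChartAt (cotangentModel I) z X.proj).2).comp
        (coordDeriv I.tangent (tulczyjew I X).proj ⟨z.proj, 0⟩ (tulczyjew I X).proj) =
      CotangentBundle.momentum I.tangent (tulczyjew I X) := by
  set m := X.proj.proj with hm
  have hmm := mem_extChartAt_source (I := I) m
  have hzz := mem_extChartAt_source (I := cotangentModel I) X.proj
  have hz : X.proj ∈ (extChartAt (cotangentModel I) z).source :=
    mem_cotangent_extChartAt_source.2 h
  have ev := eventually_cotangent_coordChange X.proj z h
  have hK := contDiffAt_coordChange hzz hz
  rw [cotangent_extChartAt_self] at ev hK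
  let q' : E := (tangentCoord (cotangentModel I) X.proj X.2).1
  let p' : E →L[ℝ] ℝ := (tangentCoord (cotangentModel I) X.proj X.2).2
  have hv : extChartAt I.tangent (tulczyjew I X).proj (tulczyjew I X).proj =
      (extChartAt I m m, q') := by
    rw [tangent_extChartAt_apply]
    refine Prod.ext rfl ?_
    exact DFunLike.congr_fun (coordDeriv_self hmm) q'
  have hc : ContinuousAt (Prod.fst : E × E → E) (extChartAt I m m, q') := continuousAt_fst
  -- Here `g` is the coordinate change of `M`, `K` that of `T*M` and `G` that of `TM`.
  have key := coprod_comp_fderiv_of_canonical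
    (G := extChartAt I.tangent (⟨z.proj, 0⟩ : TangentBundle I M) ∘
      (extChartAt I.tangent (tulczyjew I X).proj).symm)
    (contDiffAt_coordChange hmm h) hK
    (ev.mono fun _ h => h.1) (ev.mono fun _ h => h.2) q' p' (by
      filter_upwards [hc (eventually_mem_extChartAt hmm h)] with w hw
      exact tangent_coordChange_apply (tulczyjew I X).proj ⟨z.proj, 0⟩ hw.1 hw.2)
  have e1 : coordDeriv (cotangentModel I) X.proj z X.proj X.2 = fderiv ℝ
      (extChartAt (cotangentModel I) z ∘ (extChartAt (cotangentModel I) X.proj).symm)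
      (extChartAt I m m, CotangentBundle.momentum I X.proj) (q', p') := by
    rw [coordDeriv, cotangent_extChartAt_self]
    rfl
  have e2 : extChartAt (cotangentModel I) z X.proj =
      (extChartAt (cotangentModel I) z ∘ (extChartAt (cotangentModel I) X.proj).symm)
      (extChartAt I m m, CotangentBundle.momentum I X.proj) := by
    rw [← cotangent_extChartAt_self, Function.comp_apply, PartialEquiv.left_inv _ hzz]
  rw [e1, e2]
  refine ⟨key.1.symm, ?_⟩
  unfold coordDeriv
  rw [hv]
  exact key.2

/-- Coordinate changes of `T*M` are cotangent lifts, so they preserve the Liouville form `p dq`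
exactly. This is the case `S = 0` of `stdSymplecticForm_eq_of_liouville`. -/
theorem symplecticForm_coord (z z' : CotangentBundle I M)
    (h : z.proj ∈ (extChartAt I z'.proj).source) (X Y : E × (E →L[ℝ] ℝ)) :
    symplecticForm I z ((tangentCoord (cotangentModel I) z).symm X)
      ((tangentCoord (cotangentModel I) z).symm Y) =
      stdSymplecticForm E (coordDeriv (cotangentModel I) z z' z X)
        (coordDeriv (cotangentModel I) z z' z Y) := by
  have hzz := mem_extChartAt_source (I := cotangentModel I) z
  have hz : z ∈ (extChartAt (cotangentModel I) z').source :=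
    mem_cotangent_extChartAt_source.2 h
  have ev := eventually_cotangent_coordChange z z' h
  have key := stdSymplecticForm_eq_of_liouville (Z₀ := id) (S := fun _ => (0 : ℝ))
    contDiffAt_id (contDiffAt_coordChange hzz hz) contDiffAt_const ?_ X Y
  · rw [fderiv_id] at key
    exact key.symm
  · have hmem := eventually_mem_extChartAt hzz hz
    -- `eventually_nhds` is used because the equality of base coordinates is differentiated at each
    -- nearby `w`, so it must hold around `w` and not only at it.
    filter_upwards [ev.eventually_nhds, hmem] with w hw hwm v
    have hw2 := hw.self_of_nhds.2
    have ht : w.1 ∈ (extChartAt I z.proj).target := mem_cotangent_extChartAt_target.1 hwm.1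
    have hs : (extChartAt I z.proj).symm w.1 ∈ (extChartAt I z'.proj).source := by
      have := mem_cotangent_extChartAt_source.1 hwm.2
      rwa [cotangent_extChartAt_symm_apply z ht] at this
    have d1 := contDiffAt_coordChange ((extChartAt (cotangentModel I) z).map_target hwm.1) hwm.2
    rw [(extChartAt (cotangentModel I) z).right_inv hwm.1] at d1
    have d2 := contDiffAt_coordChange ((extChartAt I z.proj).map_target ht) hs
    rw [(extChartAt I z.proj).right_inv ht] at d2
    have f1 := (d1.differentiableAt (by simp)).hasFDerivAt.fst
    have f2 : HasFDerivAt (fun y : E × (E →L[ℝ] ℝ) =>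
      (extChartAt I z'.proj ∘ (extChartAt I z.proj).symm) y.1) _ w :=
      HasFDerivAt.comp w (g := extChartAt I z'.proj ∘ (extChartAt I z.proj).symm)
        (d2.differentiableAt (by simp)).hasFDerivAt hasFDerivAt_fst
    have f3 := DFunLike.congr_fun (f1.unique (f2.congr_of_eventuallyEq (hw.mono fun y hy => hy.1))) v
    have f4 := DFunLike.congr_fun hw2 v.1
    simp only [ContinuousLinearMap.coe_comp, Function.comp_apply, ContinuousLinearMap.coe_fst'] at f3 f4
    rw [f3]
    refine f4.trans ?_
    simp

/-- The Hamiltonian vector field in the coordinates of an arbitrary chart. -/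
theorem hamiltonianVectorField_coord [FiniteDimensional ℝ E] {F : CotangentBundle I M → ℝ}
    (hF : ContMDiff (cotangentModel I) 𝓘(ℝ, ℝ) ∞ F) (z z' : CotangentBundle I M)
    (h : z.proj ∈ (extChartAt I z'.proj).source) :
    coordDeriv (cotangentModel I) z z' z (hamiltonianVectorField I F z) =
      (stdSymplecticForm E).inverse (fderiv ℝ (F ∘ (extChartAt (cotangentModel I) z').symm)
        (extChartAt (cotangentModel I) z' z)) := by
  have hzz := mem_extChartAt_source (I := cotangentModel I) z
  have hz : z ∈ (extChartAt (cotangentModel I) z').source :=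
    mem_cotangent_extChartAt_source.2 h
  obtain ⟨A, hA⟩ := isInvertible_stdSymplecticForm (E := E)
  rw [← hA, ContinuousLinearMap.inverse_equiv]
  -- After applying `ω`, the claim is `ω(X, Y) = dF(Y)` in the chart at `z'`. This follows from the
  -- same equation in the preferred chart at `z`, the invariance of `ω` and the chain rule for `F`.
  refine (A.symm_apply_eq.2 ?_).symm
  refine ContinuousLinearMap.ext fun Y => ?_
  have hY := coordDeriv_coordDeriv (I := cotangentModel I) hz hzz Y
  have k1 := symplecticForm_hamiltonianVectorField I F z
    ((tangentCoord (cotangentModel I) z).symm (coordDeriv (cotangentModel I) z' z z Y))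
  have k2 := symplecticForm_coord z z' h (hamiltonianVectorField I F z)
    (coordDeriv (cotangentModel I) z' z z Y)
  have k3 := DFunLike.congr_fun (fderiv_written_comp (y := F z) hF.contMDiffAt hz
    (mem_extChartAt_source _)) (coordDeriv (cotangentModel I) z' z z Y)
  rw [coordDeriv_self (mem_extChartAt_source _)] at k3
  rw [hY] at k2
  simp only [ContinuousLinearMap.coe_comp, Function.comp_apply, hY] at k3
  have hA' : A (coordDeriv (cotangentModel I) z z' z (hamiltonianVectorField I F z)) Y =
    stdSymplecticForm E (coordDeriv (cotangentModel I) z z' z (hamiltonianVectorField I F z)) Y := by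
    rw [← hA]; rfl
  rw [hA', ← k2]
  exact k3.trans k1.symm

end CotangentCoord

/-! ### Discretization maps in coordinates -/

section DiscretizationCoord

variable {E H : Type*} [NormedAddCommGroup E] [NormedSpace ℝ E] [TopologicalSpace H]
  {I : ModelWithCorners ℝ E H} {M : Type*} [TopologicalSpace M] [ChartedSpace H M]
  [IsManifold I ∞ M] [I.Boundaryless]

theorem fderiv_extChartAt_comp {V : Type*} [NormedAddCommGroup V] [NormedSpace ℝ V] {f : V → M}
    {a : V} {n x : M} (hf : ContMDiffAt 𝓘(ℝ, V) I ∞ f a) (hn : f a = n)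
    (hx : n ∈ (extChartAt I x).source) :
    fderiv ℝ (extChartAt I x ∘ f) a = (coordDeriv I n x n).comp (mfderivCoord 𝓘(ℝ, V) I f a) := by
  subst hn
  have h := fderiv_written_comp hf (mem_extChartAt_source a) hx
  rw [coordDeriv_self (mem_extChartAt_source a), ContinuousLinearMap.comp_id] at h
  exact h

theorem tangent_extChartAt_zero (p : TangentBundle I M) (n : M) :
    extChartAt I.tangent p (⟨n, 0⟩ : TangentBundle I M) = (extChartAt I p.proj n, 0) := by
  rw [tangent_extChartAt_apply]
  exact Prod.ext rfl (map_zero _)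

theorem tangent_extChartAt_symm_zero (p : TangentBundle I M) {q : E}
    (hq : q ∈ (extChartAt I p.proj).target) :
    (extChartAt I.tangent p).symm (q, 0) = ⟨(extChartAt I p.proj).symm q, 0⟩ := by
  rw [tangent_extChartAt_symm_apply p hq]
  congr 1
  exact map_zero _

/-- In the chart at `n` the fibre over `n` is a slice with fixed first coordinate, and the change of
coordinates on it is the identity. The inclusion is thus a restriction of an inverse chart. -/
theorem contMDiff_tangentFiber (n : M) :
    ContMDiff 𝓘(ℝ, E) I.tangent ∞
      (fun w : E => (⟨n, (tangentCoord I n).symm w⟩ : TangentBundle I M)) := by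
  have hn := mem_extChartAt_target (I := I) n
  have h : ContMDiffOn 𝓘(ℝ, E × E) I.tangent ∞
      (extChartAt I.tangent (⟨n, 0⟩ : TangentBundle I M)).symm
      (extChartAt I.tangent (⟨n, 0⟩ : TangentBundle I M)).target := contMDiffOn_extChartAt_symm _
  have e : (fun w : E => (⟨n, (tangentCoord I n).symm w⟩ : TangentBundle I M)) = fun w : E =>
      (extChartAt I.tangent (⟨n, 0⟩ : TangentBundle I M)).symm (extChartAt I n n, w) := by
    funext w
    rw [tangent_extChartAt_symm_apply _ hn]
    change _ = (⟨(extChartAt I n).symm (extChartAt I n n), coordDeriv I n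
      ((extChartAt I n).symm (extChartAt I n n)) ((extChartAt I n).symm (extChartAt I n n)) w⟩ :
      TangentBundle I M)
    rw [extChartAt_to_inv n, coordDeriv_self (mem_extChartAt_source n)]
    rfl
  rw [e]
  intro w
  have h2 : ContMDiffAt 𝓘(ℝ, E) 𝓘(ℝ, E × E) ∞ (fun w : E => (extChartAt I n n, w)) w := by
    rw [contMDiffAt_iff_contDiffAt]
    fun_prop
  exact ContMDiffAt.comp w (h.contMDiffAt ((isOpen_extChartAt_target _).mem_nhds
    (mem_tangent_extChartAt_target.2 hn))) h2

/-- The derivative along the fibre of the coordinate expression of a map `TM → M × M`. -/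
theorem fderiv_written_fiber {R : TangentBundle I M → M × M} {n x : M}
    (hx : n ∈ (extChartAt I x).source)
    (hR : ContMDiffAt I.tangent (I.prod I) ∞ R (⟨n, 0⟩ : TangentBundle I M))
    (h0 : R ⟨n, 0⟩ = (n, n)) (v : E) :
    fderiv ℝ (extChartAt (I.prod I) (x, x) ∘ R ∘
        (extChartAt I.tangent (⟨x, 0⟩ : TangentBundle I M)).symm) (extChartAt I x n, 0) (0, v) =
      (coordDeriv I n x n (mfderivCoord 𝓘(ℝ, E) I
          (fun w : E => (R ⟨n, (tangentCoord I n).symm w⟩).1) 0 (coordDeriv I x n n v)),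
        coordDeriv I n x n (mfderivCoord 𝓘(ℝ, E) I
          (fun w : E => (R ⟨n, (tangentCoord I n).symm w⟩).2) 0 (coordDeriv I x n n v))) := by
  have hnn := mem_extChartAt_source (I := I) n
  have hxt := (extChartAt I x).map_source hx
  have hτ : extChartAt I.tangent (⟨x, 0⟩ : TangentBundle I M) (⟨n, 0⟩ : TangentBundle I M) =
    (extChartAt I x n, 0) := tangent_extChartAt_zero _ _
  have hr := contDiffAt_written (x := (⟨x, 0⟩ : TangentBundle I M)) (y := (x, x)) hR
    (mem_tangent_extChartAt_source.2 hx) (by rw [h0, extChartAt_prod]; exact ⟨hx, hx⟩)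
  rw [hτ] at hr
  have hf : ContMDiffAt 𝓘(ℝ, E) (I.prod I) ∞
      (fun w : E => R ⟨n, (tangentCoord I n).symm w⟩) 0 :=
    ContMDiffAt.comp (0 : E) (hR : ContMDiffAt I.tangent (I.prod I) ∞ R
      (⟨n, (tangentCoord I n).symm 0⟩ : TangentBundle I M)) (contMDiff_tangentFiber n).contMDiffAt
  have e1 := fderiv_extChartAt_comp hf.fst (congrArg Prod.fst h0) hx
  have e2 := fderiv_extChartAt_comp hf.snd (congrArg Prod.snd h0) hx
  have d1 := (contDiffAt_written (x := (0 : E)) (y := x) hf.fst (mem_extChartAt_source _) (by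
    change (R ⟨n, 0⟩).1 ∈ _; rw [h0]; exact hx)).differentiableAt (by simp)
  have d2 := (contDiffAt_written (x := (0 : E)) (y := x) hf.snd (mem_extChartAt_source _) (by
    change (R ⟨n, 0⟩).2 ∈ _; rw [h0]; exact hx)).differentiableAt (by simp)
  have d1 : HasFDerivAt (extChartAt I x ∘ fun w : E => (R ⟨n, (tangentCoord I n).symm w⟩).1) _
    0 := d1.hasFDerivAt
  have d2 : HasFDerivAt (extChartAt I x ∘ fun w : E => (R ⟨n, (tangentCoord I n).symm w⟩).2) _
    0 := d2.hasFDerivAt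
  rw [← map_zero (coordDeriv I x n n)] at d1 d2
  have d3 := (d1.comp 0 (coordDeriv I x n n).hasFDerivAt).prodMk
    (d2.comp 0 (coordDeriv I x n n).hasFDerivAt)
  have d4 := HasFDerivAt.comp (0 : E) (hr.differentiableAt (by simp)).hasFDerivAt
    (hasFDerivAt_prodMk_right (𝕜 := ℝ) (extChartAt I x n) (0 : E))
  -- Along the fibre, the chart at `x` and the preferred chart at `n` differ by the linear map
  -- `coordDeriv I x n n`.
  have e : (extChartAt (I.prod I) (x, x) ∘ R ∘
        (extChartAt I.tangent (⟨x, 0⟩ : TangentBundle I M)).symm) ∘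
        (fun w => (extChartAt I x n, w)) = fun w =>
      ((extChartAt I x ∘ fun w : E => (R ⟨n, (tangentCoord I n).symm w⟩).1)
        (coordDeriv I x n n w), (extChartAt I x ∘ fun w : E =>
          (R ⟨n, (tangentCoord I n).symm w⟩).2) (coordDeriv I x n n w)) := by
    funext w
    simp only [Function.comp_apply]
    rw [tangent_extChartAt_symm_apply _ hxt]
    simp only [extChartAt_prod, PartialEquiv.prod_coe]
    rw [(extChartAt I x).left_inv hx]
    rfl
  rw [e] at d4
  have := DFunLike.congr_fun (d4.unique d3) v
  simp only [ContinuousLinearMap.coe_comp, Function.comp_apply, ContinuousLinearMap.inr_apply] at this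
  rw [this, map_zero]
  have e1' := DFunLike.congr_fun e1 (coordDeriv I x n n v)
  have e2' := DFunLike.congr_fun e2 (coordDeriv I x n n v)
  exact Prod.ext e1' e2'

omit [I.Boundaryless] in
theorem IsDiscretizationMap.contMDiffAt_zero {U : Set (TangentBundle I M)}
    {R : TangentBundle I M → M × M} (hR : IsDiscretizationMap I U R) (n : M) :
    ContMDiffAt I.tangent (I.prod I) ∞ R (⟨n, 0⟩ : TangentBundle I M) :=
  hR.contMDiffOn.contMDiffAt (hR.isOpen.mem_nhds (hR.zero_mem n))

/-- A discretization map satisfies the defining conditions in the coordinates of every chart. -/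
theorem IsDiscretizationMap.isLocalDiscretization {U : Set (TangentBundle I M)}
    {R : TangentBundle I M → M × M} (hR : IsDiscretizationMap I U R) (x : M) {q : E}
    (hq : q ∈ (extChartAt I x).target) :
    IsLocalDiscretization (extChartAt (I.prod I) (x, x) ∘ R ∘
        (extChartAt I.tangent (⟨x, 0⟩ : TangentBundle I M)).symm) q where
  contDiffAt := by
    have hx := (extChartAt I x).map_target hq
    have hr := contDiffAt_written (x := (⟨x, 0⟩ : TangentBundle I M)) (y := (x, x))
      (hR.contMDiffAt_zero ((extChartAt I x).symm q))
      (mem_tangent_extChartAt_source.2 hx) (by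
        rw [hR.map_zero, extChartAt_prod]; exact ⟨hx, hx⟩)
    rw [tangent_extChartAt_zero] at hr
    change ContDiffAt ℝ ∞ _ (extChartAt I x ((extChartAt I x).symm q), 0) at hr
    rwa [(extChartAt I x).right_inv hq] at hr
  apply_zero := by
    filter_upwards [(isOpen_extChartAt_target (I := I) x).mem_nhds hq] with q hq
    simp only [Function.comp_apply]
    rw [tangent_extChartAt_symm_zero _ hq, hR.map_zero, extChartAt_prod]
    exact Prod.ext ((extChartAt I x).right_inv hq) ((extChartAt I x).right_inv hq)
  fderiv_sub := by
    filter_upwards [(isOpen_extChartAt_target (I := I) x).mem_nhds hq] with q hq v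
    have hx := (extChartAt I x).map_target hq
    have h := fderiv_written_fiber hx (hR.contMDiffAt_zero _) (hR.map_zero _) v
    rw [(extChartAt I x).right_inv hq] at h
    rw [h, ← map_sub]
    have h2 := hR.mfderiv_sub ((extChartAt I x).symm q)
      (coordDeriv I x ((extChartAt I x).symm q) ((extChartAt I x).symm q) v)
    -- By `fderiv_written_fiber` the derivative in the chart at `x` is the one in the preferred
    -- chart conjugated by `coordDeriv`, and conjugation fixes the identity.
    refine (congrArg _ h2).trans ?_
    exact coordDeriv_coordDeriv hx (mem_extChartAt_source _) v

/-- The condition on the derivative of a discretization map may be checked in the coordinates of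
the preferred chart. -/
theorem mfderiv_sub_of_fderiv {R : TangentBundle I M → M × M} {x : M}
    (hR : ContMDiffAt I.tangent (I.prod I) ∞ R (⟨x, 0⟩ : TangentBundle I M))
    (h0 : R ⟨x, 0⟩ = (x, x)) {v : E} (h : ∀ d, fderiv ℝ (extChartAt (I.prod I) (x, x) ∘ R ∘
        (extChartAt I.tangent (⟨x, 0⟩ : TangentBundle I M)).symm) (extChartAt I x x, 0) (0, v) = d →
      d.2 - d.1 = v) :
    tangentCoord I _ (mfderiv 𝓘(ℝ, E) I
        (fun w : E => (R ⟨x, (tangentCoord I x).symm w⟩).2) 0 v) -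
      tangentCoord I _ (mfderiv 𝓘(ℝ, E) I
        (fun w : E => (R ⟨x, (tangentCoord I x).symm w⟩).1) 0 v) = v := by
  have hx := mem_extChartAt_source (I := I) x
  have := h _ (fderiv_written_fiber hx hR h0 v)
  rw [coordDeriv_self hx] at this
  exact this

end DiscretizationCoord

/-! ### The cotangent lift in coordinates -/

section CotangentLift

variable {E H : Type*} [NormedAddCommGroup E] [NormedSpace ℝ E] [TopologicalSpace H]
  {I : ModelWithCorners ℝ E H} {M : Type*} [TopologicalSpace M] [ChartedSpace H M]
  [IsManifold I ∞ M] [I.Boundaryless]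
  {E' H' : Type*} [NormedAddCommGroup E'] [NormedSpace ℝ E'] [TopologicalSpace H']
  {J : ModelWithCorners ℝ E' H'} {N : Type*} [TopologicalSpace N] [ChartedSpace H' N]
  [IsManifold J ∞ N] [J.Boundaryless]

theorem isInvertible_mfderivCoord_iff {f : M → N} {m x : M} {y : N} (hf : ContMDiffAt I J ∞ f m)
    (hx : m ∈ (extChartAt I x).source) (hy : f m ∈ (extChartAt J y).source) :
    (mfderivCoord I J f m).IsInvertible ↔
      (fderiv ℝ (extChartAt J y ∘ f ∘ (extChartAt I x).symm) (extChartAt I x m)).IsInvertible := by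
  have h := fderiv_written_comp hf hx hy
  obtain ⟨A, hA⟩ := isInvertible_coordDeriv (mem_extChartAt_source (I := I) m) hx
  obtain ⟨B, hB⟩ := isInvertible_coordDeriv (mem_extChartAt_source (I := J) (f m)) hy
  rw [← hA, ← hB] at h
  rw [← ContinuousLinearMap.isInvertible_equiv_comp (e := B), ← h,
    ContinuousLinearMap.isInvertible_comp_equiv]

/-- The inverse form of `fderiv_written_comp`: a change of coordinates is inverted by exchanging the
charts. It moves the inverse tangent map in the cotangent lift to fixed charts. -/
theorem inverse_fderiv_written {f : M → N} {m x : M} {y : N} (hf : ContMDiffAt I J ∞ f m)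
    (hx : m ∈ (extChartAt I x).source) (hy : f m ∈ (extChartAt J y).source)
    (hi : (mfderivCoord I J f m).IsInvertible) :
    (fderiv ℝ (extChartAt J y ∘ f ∘ (extChartAt I x).symm) (extChartAt I x m)).inverse =
      (coordDeriv I m x m).comp
        ((mfderivCoord I J f m).inverse.comp (coordDeriv J y (f m) (f m))) := by
  have h := fderiv_written_comp hf hx hy
  have hmm := mem_extChartAt_source (I := I) m
  have hff := mem_extChartAt_source (I := J) (f m)
  have h2 := congrArg (fun L => L.comp (coordDeriv I x m m)) h
  simp only [ContinuousLinearMap.comp_assoc, coordDeriv_comp_symm hx hmm,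
    ContinuousLinearMap.comp_id] at h2
  rw [h2]
  obtain ⟨D, hD⟩ := hi
  rw [← hD, ContinuousLinearMap.inverse_equiv]
  refine ContinuousLinearMap.inverse_eq (ContinuousLinearMap.ext fun u => ?_)
    (ContinuousLinearMap.ext fun u => ?_)
  · simp [coordDeriv_coordDeriv hmm hx, coordDeriv_coordDeriv hy hff]
  · simp [coordDeriv_coordDeriv hff hy, coordDeriv_coordDeriv hx hmm]

omit [I.Boundaryless] in
theorem mem_tangent_extChartAt_tulczyjew
    {X : TangentBundle (cotangentModel I) (CotangentBundle I M)} {z : CotangentBundle I M}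
    (h : X.proj.proj ∈ (extChartAt I z.proj).source) :
    (tulczyjew I X).proj ∈ (extChartAt I.tangent (⟨z.proj, 0⟩ : TangentBundle I M)).source :=
  mem_tangent_extChartAt_source.2 h

/-- The base point of `α X` in coordinates. -/
theorem tangent_extChartAt_tulczyjew
    (X : TangentBundle (cotangentModel I) (CotangentBundle I M)) (z : CotangentBundle I M)
    (h : X.proj.proj ∈ (extChartAt I z.proj).source) :
    extChartAt I.tangent (⟨z.proj, 0⟩ : TangentBundle I M) (tulczyjew I X).proj =
      ((extChartAt (cotangentModel I).tangent
          (⟨z, 0⟩ : TangentBundle (cotangentModel I) (CotangentBundle I M)) X).1.1,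
        (extChartAt (cotangentModel I).tangent
          (⟨z, 0⟩ : TangentBundle (cotangentModel I) (CotangentBundle I M)) X).2.1) := by
  rw [tangent_extChartAt_apply, tangent_extChartAt_apply, cotangent_extChartAt_apply _ _ h]
  exact Prod.ext rfl (tulczyjew_coord X z h).1

/-- The cotangent lift in coordinates. -/
theorem cotangentLift_coord {R : TangentBundle I M → M × M}
    (X : TangentBundle (cotangentModel I) (CotangentBundle I M)) (z z₀ z₁ : CotangentBundle I M)
    (h : X.proj.proj ∈ (extChartAt I z.proj).source)
    (hR : ContMDiffAt I.tangent (I.prod I) ∞ R (tulczyjew I X).proj)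
    (hi : (mfderivCoord I.tangent (I.prod I) R (tulczyjew I X).proj).IsInvertible)
    (h₀ : (R (tulczyjew I X).proj).1 ∈ (extChartAt I z₀.proj).source)
    (h₁ : (R (tulczyjew I X).proj).2 ∈ (extChartAt I z₁.proj).source) :
    (extChartAt (cotangentModel I) z₀ (cotangentLift I R X).1,
      extChartAt (cotangentModel I) z₁ (cotangentLift I R X).2) =
      localCotangentLift (extChartAt (I.prod I) (z₀.proj, z₁.proj) ∘ R ∘
        (extChartAt I.tangent (⟨z.proj, 0⟩ : TangentBundle I M)).symm)
        (extChartAt (cotangentModel I).tangent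
          (⟨z, 0⟩ : TangentBundle (cotangentModel I) (CotangentBundle I M)) X) := by
  set v := (tulczyjew I X).proj with hv
  have hvs : v ∈ (extChartAt I.tangent (⟨z.proj, 0⟩ : TangentBundle I M)).source :=
    mem_tangent_extChartAt_tulczyjew h
  have hRs : R v ∈ (extChartAt (I.prod I) (z₀.proj, z₁.proj)).source := by
    rw [extChartAt_prod]; exact ⟨h₀, h₁⟩
  have hinv := inverse_fderiv_written hR hvs hRs hi
  have hτ := tangent_extChartAt_tulczyjew X z h
  rw [← hv] at hτ
  have hmom := (tulczyjew_coord X z h).2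
  rw [← hv] at hmom
  set c : E × E →L[ℝ] ℝ := (CotangentBundle.momentum I.tangent (tulczyjew I X)).comp
    (mfderivCoord I.tangent (I.prod I) R v).inverse with hc
  have hS : cotangentLift I R X =
      (CotangentBundle.ofMomentum I (R v).1 (-c.comp (ContinuousLinearMap.inl ℝ E E)),
        CotangentBundle.ofMomentum I (R v).2 (c.comp (ContinuousLinearMap.inr ℝ E E))) := rfl
  have hθ : ((extChartAt (cotangentModel I).tangent
          (⟨z, 0⟩ : TangentBundle (cotangentModel I) (CotangentBundle I M)) X).2.2.coprod
        (extChartAt (cotangentModel I).tangent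
          (⟨z, 0⟩ : TangentBundle (cotangentModel I) (CotangentBundle I M)) X).1.2).comp
        (coordDeriv I.tangent v ⟨z.proj, 0⟩ v) =
        CotangentBundle.momentum I.tangent (tulczyjew I X) := by
    rw [tangent_extChartAt_apply]
    exact hmom
  rw [hS, cotangent_extChartAt_apply z₀ _ h₀, cotangent_extChartAt_apply z₁ _ h₁,
    CotangentBundle.momentum_ofMomentum, CotangentBundle.momentum_ofMomentum]
  unfold localCotangentLift
  -- The change of coordinates at `v` coming from the inverse derivative turns the coordinates of
  -- the covector into its momentum by `hθ`. What remains is the change of coordinates at `R v`,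
  -- which acts separately on the two factors.
  rw [← hτ, hinv, ← ContinuousLinearMap.comp_assoc, ← ContinuousLinearMap.comp_assoc, hθ, ← hc,
    coordDeriv_prod hRs (mem_extChartAt_source _)]
  have hval : (extChartAt (I.prod I) (z₀.proj, z₁.proj) ∘ R ∘
        (extChartAt I.tangent (⟨z.proj, 0⟩ : TangentBundle I M)).symm)
        (extChartAt I.tangent (⟨z.proj, 0⟩ : TangentBundle I M) v) =
        (extChartAt I z₀.proj (R v).1, extChartAt I z₁.proj (R v).2) := by
    simp only [Function.comp_apply]
    rw [PartialEquiv.left_inv _ hvs, extChartAt_prod]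
    rfl
  rw [hval]
  refine Prod.ext (Prod.ext rfl ?_) (Prod.ext rfl ?_)
  · ext a
    simp [CotangentBundle.ofMomentum]
  · ext a
    simp [CotangentBundle.ofMomentum]

/-- The points, in the coordinates of `TM` given by the chart at `x`, at which `R` is a local
diffeomorphism with values in the domain of the chart at `(x₀, x₁)`. -/
def regularCoords (U : Set (TangentBundle I M)) (R : TangentBundle I M → M × M) (x x₀ x₁ : M) :
    Set (E × E) :=
  {q | (q ∈ (extChartAt I.tangent (⟨x, 0⟩ : TangentBundle I M)).target ∧
    (extChartAt I.tangent (⟨x, 0⟩ : TangentBundle I M)).symm q ∈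
      U ∩ R ⁻¹' (extChartAt (I.prod I) (x₀, x₁)).source) ∧
    (fderiv ℝ (extChartAt (I.prod I) (x₀, x₁) ∘ R ∘
        (extChartAt I.tangent (⟨x, 0⟩ : TangentBundle I M)).symm) q).IsInvertible}

variable {U : Set (TangentBundle I M)} {R : TangentBundle I M → M × M}

theorem contDiffAt_of_mem_regularCoords (hU : IsOpen U)
    (hR : ContMDiffOn I.tangent (I.prod I) ∞ R U) {x x₀ x₁ : M} {q : E × E}
    (hq : q ∈ (extChartAt I.tangent (⟨x, 0⟩ : TangentBundle I M)).target)
    (hq' : (extChartAt I.tangent (⟨x, 0⟩ : TangentBundle I M)).symm q ∈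
      U ∩ R ⁻¹' (extChartAt (I.prod I) (x₀, x₁)).source) :
    ContDiffAt ℝ ∞ (extChartAt (I.prod I) (x₀, x₁) ∘ R ∘
        (extChartAt I.tangent (⟨x, 0⟩ : TangentBundle I M)).symm) q := by
  have := contDiffAt_written (hR.contMDiffAt (hU.mem_nhds hq'.1))
    (PartialEquiv.map_target _ hq) hq'.2
  rwa [PartialEquiv.right_inv _ hq] at this

theorem isOpen_regularCoords [CompleteSpace E] (hU : IsOpen U)
    (hR : ContMDiffOn I.tangent (I.prod I) ∞ R U) (x x₀ x₁ : M) :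
    IsOpen (regularCoords U R x x₀ x₁) := by
  have h1 : IsOpen (U ∩ R ⁻¹' (extChartAt (I.prod I) (x₀, x₁)).source) :=
    hR.continuousOn.isOpen_inter_preimage hU (isOpen_extChartAt_source _)
  have h2 := (continuousOn_extChartAt_symm (I := I.tangent)
    (⟨x, 0⟩ : TangentBundle I M)).isOpen_inter_preimage (isOpen_extChartAt_target _) h1
  rw [isOpen_iff_mem_nhds]
  intro q hq
  filter_upwards [h2.mem_nhds hq.1, eventually_isInvertible_fderiv
    (contDiffAt_of_mem_regularCoords hU hR hq.1.1 hq.1.2) hq.2] with q' h h'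
  exact ⟨h, h'⟩

theorem mem_regularCoords_iff (hU : IsOpen U) (hR : ContMDiffOn I.tangent (I.prod I) ∞ R U)
    {x x₀ x₁ : M} {v : TangentBundle I M}
    (hv : v ∈ (extChartAt I.tangent (⟨x, 0⟩ : TangentBundle I M)).source) :
    extChartAt I.tangent (⟨x, 0⟩ : TangentBundle I M) v ∈ regularCoords U R x x₀ x₁ ↔
      (v ∈ U ∧ (mfderivCoord I.tangent (I.prod I) R v).IsInvertible) ∧
        R v ∈ (extChartAt (I.prod I) (x₀, x₁)).source := by
  unfold regularCoords
  rw [mem_ofPred_eq, PartialEquiv.left_inv _ hv]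
  constructor
  · rintro ⟨⟨-, h1, h2⟩, h3⟩
    exact ⟨⟨h1, (isInvertible_mfderivCoord_iff (hR.contMDiffAt (hU.mem_nhds h1)) hv h2).2 h3⟩, h2⟩
  · rintro ⟨⟨h1, h2⟩, h3⟩
    exact ⟨⟨PartialEquiv.map_source _ hv, h1, h3⟩,
      (isInvertible_mfderivCoord_iff (hR.contMDiffAt (hU.mem_nhds h1)) hv h3).1 h2⟩

/-- The domain of the cotangent lift in coordinates. -/
theorem mem_cotangentLiftDomain_iff_regularCoords (hU : IsOpen U)
    (hR : ContMDiffOn I.tangent (I.prod I) ∞ R U)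
    {X : TangentBundle (cotangentModel I) (CotangentBundle I M)} {z z₀ z₁ : CotangentBundle I M}
    (h : X.proj.proj ∈ (extChartAt I z.proj).source) :
    ((extChartAt (cotangentModel I).tangent
          (⟨z, 0⟩ : TangentBundle (cotangentModel I) (CotangentBundle I M)) X).1.1,
        (extChartAt (cotangentModel I).tangent
          (⟨z, 0⟩ : TangentBundle (cotangentModel I) (CotangentBundle I M)) X).2.1) ∈
        regularCoords U R z.proj z₀.proj z₁.proj ↔
      X ∈ cotangentLiftDomain I U R ∧
        R (tulczyjew I X).proj ∈ (extChartAt (I.prod I) (z₀.proj, z₁.proj)).source := by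
  rw [← tangent_extChartAt_tulczyjew X z h,
    mem_regularCoords_iff hU hR (mem_tangent_extChartAt_tulczyjew h)]
  rfl

/-- The cotangent lift as the composition of its coordinate expression with charts. -/
theorem cotangentLift_eq_symm (hU : IsOpen U) (hR : ContMDiffOn I.tangent (I.prod I) ∞ R U)
    {X : TangentBundle (cotangentModel I) (CotangentBundle I M)} {z z₀ z₁ : CotangentBundle I M}
    (h : X.proj.proj ∈ (extChartAt I z.proj).source) (hX : X ∈ cotangentLiftDomain I U R)
    (hRX : R (tulczyjew I X).proj ∈ (extChartAt (I.prod I) (z₀.proj, z₁.proj)).source) :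
    cotangentLift I R X =
      (extChartAt ((cotangentModel I).prod (cotangentModel I)) (z₀, z₁)).symm
        (localCotangentLift (extChartAt (I.prod I) (z₀.proj, z₁.proj) ∘ R ∘
          (extChartAt I.tangent (⟨z.proj, 0⟩ : TangentBundle I M)).symm)
          (extChartAt (cotangentModel I).tangent
            (⟨z, 0⟩ : TangentBundle (cotangentModel I) (CotangentBundle I M)) X)) := by
  have hs : R (tulczyjew I X).proj ∈
      (extChartAt I z₀.proj).source ×ˢ (extChartAt I z₁.proj).source := by
    rwa [extChartAt_prod] at hRX
  rw [← cotangentLift_coord X z z₀ z₁ h (hR.contMDiffAt (hU.mem_nhds hX.1)) hX.2 hs.1 hs.2,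
    extChartAt_prod]
  refine Prod.ext ?_ ?_
  · exact (PartialEquiv.left_inv _ (mem_cotangent_extChartAt_source.2 hs.1)).symm
  · exact (PartialEquiv.left_inv _ (mem_cotangent_extChartAt_source.2 hs.2)).symm

end CotangentLift

/-! ### The cotangent lift of a discretization map is a discretization map -/

section CotangentLiftDiscretization

variable {E H : Type*} [NormedAddCommGroup E] [NormedSpace ℝ E] [TopologicalSpace H]
  {I : ModelWithCorners ℝ E H} {M : Type*} [TopologicalSpace M] [ChartedSpace H M]
  [IsManifold I ∞ M] [I.Boundaryless]
  {U : Set (TangentBundle I M)} {R : TangentBundle I M → M × M}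

omit [I.Boundaryless] in
theorem mem_tangent_cotangent_extChartAt_source
    {X : TangentBundle (cotangentModel I) (CotangentBundle I M)} {z : CotangentBundle I M} :
    X ∈ (extChartAt (cotangentModel I).tangent
      (⟨z, 0⟩ : TangentBundle (cotangentModel I) (CotangentBundle I M))).source ↔
      X.proj.proj ∈ (extChartAt I z.proj).source :=
  mem_tangent_extChartAt_source.trans mem_cotangent_extChartAt_source

/-- In a chart, membership in the domain of the lift depends only on the coordinates `(q, q̇)` and
is given by the open set `regularCoords`. The openness of that domain follows as well. -/
theorem eventually_mem_regularCoords [CompleteSpace E] (hU : IsOpen U)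
    (hR : ContMDiffOn I.tangent (I.prod I) ∞ R U)
    {X : TangentBundle (cotangentModel I) (CotangentBundle I M)} {z z₀ z₁ : CotangentBundle I M}
    (h : X.proj.proj ∈ (extChartAt I z.proj).source) (hX : X ∈ cotangentLiftDomain I U R)
    (hRX : R (tulczyjew I X).proj ∈ (extChartAt (I.prod I) (z₀.proj, z₁.proj)).source) :
    ∀ᶠ Y in 𝓝 X, Y.proj.proj ∈ (extChartAt I z.proj).source ∧ Y ∈ cotangentLiftDomain I U R ∧
      R (tulczyjew I Y).proj ∈ (extChartAt (I.prod I) (z₀.proj, z₁.proj)).source := by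
  have hs : X ∈ (extChartAt (cotangentModel I).tangent
      (⟨z, 0⟩ : TangentBundle (cotangentModel I) (CotangentBundle I M))).source :=
    mem_tangent_cotangent_extChartAt_source.2 h
  have hc := continuousAt_extChartAt' hs
  have hcc : ContinuousAt (fun Y : TangentBundle (cotangentModel I) (CotangentBundle I M) =>
      ((extChartAt (cotangentModel I).tangent
          (⟨z, 0⟩ : TangentBundle (cotangentModel I) (CotangentBundle I M)) Y).1.1,
        (extChartAt (cotangentModel I).tangent
          (⟨z, 0⟩ : TangentBundle (cotangentModel I) (CotangentBundle I M)) Y).2.1)) X :=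
    hc.fst.fst.prodMk hc.snd.fst
  have hev := hcc.eventually_mem ((isOpen_regularCoords hU hR z.proj z₀.proj z₁.proj).mem_nhds
    ((mem_cotangentLiftDomain_iff_regularCoords hU hR h).2 ⟨hX, hRX⟩))
  have hev' : ∀ᶠ Y in 𝓝 X, Y ∈ (extChartAt (cotangentModel I).tangent
      (⟨z, 0⟩ : TangentBundle (cotangentModel I) (CotangentBundle I M))).source :=
    (isOpen_extChartAt_source _).eventually_mem hs
  refine (hev.and hev').mono fun Y hY => ?_
  have h3 : Y.proj.proj ∈ (extChartAt I z.proj).source :=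
    mem_tangent_cotangent_extChartAt_source.1 hY.2
  exact ⟨h3, (mem_cotangentLiftDomain_iff_regularCoords (z := z) (z₀ := z₀) (z₁ := z₁) hU hR
    h3).1 hY.1⟩

/-- The coordinate expression of the cotangent lift near a point. -/
theorem written_cotangentLift_eventuallyEq [CompleteSpace E] (hU : IsOpen U)
    (hR : ContMDiffOn I.tangent (I.prod I) ∞ R U)
    {X : TangentBundle (cotangentModel I) (CotangentBundle I M)} {z z₀ z₁ : CotangentBundle I M}
    (h : X.proj.proj ∈ (extChartAt I z.proj).source) (hX : X ∈ cotangentLiftDomain I U R)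
    (hRX : R (tulczyjew I X).proj ∈ (extChartAt (I.prod I) (z₀.proj, z₁.proj)).source) :
    extChartAt ((cotangentModel I).prod (cotangentModel I)) (z₀, z₁) ∘ cotangentLift I R ∘
        (extChartAt (cotangentModel I).tangent
          (⟨z, 0⟩ : TangentBundle (cotangentModel I) (CotangentBundle I M))).symm
      =ᶠ[𝓝 (extChartAt (cotangentModel I).tangent
          (⟨z, 0⟩ : TangentBundle (cotangentModel I) (CotangentBundle I M)) X)]
      localCotangentLift (extChartAt (I.prod I) (z₀.proj, z₁.proj) ∘ R ∘
          (extChartAt I.tangent (⟨z.proj, 0⟩ : TangentBundle I M)).symm) := by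
  have hs : X ∈ (extChartAt (cotangentModel I).tangent
      (⟨z, 0⟩ : TangentBundle (cotangentModel I) (CotangentBundle I M))).source :=
    mem_tangent_cotangent_extChartAt_source.2 h
  have hev := eventually_mem_regularCoords hU hR h hX hRX
  have hc := continuousAt_extChartAt_symm' hs
  rw [ContinuousAt, PartialEquiv.left_inv _ hs] at hc
  have hev' := (isOpen_extChartAt_target (I := (cotangentModel I).tangent) _).mem_nhds
    (PartialEquiv.map_source _ hs)
  filter_upwards [hc.eventually hev, hev'] with y hy hyt
  obtain ⟨h1, h2, h3⟩ := hy
  have hs2 := h3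
  rw [extChartAt_prod] at hs2
  have e := cotangentLift_coord _ z z₀ z₁ h1 (hR.contMDiffAt (hU.mem_nhds h2.1)) h2.2 hs2.1 hs2.2
  rw [PartialEquiv.right_inv _ hyt] at e
  rw [← e, extChartAt_prod]
  rfl

/-- With charts fixed at the base point of `X` and at its two images, the lift near `X` is the
smooth map `localCotangentLift` between a chart and an inverse chart. -/
theorem contMDiffAt_cotangentLift [CompleteSpace E] (hU : IsOpen U)
    (hR : ContMDiffOn I.tangent (I.prod I) ∞ R U)
    {X : TangentBundle (cotangentModel I) (CotangentBundle I M)}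
    (hX : X ∈ cotangentLiftDomain I U R) :
    ContMDiffAt (cotangentModel I).tangent ((cotangentModel I).prod (cotangentModel I)) ∞
      (cotangentLift I R) X := by
  let z := X.proj
  let z₀ := (cotangentLift I R X).1
  let z₁ := (cotangentLift I R X).2
  have h : X.proj.proj ∈ (extChartAt I z.proj).source := mem_extChartAt_source _
  have hRX : R (tulczyjew I X).proj ∈ (extChartAt (I.prod I) (z₀.proj, z₁.proj)).source :=
    mem_extChartAt_source (R (tulczyjew I X).proj)
  have hs : X ∈ (extChartAt (cotangentModel I).tangent
      (⟨z, 0⟩ : TangentBundle (cotangentModel I) (CotangentBundle I M))).source :=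
    mem_tangent_cotangent_extChartAt_source.2 h
  have ev := eventually_mem_regularCoords hU hR h hX hRX
  have hreg := (mem_cotangentLiftDomain_iff_regularCoords hU hR h).2 ⟨hX, hRX⟩
  have h1 : ContMDiffAt (cotangentModel I).tangent 𝓘(ℝ, (E × (E →L[ℝ] ℝ)) × (E × (E →L[ℝ] ℝ))) ∞
      (extChartAt (cotangentModel I).tangent
        (⟨z, 0⟩ : TangentBundle (cotangentModel I) (CotangentBundle I M))) X :=
    contMDiffAt_extChartAt' (by rwa [extChartAt_source] at hs)
  have h2 := contDiffAt_localCotangentLift (contDiffAt_of_mem_regularCoords hU hR hreg.1.1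
    hreg.1.2) hreg.2
  have hs2 : R (tulczyjew I X).proj ∈
      (extChartAt I z₀.proj).source ×ˢ (extChartAt I z₁.proj).source := by
    rwa [extChartAt_prod] at hRX
  have h3 := cotangentLift_coord X z z₀ z₁ h (hR.contMDiffAt (hU.mem_nhds hX.1)) hX.2 hs2.1 hs2.2
  have h4 : ContMDiffAt 𝓘(ℝ, (E × (E →L[ℝ] ℝ)) × (E × (E →L[ℝ] ℝ)))
      ((cotangentModel I).prod (cotangentModel I)) ∞
      (extChartAt ((cotangentModel I).prod (cotangentModel I)) (z₀, z₁)).symm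
      (localCotangentLift (extChartAt (I.prod I) (z₀.proj, z₁.proj) ∘ R ∘
          (extChartAt I.tangent (⟨z.proj, 0⟩ : TangentBundle I M)).symm)
          (extChartAt (cotangentModel I).tangent
            (⟨z, 0⟩ : TangentBundle (cotangentModel I) (CotangentBundle I M)) X)) := by
    rw [← h3]
    exact (contMDiffOn_extChartAt_symm (z₀, z₁)).contMDiffAt
      ((isOpen_extChartAt_target _).mem_nhds (mem_extChartAt_target _))
  refine ContMDiffAt.congr_of_eventuallyEq
    (ContMDiffAt.comp X h4 (ContMDiffAt.comp X h2.contMDiffAt h1)) ?_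
  filter_upwards [ev] with Y hY
  exact cotangentLift_eq_symm hU hR hY.1 hY.2.1 hY.2.2

/-- The cotangent lift of a discretization map is a discretization map. -/
theorem IsDiscretizationMap.cotangentLift [CompleteSpace E] (hR : IsDiscretizationMap I U R) :
    IsDiscretizationMap (cotangentModel I) (cotangentLiftDomain I U R) (cotangentLift I R) := by
  have hproj : ∀ z : CotangentBundle I M, (tulczyjew I
      (⟨z, 0⟩ : TangentBundle (cotangentModel I) (CotangentBundle I M))).proj = ⟨z.proj, 0⟩ :=
    fun z => rfl
  have hmem : ∀ z : CotangentBundle I M,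
      (⟨z, 0⟩ : TangentBundle (cotangentModel I) (CotangentBundle I M)) ∈
        cotangentLiftDomain I U R := by
    intro z
    have hz := mem_extChartAt_source (I := I) z.proj
    refine ⟨hR.zero_mem z.proj, (isInvertible_mfderivCoord_iff
      (x := (⟨z.proj, 0⟩ : TangentBundle I M)) (y := (z.proj, z.proj))
      (hR.contMDiffAt_zero z.proj) (mem_tangent_extChartAt_source.2 hz) ?_).2 ?_⟩
    · rw [hR.map_zero]; exact mem_extChartAt_source _
    · rw [tangent_extChartAt_zero]
      exact (hR.isLocalDiscretization z.proj (mem_extChartAt_target z.proj)).isInvertible_fderiv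
  have hzero : ∀ z : CotangentBundle I M, _root_.cotangentLift I R
      (⟨z, 0⟩ : TangentBundle (cotangentModel I) (CotangentBundle I M)) = (z, z) := by
    intro z
    have hz := mem_extChartAt_source (I := I) z.proj
    rw [cotangentLift_eq_symm (z := z) (z₀ := z) (z₁ := z) hR.isOpen hR.contMDiffOn hz (hmem z)
      (by rw [hproj, hR.map_zero]; exact mem_extChartAt_source _), tangent_extChartAt_zero,
      cotangent_extChartAt_self, (hR.isLocalDiscretization z.proj
        (mem_extChartAt_target z.proj)).localCotangentLift_zero, ← cotangent_extChartAt_self]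
    exact extChartAt_to_inv (I := (cotangentModel I).prod (cotangentModel I)) (z, z)
  refine ⟨?_, hmem, fun X hX => (contMDiffAt_cotangentLift hR.isOpen hR.contMDiffOn
    hX).contMDiffWithinAt, hzero, fun z w => ?_⟩
  · rw [isOpen_iff_mem_nhds]
    intro X hX
    have := eventually_mem_regularCoords (z := X.proj) (z₀ := (_root_.cotangentLift I R X).1)
      (z₁ := (_root_.cotangentLift I R X).2) hR.isOpen hR.contMDiffOn (mem_extChartAt_source _) hX
      (mem_extChartAt_source (R (tulczyjew I X).proj))
    filter_upwards [this] with Y hY using hY.2.1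
  · refine mfderiv_sub_of_fderiv (contMDiffAt_cotangentLift hR.isOpen hR.contMDiffOn (hmem z))
      (hzero z) fun d hd => ?_
    have key := (hR.isLocalDiscretization z.proj
      (mem_extChartAt_target z.proj)).fderiv_localCotangentLift_sub
      (CotangentBundle.momentum I z) w
    have ev := written_cotangentLift_eventuallyEq (z := z) (z₀ := z) (z₁ := z) hR.isOpen
      hR.contMDiffOn (mem_extChartAt_source z.proj) (hmem z)
      (by rw [hproj, hR.map_zero]; exact mem_extChartAt_source _)
    rw [tangent_extChartAt_zero] at ev
    rw [← hd, ev.fderiv_eq, cotangent_extChartAt_self]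
    exact key

end CotangentLiftDiscretization

/-! ### The numerical scheme in coordinates -/

section LocalScheme

/-- Solving `(G (h, y)).1 = w` for `y` near a point at which `G (0, y) = (y, y)`. -/
theorem exists_local_solution {Z : Type*} [NormedAddCommGroup Z] [NormedSpace ℝ Z]
    [CompleteSpace Z] {O : Set (ℝ × Z)} (hO : IsOpen O) {g : ℝ × Z → Z} (hg : ContDiffOn ℝ ∞ g O)
    {y₀ : Z} (hy₀ : ((0 : ℝ), y₀) ∈ O) (h0 : ∀ y, ((0 : ℝ), y) ∈ O → g (0, y) = y) :
    ∃ ε > (0 : ℝ), ∃ W N : Set Z, IsOpen W ∧ y₀ ∈ W ∧ IsOpen N ∧ y₀ ∈ N ∧ ∃ Y : ℝ × Z → Z,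
      ContDiffOn ℝ ∞ Y (Ioo (-ε) ε ×ˢ W) ∧
      (∀ h ∈ Ioo (-ε) ε, ∀ y ∈ N, (h, y) ∈ O) ∧
      (∀ h ∈ Ioo (-ε) ε, ∀ w ∈ W, Y (h, w) ∈ N ∧ g (h, Y (h, w)) = w) ∧
      (∀ h ∈ Ioo (-ε) ε, ∀ y ∈ N, g (h, y) ∈ W → Y (h, g (h, y)) = y) := by
  -- Keeping `h` as a component turns the equation with parameter into the inversion of a single
  -- map, so the solution is smooth in `h` and `w` together.
  let Γ : ℝ × Z → ℝ × Z := fun p => (p.1, g p)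
  have hgat : ∀ p ∈ O, ContDiffAt ℝ ∞ g p := fun p hp => hg.contDiffAt (hO.mem_nhds hp)
  have hΓat : ∀ p ∈ O, ContDiffAt ℝ ∞ Γ p := fun p hp => contDiffAt_fst.prodMk (hgat p hp)
  have hg0 : g (0, y₀) = y₀ := h0 y₀ hy₀
  have hΓ0 : Γ (0, y₀) = (0, y₀) := by simp [Γ, hg0]
  have hgd := ((hgat _ hy₀).differentiableAt (by simp)).hasFDerivAt
  have hΓd : HasFDerivAt Γ _ (0, y₀) := hasFDerivAt_fst.prodMk hgd
  have hy : ∀ v, fderiv ℝ g (0, y₀) (0, v) = v := by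
    intro v
    have h1 := HasFDerivAt.comp y₀ hgd (hasFDerivAt_prodMk_right (𝕜 := ℝ) (0 : ℝ) y₀)
    have hc : ContinuousAt (fun y : Z => ((0 : ℝ), y)) y₀ := by fun_prop
    have h2 := (hasFDerivAt_id (𝕜 := ℝ) y₀).congr_of_eventuallyEq (f₁ := g ∘ fun y => ((0 : ℝ), y))
      ((hc.eventually_mem (hO.mem_nhds hy₀)).mono fun y hy => h0 y hy)
    simpa using DFunLike.congr_fun (h1.unique h2) v
  have hinv : (fderiv ℝ Γ (0, y₀)).IsInvertible := by
    rw [hΓd.fderiv]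
    -- Since `g(0, ·)` is the identity, the derivative of `Γ` is `(s, v) ↦ (s, A s + v)`, with
    -- inverse `(s, v) ↦ (s, v - A s)`.
    let A : ℝ →L[ℝ] Z := (fderiv ℝ g (0, y₀)).comp (ContinuousLinearMap.inl ℝ ℝ Z)
    have hA : ∀ p : ℝ × Z, fderiv ℝ g (0, y₀) p = A p.1 + p.2 := by
      intro p
      have : p = (p.1, 0) + (0, p.2) := by simp
      conv_lhs => rw [this, map_add, hy]
      rfl
    refine ContinuousLinearMap.IsInvertible.of_inverse
      (g := (ContinuousLinearMap.fst ℝ ℝ Z).prod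
        (ContinuousLinearMap.snd ℝ ℝ Z - A.comp (ContinuousLinearMap.fst ℝ ℝ Z))) ?_ ?_
    · refine ContinuousLinearMap.ext fun p => Prod.ext rfl ?_
      simp [hA]
    · refine ContinuousLinearMap.ext fun p => Prod.ext rfl ?_
      simp [hA]
  obtain ⟨e, he⟩ := id hinv
  have hΓe : HasFDerivAt Γ (e : ℝ × Z →L[ℝ] ℝ × Z) (0, y₀) := by
    rw [he]; exact hΓd.differentiableAt.hasFDerivAt
  let Φ := (hΓat _ hy₀).toOpenPartialHomeomorph Γ hΓe (by simp)
  have hΦ : ∀ p, Φ p = Γ p := fun p => rfl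
  have hsrc : ((0 : ℝ), y₀) ∈ Φ.source := (hΓat _ hy₀).mem_toOpenPartialHomeomorph_source hΓe (by simp)
  -- Invertibility is required at all points of the box, so that the local inverse is smooth on a
  -- neighbourhood and not only at the centre.
  have hgood : ∀ᶠ p in 𝓝 ((0 : ℝ), y₀), p ∈ Φ.source ∧ p ∈ O ∧ (fderiv ℝ Γ p).IsInvertible :=
    (Φ.open_source.eventually_mem hsrc).and ((hO.eventually_mem hy₀).and
      (eventually_isInvertible_fderiv (hΓat _ hy₀) hinv))
  obtain ⟨A, hA, N, hN, hAN⟩ := mem_nhds_prod_iff.1 hgood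
  obtain ⟨N', hN'N, hN'o, hyN'⟩ := mem_nhds_iff.1 hN
  have htgt : ((0 : ℝ), y₀) ∈ Φ.target := by
    have := Φ.map_source hsrc
    rwa [hΦ, hΓ0] at this
  have hsymm0 : Φ.symm ((0 : ℝ), y₀) = (0, y₀) := by
    conv_lhs => rw [← hΓ0, ← hΦ]
    exact Φ.left_inv hsrc
  have hcont : ContinuousAt Φ.symm ((0 : ℝ), y₀) := Φ.continuousAt_symm htgt
  have hback : ∀ᶠ p in 𝓝 ((0 : ℝ), y₀), p ∈ Φ.target ∧ (Φ.symm p).2 ∈ N' := by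
    refine (Φ.open_target.eventually_mem htgt).and (hcont.snd.eventually_mem ?_)
    rw [hsymm0]
    exact hN'o.mem_nhds hyN'
  obtain ⟨B, hB, W, hW, hBW⟩ := mem_nhds_prod_iff.1 hback
  obtain ⟨W', hW'W, hW'o, hyW'⟩ := mem_nhds_iff.1 hW
  obtain ⟨ε, hε, hεAB⟩ := Metric.mem_nhds_iff.1 (Filter.inter_mem hA hB)
  rw [Real.ball_eq_Ioo, zero_sub, zero_add] at hεAB
  have hbox : ∀ h ∈ Ioo (-ε) ε, ∀ y ∈ N', (h, y) ∈ Φ.source ∧ (h, y) ∈ O ∧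
      (fderiv ℝ Γ (h, y)).IsInvertible := fun h hh y hy => hAN ⟨(hεAB hh).1, hN'N hy⟩
  have hfst : ∀ p ∈ Φ.target, (Φ.symm p).1 = p.1 := by
    intro p hp
    have := Φ.right_inv hp
    have h2 : (Γ (Φ.symm p)).1 = p.1 := by rw [← hΦ, this]
    exact h2
  have hsol : ∀ h ∈ Ioo (-ε) ε, ∀ w ∈ W', (h, w) ∈ Φ.target ∧ (Φ.symm (h, w)).2 ∈ N' ∧
      Φ.symm (h, w) = (h, (Φ.symm (h, w)).2) := by
    intro h hh w hw
    have h1 := hBW (show (h, w) ∈ B ×ˢ W from ⟨(hεAB hh).2, hW'W hw⟩)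
    exact ⟨h1.1, h1.2, Prod.ext (hfst _ h1.1) rfl⟩
  refine ⟨ε, hε, W', N', hW'o, hyW', hN'o, hyN', fun p => (Φ.symm p).2, ?_, ?_, ?_, ?_⟩
  · rintro ⟨h, w⟩ ⟨hh, hw⟩
    obtain ⟨h1, h2, h3⟩ := hsol h hh w hw
    obtain ⟨-, h5, e', he'⟩ := hbox h hh _ h2
    refine ContDiffAt.contDiffWithinAt (ContDiffAt.snd ?_)
    refine Φ.contDiffAt_symm (f₀' := e') h1 ?_ ?_
    · rw [h3, he']
      exact ((hΓat _ h5).differentiableAt (by simp)).hasFDerivAt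
    · rw [h3]
      exact hΓat _ h5
  · exact fun h hh y hy => (hbox h hh y hy).2.1
  · intro h hh w hw
    obtain ⟨h1, h2, h3⟩ := hsol h hh w hw
    refine ⟨h2, ?_⟩
    have := Φ.right_inv h1
    rw [hΦ, h3] at this
    exact congrArg Prod.snd this
  · intro h hh y hy _
    have := Φ.left_inv (hbox h hh y hy).1
    exact congrArg Prod.snd this

theorem contDiffAt_clm_fderiv {V : Type*} [NormedAddCommGroup V] [NormedSpace ℝ V]
    (L : (V →L[ℝ] ℝ) →L[ℝ] V) {f : V → ℝ} {y : V} (hf : ContDiffAt ℝ ∞ f y) :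
    ContDiffAt ℝ ∞ (fun y => L (fderiv ℝ f y)) y :=
  L.contDiff.contDiffAt.comp y (hf.fderiv_right (m := ∞) (by simp))

variable {E : Type*} [NormedAddCommGroup E] [NormedSpace ℝ E] [FiniteDimensional ℝ E]

/-- The Hamiltonian vector field of a function on `E × E*`. -/
def localHamiltonian (f : E × (E →L[ℝ] ℝ) → ℝ) (y : E × (E →L[ℝ] ℝ)) : E × (E →L[ℝ] ℝ) :=
  (stdSymplecticForm E).inverse (fderiv ℝ f y)

theorem stdSymplecticForm_localHamiltonian (f : E × (E →L[ℝ] ℝ) → ℝ) (y v : E × (E →L[ℝ] ℝ)) :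
    v.2 (localHamiltonian f y).1 - (localHamiltonian f y).2 v.1 = fderiv ℝ f y v := by
  rw [← stdSymplecticForm_apply, localHamiltonian,
    isInvertible_stdSymplecticForm.self_apply_inverse]

omit [FiniteDimensional ℝ E] in
theorem contDiffAt_localHamiltonian {f : E × (E →L[ℝ] ℝ) → ℝ} {y : E × (E →L[ℝ] ℝ)}
    (hf : ContDiffAt ℝ ∞ f y) : ContDiffAt ℝ ∞ (localHamiltonian f) y :=
  contDiffAt_clm_fderiv (stdSymplecticForm E).inverse hf

/-- The map sending `(h, y)` to the images under the cotangent lift of the vector `h • ♯(df)`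
at `y`. -/
def localScheme (r : E × E → E × E) (f : E × (E →L[ℝ] ℝ) → ℝ) (p : ℝ × (E × (E →L[ℝ] ℝ))) :
    (E × (E →L[ℝ] ℝ)) × (E × (E →L[ℝ] ℝ)) :=
  localCotangentLift r (p.2, p.1 • localHamiltonian f p.2)

variable {r : E × E → E × E} {f : E × (E →L[ℝ] ℝ) → ℝ}

theorem contDiffAt_localScheme {h : ℝ} {y : E × (E →L[ℝ] ℝ)} (hf : ContDiffAt ℝ ∞ f y)
    (hr : ContDiffAt ℝ ∞ r (y.1, h • (localHamiltonian f y).1))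
    (hi : (fderiv ℝ r (y.1, h • (localHamiltonian f y).1)).IsInvertible) :
    ContDiffAt ℝ ∞ (localScheme r f) (h, y) := by
  have h1 : ContDiffAt ℝ ∞ (fun p : ℝ × (E × (E →L[ℝ] ℝ)) =>
      (p.2, p.1 • localHamiltonian f p.2)) (h, y) :=
    contDiffAt_snd.prodMk (contDiffAt_fst.smul
      (ContDiffAt.comp (h, y) (g := localHamiltonian f) (contDiffAt_localHamiltonian hf) contDiffAt_snd))
  exact ContDiffAt.comp (h, y) (contDiffAt_localCotangentLift
    (y := (y, h • localHamiltonian f y)) hr hi) h1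

/-- The scheme preserves the symplectic form. -/
theorem stdSymplecticForm_localScheme {h : ℝ} {y : E × (E →L[ℝ] ℝ)}
    (hev : ∀ᶠ y in 𝓝 y, ContDiffAt ℝ ∞ f y ∧
      ContDiffAt ℝ ∞ r (y.1, h • (localHamiltonian f y).1) ∧
      (fderiv ℝ r (y.1, h • (localHamiltonian f y).1)).IsInvertible) (u v : E × (E →L[ℝ] ℝ)) :
    stdSymplecticForm E (fderiv ℝ (fun y => (localScheme r f (h, y)).2) y u)
        (fderiv ℝ (fun y => (localScheme r f (h, y)).2) y v) =
      stdSymplecticForm E (fderiv ℝ (fun y => (localScheme r f (h, y)).1) y u)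
        (fderiv ℝ (fun y => (localScheme r f (h, y)).1) y v) := by
  have hG : ∀ y : E × (E →L[ℝ] ℝ), ContDiffAt ℝ ∞ f y ∧
      ContDiffAt ℝ ∞ r (y.1, h • (localHamiltonian f y).1) ∧
      (fderiv ℝ r (y.1, h • (localHamiltonian f y).1)).IsInvertible →
      ContDiffAt ℝ ∞ (fun y => localScheme r f (h, y)) y := fun y hy =>
    ContDiffAt.comp y (g := localScheme r f) (contDiffAt_localScheme hy.1 hy.2.1 hy.2.2)
      (contDiffAt_const.prodMk contDiffAt_id)
  have hy := hev.self_of_nhds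
  have hξ := contDiffAt_localHamiltonian hy.1
  -- `S` is `h` times the action density `p ∂f/∂p - f`. Its differential is `ṗ dq + p dq̇` for `q̇ =
  -- h ∂f/∂p`, `ṗ = -h ∂f/∂q`.
  refine stdSymplecticForm_eq_of_liouville
    (S := fun y => h * (y.2 (localHamiltonian f y).1 - f y))
    (hG y hy).fst (hG y hy).snd
    (contDiffAt_const.mul ((contDiffAt_snd.clm_apply hξ.fst).sub hy.1)) ?_ u v
  filter_upwards [hev] with y hy v
  have dG := ((hG y hy).differentiableAt (by simp)).hasFDerivAt
  have dξ := ((contDiffAt_localHamiltonian hy.1).differentiableAt (by simp)).hasFDerivAt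
  have df := (hy.1.differentiableAt (by simp)).hasFDerivAt
  have dr := (hy.2.1.differentiableAt (by simp)).hasFDerivAt
  have dw : HasFDerivAt (fun y : E × (E →L[ℝ] ℝ) => (y.1, h • (localHamiltonian f y).1)) _ y :=
    hasFDerivAt_fst.prodMk (dξ.fst.const_smul h)
  have drw := HasFDerivAt.comp y (g := r) dr dw
  have e1 := DFunLike.congr_fun (dG.fst.fst.unique drw.fst) v
  have e2 := DFunLike.congr_fun (dG.snd.fst.unique drw.snd) v
  have dS : HasFDerivAt (fun y : E × (E →L[ℝ] ℝ) => h * (y.2 (localHamiltonian f y).1 - f y)) _ y :=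
    (((hasFDerivAt_snd (𝕜 := ℝ) (p := y)).clm_apply dξ.fst).sub df).const_mul h
  -- The test vector is the image of `v` under the derivative of `y ↦ (q, q̇)`, so `Dr` of it gives
  -- the derivatives of `q₀` and `q₁` along `v`.
  have key := localCotangentLift_apply_fderiv (r := r) (y := (y, h • localHamiltonian f y)) hy.2.2
    (v.1, h • (fderiv ℝ (localHamiltonian f) y v).1)
  have hham := stdSymplecticForm_localHamiltonian f y v
  rw [dS.fderiv, dG.fst.fderiv, dG.snd.fderiv]
  simp at e1 e2 key ⊢
  rw [e1, e2]
  unfold localScheme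
  rw [← hham]
  linear_combination key

/-- The scheme approximates the flow of the Hamiltonian vector field to first order. -/
theorem hasDerivAt_localScheme {w : E × (E →L[ℝ] ℝ)} (hf : ContDiffAt ℝ ∞ f w)
    (hr : ∀ᶠ q in 𝓝 w.1, IsLocalDiscretization r q) {c : ℝ → E × (E →L[ℝ] ℝ)} (hc0 : c 0 = w)
    (hc : DifferentiableAt ℝ c 0) (hcw : ∀ᶠ h in 𝓝 0, (localScheme r f (h, c h)).1 = w) :
    HasDerivAt (fun h => (localScheme r f (h, c h)).2) (localHamiltonian f w) 0 := by
  have hr0 := hr.self_of_nhds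
  have dξ := ((contDiffAt_localHamiltonian hf).differentiableAt (by simp)).hasFDerivAt
  have ds := ((contDiffAt_localCotangentLift (r := r) (y := (w, 0)) hr0.contDiffAt
    hr0.isInvertible_fderiv).differentiableAt (by simp)).hasFDerivAt
  have dc := hc.hasDerivAt
  set c' := deriv c 0
  have dξc := HasFDerivAt.comp_hasDerivAt (x := (0 : ℝ)) (by rw [hc0]; exact dξ) dc
  have d1 := dc.prodMk ((hasDerivAt_id (0 : ℝ)).smul dξc)
  have d2 := HasFDerivAt.comp_hasDerivAt (x := (0 : ℝ)) (l := localCotangentLift r)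
    (by simpa [hc0] using ds) d1
  simp only [id, Function.comp_apply, hc0, one_smul, zero_smul, zero_add] at d2
  -- The lift is diagonal on the zero section. The motion of the base point thus contributes equally
  -- to both images and drops out of their difference.
  have hdiag : fderiv ℝ (localCotangentLift r) (w, 0) (c', 0) = (c', c') := by
    have h1 := HasFDerivAt.comp w (g := localCotangentLift r) ds
      (hasFDerivAt_prodMk_left (𝕜 := ℝ) w (0 : E × (E →L[ℝ] ℝ)))
    have h2 := ((hasFDerivAt_id (𝕜 := ℝ) w).prodMk (hasFDerivAt_id w)).congr_of_eventuallyEq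
      (f₁ := localCotangentLift r ∘ fun y => (y, 0)) ((continuousAt_fst.eventually hr).mono
        fun y hy => hy.localCotangentLift_zero y.2)
    simpa using DFunLike.congr_fun (h1.unique h2) c'
  have hsub := hr0.fderiv_localCotangentLift_sub w.2 (localHamiltonian f w)
  have hval : fderiv ℝ (localCotangentLift r) (w, 0) (c', localHamiltonian f w) =
      (c', c') + fderiv ℝ (localCotangentLift r) (w, 0) (0, localHamiltonian f w) := by
    rw [← hdiag, ← map_add]; simp
  have d2 : HasDerivAt (fun h => localScheme r f (h, c h)) _ 0 := d2
  -- The first image stays at `w`, so its velocity is zero. The velocity of the second image equals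
  -- the difference of the two, which is `localHamiltonian f w` by the discretization condition.
  have e1 := (hasFDerivAt_fst.comp_hasDerivAt 0 d2).unique
    ((hasDerivAt_const (0 : ℝ) w).congr_of_eventuallyEq hcw)
  have d3 := hasFDerivAt_snd.comp_hasDerivAt 0 d2
  have e2 : (fderiv ℝ (localCotangentLift r) (w, 0) (c', localHamiltonian f w)).2 =
      localHamiltonian f w := by
    rw [← sub_zero (fderiv ℝ (localCotangentLift r) (w, 0) (c', localHamiltonian f w)).2]
    refine (congrArg _ e1.symm).trans ?_
    simp only [hval, Prod.snd_add, ContinuousLinearMap.coe_fst', Prod.fst_add]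
    rw [add_sub_add_left_eq_sub]
    exact hsub
  simp only [ContinuousLinearMap.coe_snd', e2] at d3
  exact d3

end LocalScheme

/-! ### Symplectic integrators -/

section SymplecticIntegrator

variable {E H : Type*} [NormedAddCommGroup E] [NormedSpace ℝ E] [TopologicalSpace H]
  {I : ModelWithCorners ℝ E H} {M : Type*} [TopologicalSpace M] [ChartedSpace H M]
  [IsManifold I ∞ M] [I.Boundaryless]
  {U : Set (TangentBundle I M)} {R : TangentBundle I M → M × M}

omit [IsManifold I ∞ M] [I.Boundaryless] in
theorem velocity_eq_mk {c : ℝ → M} {x : M} {v : E} (h0 : c 0 = x)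
    (h : mfderivCoord 𝓘(ℝ, ℝ) I c 0 1 = v) : velocity I c = ⟨x, v⟩ := by
  subst h0
  subst h
  rfl

/-- A velocity may be computed in any chart `y` around the point, since `coordDeriv I x y x` is
injective. -/
theorem velocity_eq_of_hasDerivAt {c : ℝ → M} {x y : M} {v w : E}
    (hc : ContMDiffAt 𝓘(ℝ, ℝ) I ∞ c 0) (h0 : c 0 = x) (hx : x ∈ (extChartAt I y).source)
    (hd : HasDerivAt (extChartAt I y ∘ c) w 0) (hv : coordDeriv I x y x v = w) :
    velocity I c = ⟨x, v⟩ := by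
  refine velocity_eq_mk h0 ?_
  have h := DFunLike.congr_fun (fderiv_extChartAt_comp hc h0 hx) 1
  have h2 : fderiv ℝ (extChartAt I y ∘ c) 0 1 = w := by
    rw [hd.hasFDerivAt.fderiv]; simp
  rw [h2, ← hv] at h
  have h3 := congrArg (coordDeriv I y x x) h
  rw [coordDeriv_coordDeriv (mem_extChartAt_source x) hx] at h3
  rw [h3]
  exact (coordDeriv_coordDeriv (mem_extChartAt_source x) hx _).symm

theorem IsDiscretizationMap.zero_mem_regularCoords (hR : IsDiscretizationMap I U R) (x : M) {q : E}
    (hq : q ∈ (extChartAt I x).target) : (q, 0) ∈ regularCoords U R x x x := by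
  refine ⟨⟨mem_tangent_extChartAt_target.2 hq, ?_⟩, (hR.isLocalDiscretization x hq).isInvertible_fderiv⟩
  rw [tangent_extChartAt_symm_zero _ hq]
  refine ⟨hR.zero_mem _, ?_⟩
  rw [mem_preimage, hR.map_zero, extChartAt_prod]
  exact ⟨(extChartAt I x).map_target hq, (extChartAt I x).map_target hq⟩

variable [FiniteDimensional ℝ E]

/-- The vector `h • ♯(dF)` in coordinates. -/
theorem extChartAt_smul_hamiltonianVectorField {F : CotangentBundle I M → ℝ}
    (hF : ContMDiff (cotangentModel I) 𝓘(ℝ, ℝ) ∞ F) (z z' : CotangentBundle I M)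
    (h : z.proj ∈ (extChartAt I z'.proj).source) (t : ℝ) :
    extChartAt (cotangentModel I).tangent
      (⟨z', 0⟩ : TangentBundle (cotangentModel I) (CotangentBundle I M))
      ⟨z, t • hamiltonianVectorField I F z⟩ =
      (extChartAt (cotangentModel I) z' z, t • localHamiltonian
        (F ∘ (extChartAt (cotangentModel I) z').symm) (extChartAt (cotangentModel I) z' z)) := by
  rw [tangent_extChartAt_apply]
  refine Prod.ext rfl ?_
  change coordDeriv (cotangentModel I) z z' z (t • hamiltonianVectorField I F z) = _
  refine (map_smul (coordDeriv (cotangentModel I) z z' z) t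
    (hamiltonianVectorField I F z : E × (E →L[ℝ] ℝ))).trans ?_
  exact congrArg (t • ·) (hamiltonianVectorField_coord hF z _ h)

/-- The equation of the scheme in coordinates. -/
theorem cotangentLift_smul_hamiltonianVectorField (hU : IsOpen U)
    (hR : ContMDiffOn I.tangent (I.prod I) ∞ R U) {F : CotangentBundle I M → ℝ}
    (hF : ContMDiff (cotangentModel I) 𝓘(ℝ, ℝ) ∞ F) (z z' : CotangentBundle I M)
    (h : z.proj ∈ (extChartAt I z'.proj).source) (t : ℝ)
    (hreg : ((extChartAt (cotangentModel I) z' z).1, t • (localHamiltonian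
        (F ∘ (extChartAt (cotangentModel I) z').symm) (extChartAt (cotangentModel I) z' z)).1) ∈
        regularCoords U R z'.proj z'.proj z'.proj) :
    ∃ X ∈ cotangentLiftDomain I U R, X = (⟨z, t • hamiltonianVectorField I F z⟩ :
        TangentBundle (cotangentModel I) (CotangentBundle I M)) ∧
      (cotangentLift I R X).1 ∈ (extChartAt (cotangentModel I) z').source ∧
      (cotangentLift I R X).2 ∈ (extChartAt (cotangentModel I) z').source ∧
      (extChartAt (cotangentModel I) z' (cotangentLift I R X).1,
        extChartAt (cotangentModel I) z' (cotangentLift I R X).2) =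
      localScheme (extChartAt (I.prod I) (z'.proj, z'.proj) ∘ R ∘
        (extChartAt I.tangent (⟨z'.proj, 0⟩ : TangentBundle I M)).symm)
        (F ∘ (extChartAt (cotangentModel I) z').symm) (t, extChartAt (cotangentModel I) z' z) := by
  have e := extChartAt_smul_hamiltonianVectorField hF z z' h t
  set X : TangentBundle (cotangentModel I) (CotangentBundle I M) :=
    ⟨z, t • hamiltonianVectorField I F z⟩ with hXdef
  have hX : X.proj.proj ∈ (extChartAt I z'.proj).source := h
  have hm := (mem_cotangentLiftDomain_iff_regularCoords (z := z') (z₀ := z') (z₁ := z')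
    hU hR hX).1 (by rw [e]; exact hreg)
  have hs := hm.2
  rw [extChartAt_prod] at hs
  refine ⟨X, hm.1, rfl, mem_cotangent_extChartAt_source.2 hs.1,
    mem_cotangent_extChartAt_source.2 hs.2, ?_⟩
  rw [cotangentLift_coord X z' z' z' hX (hR.contMDiffAt (hU.mem_nhds hm.1.1)) hm.1.2 hs.1 hs.2, e]
  rfl

end SymplecticIntegrator

/-! ### Smooth families of maps of a manifold -/

section ParametrizedMaps

variable {E H : Type*} [NormedAddCommGroup E] [NormedSpace ℝ E] [TopologicalSpace H]
  {J : ModelWithCorners ℝ E H} {N : Type*} [TopologicalSpace N] [ChartedSpace H N]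

theorem ContMDiffAt.uncurry_left {f : ℝ × N → N} {t : ℝ} {z : N}
    (hf : ContMDiffAt (𝓘(ℝ, ℝ).prod J) J ∞ f (t, z)) :
    ContMDiffAt 𝓘(ℝ, ℝ) J ∞ (fun s => f (s, z)) t :=
  ContMDiffAt.comp (I' := 𝓘(ℝ, ℝ).prod J) t (g := f) (f := fun s => (s, z)) hf
    (contMDiffAt_id.prodMk contMDiffAt_const)

theorem ContMDiffAt.uncurry_right {f : ℝ × N → N} {t : ℝ} {z : N}
    (hf : ContMDiffAt (𝓘(ℝ, ℝ).prod J) J ∞ f (t, z)) :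
    ContMDiffAt J J ∞ (fun y => f (t, y)) z :=
  ContMDiffAt.comp (I' := 𝓘(ℝ, ℝ).prod J) z (g := f) (f := fun y => (t, y)) hf
    (contMDiffAt_const.prodMk contMDiffAt_id)

variable [IsManifold J ∞ N] [J.Boundaryless]

theorem contMDiffAt_symm_comp_uncurry {y z : N} {t : ℝ} {Ψ : ℝ × E → E}
    (hz : z ∈ (extChartAt J y).source) (hΨ : ContDiffAt ℝ ∞ Ψ (t, extChartAt J y z))
    (ht : Ψ (t, extChartAt J y z) ∈ (extChartAt J y).target) :
    ContMDiffAt (𝓘(ℝ, ℝ).prod J) J ∞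
      (fun p : ℝ × N => (extChartAt J y).symm (Ψ (p.1, extChartAt J y p.2))) (t, z) := by
  have h0 : ContMDiffAt J 𝓘(ℝ, E) ∞ (extChartAt J y) z :=
    contMDiffAt_extChartAt' (by rwa [extChartAt_source] at hz)
  have h1 : ContMDiffAt (𝓘(ℝ, ℝ).prod J) 𝓘(ℝ, ℝ × E) ∞
      (fun p : ℝ × N => (p.1, extChartAt J y p.2)) (t, z) :=
    contMDiffAt_fst.prodMk_space (ContMDiffAt.comp (t, z) h0 contMDiffAt_snd)
  have h3 : ContMDiffAt (𝓘(ℝ, ℝ).prod J) 𝓘(ℝ, E) ∞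
      (fun p : ℝ × N => Ψ (p.1, extChartAt J y p.2)) (t, z) :=
    ContMDiffAt.comp (I' := 𝓘(ℝ, ℝ × E)) (t, z) (g := Ψ)
      (f := fun p => (p.1, extChartAt J y p.2)) hΨ.contMDiffAt h1
  have h4 := (contMDiffOn_extChartAt_symm (I := J) (n := ∞) y).contMDiffAt
    ((isOpen_extChartAt_target y).mem_nhds ht)
  exact ContMDiffAt.comp (I' := 𝓘(ℝ, E)) (t, z) (g := (extChartAt J y).symm)
    (f := fun p => Ψ (p.1, extChartAt J y p.2)) h4 h3

end ParametrizedMaps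

/-! ### Symplectic maps in coordinates -/

section SymplecticMaps

variable {E H : Type*} [NormedAddCommGroup E] [NormedSpace ℝ E] [TopologicalSpace H]
  {I : ModelWithCorners ℝ E H} {M : Type*} [TopologicalSpace M] [ChartedSpace H M]
  [IsManifold I ∞ M] [I.Boundaryless]

/-- A map of `T*M` that preserves `dq ∧ dp` in coordinates preserves the symplectic form. -/
theorem symplecticForm_mfderiv {ψ : CotangentBundle I M → CotangentBundle I M}
    {z zc : CotangentBundle I M}
    (hψ : ContMDiffAt (cotangentModel I) (cotangentModel I) ∞ ψ z)
    (hz : z ∈ (extChartAt (cotangentModel I) zc).source)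
    (hψz : ψ z ∈ (extChartAt (cotangentModel I) zc).source)
    {D : E × (E →L[ℝ] ℝ) →L[ℝ] E × (E →L[ℝ] ℝ)}
    (hD : fderiv ℝ (extChartAt (cotangentModel I) zc ∘ ψ ∘
      (extChartAt (cotangentModel I) zc).symm) (extChartAt (cotangentModel I) zc z) = D)
    (h : ∀ u u', stdSymplecticForm E (D u) (D u') = stdSymplecticForm E u u')
    (v v' : TangentSpace (cotangentModel I) z) :
    symplecticForm I (ψ z) (mfderiv (cotangentModel I) (cotangentModel I) ψ z v)
      (mfderiv (cotangentModel I) (cotangentModel I) ψ z v') = symplecticForm I z v v' := by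
  have key := fderiv_written_comp (f := ψ) (y := zc) hψ hz hψz
  rw [hD] at key
  have hk : ∀ u, coordDeriv (cotangentModel I) (ψ z) zc (ψ z)
      (mfderivCoord (cotangentModel I) (cotangentModel I) ψ z u) =
      D (coordDeriv (cotangentModel I) z zc z u) := fun u => (DFunLike.congr_fun key u).symm
  have h1 := symplecticForm_coord (ψ z) zc (mem_cotangent_extChartAt_source.1 hψz)
    (mfderivCoord (cotangentModel I) (cotangentModel I) ψ z v)
    (mfderivCoord (cotangentModel I) (cotangentModel I) ψ z v')
  have h2 := symplecticForm_coord z zc (mem_cotangent_extChartAt_source.1 hz) v v'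
  exact h1.trans ((congrArg₂ (fun a b => stdSymplecticForm E a b) (hk _) (hk _)).trans
    ((h _ _).trans h2.symm))

end SymplecticMaps

/-! ### The symplectic integrator of a cotangent lift -/

section SymplecticIntegratorTheorem

variable {E H : Type*} [NormedAddCommGroup E] [NormedSpace ℝ E] [TopologicalSpace H]
  {I : ModelWithCorners ℝ E H} {M : Type*} [TopologicalSpace M] [ChartedSpace H M]
  [IsManifold I ∞ M] [I.Boundaryless]
  {U : Set (TangentBundle I M)} {R : TangentBundle I M → M × M} [FiniteDimensional ℝ E]

/-- The scheme generated by the cotangent lift of a discretization map is a symplectic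
integrator. -/
theorem IsDiscretizationMap.generatesSymplecticIntegrator (hR : IsDiscretizationMap I U R)
    {F : CotangentBundle I M → ℝ} (hF : ContMDiff (cotangentModel I) 𝓘(ℝ, ℝ) ∞ F) :
    GeneratesSymplecticIntegrator I (cotangentLiftDomain I U R) (_root_.cotangentLift I R) F := by
  intro zc
  set κ := extChartAt (cotangentModel I) zc with hκ
  set r := extChartAt (I.prod I) (zc.proj, zc.proj) ∘ R ∘
    (extChartAt I.tangent (⟨zc.proj, 0⟩ : TangentBundle I M)).symm with hr
  set f := F ∘ κ.symm with hf
  have hTopen : IsOpen κ.target := isOpen_extChartAt_target zc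
  have hsrcopen : IsOpen κ.source := isOpen_extChartAt_source zc
  have hsymm : ∀ y ∈ κ.target, ContMDiffAt 𝓘(ℝ, E × (E →L[ℝ] ℝ)) (cotangentModel I) ∞ κ.symm y :=
    fun y hy => (contMDiffOn_extChartAt_symm zc).contMDiffAt (hTopen.mem_nhds hy)
  have hfs : ∀ y ∈ κ.target, ContDiffAt ℝ ∞ f y := fun y hy =>
    contMDiffAt_iff_contDiffAt.1 (ContMDiffAt.comp y hF.contMDiffAt (hsymm y hy))
  have hdisc : ∀ y ∈ κ.target, IsLocalDiscretization r y.1 := fun y hy =>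
    hR.isLocalDiscretization zc.proj (mem_cotangent_extChartAt_target.1 hy)
  -- The pairs `(h, y)` for which the lift is defined at the vector `h ♯(dF)` at `y`, with both
  -- images in the domain of the same chart.
  let O : Set (ℝ × (E × (E →L[ℝ] ℝ))) := {p | p.2 ∈ κ.target ∧
    (p.2.1, p.1 • (localHamiltonian f p.2).1) ∈ regularCoords U R zc.proj zc.proj zc.proj}
  have hO : IsOpen O := by
    rw [isOpen_iff_mem_nhds]
    rintro p ⟨h1, h2⟩
    have hc : ContinuousAt (fun p : ℝ × (E × (E →L[ℝ] ℝ)) =>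
        (p.2.1, p.1 • (localHamiltonian f p.2).1)) p := by
      have hξ : ContinuousAt (fun p : ℝ × (E × (E →L[ℝ] ℝ)) => localHamiltonian f p.2) p :=
        ContinuousAt.comp (g := localHamiltonian f)
          (contDiffAt_localHamiltonian (hfs _ h1)).continuousAt continuousAt_snd
      exact continuousAt_snd.fst.prodMk (continuousAt_fst.smul hξ.fst)
    exact (continuousAt_snd.eventually_mem (hTopen.mem_nhds h1)).and (hc.eventually_mem
      ((isOpen_regularCoords hR.isOpen hR.contMDiffOn _ _ _).mem_nhds h2))
  have hrs : ∀ p ∈ O, ContDiffAt ℝ ∞ f p.2 ∧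
      ContDiffAt ℝ ∞ r (p.2.1, p.1 • (localHamiltonian f p.2).1) ∧
      (fderiv ℝ r (p.2.1, p.1 • (localHamiltonian f p.2).1)).IsInvertible := fun p hp =>
    ⟨hfs _ hp.1, contDiffAt_of_mem_regularCoords hR.isOpen hR.contMDiffOn hp.2.1.1 hp.2.1.2, hp.2.2⟩
  have hGs : ∀ p ∈ O, ContDiffAt ℝ ∞ (localScheme r f) p := fun p hp =>
    contDiffAt_localScheme (hrs p hp).1 (hrs p hp).2.1 (hrs p hp).2.2
  have hG0 : ∀ y ∈ κ.target, localScheme r f (0, y) = (y, y) := by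
    intro y hy
    unfold localScheme
    rw [zero_smul]
    exact (hdisc y hy).localCotangentLift_zero y.2
  have hO0 : ∀ y ∈ κ.target, ((0 : ℝ), y) ∈ O := by
    intro y hy
    refine ⟨hy, ?_⟩
    rw [zero_smul]
    exact hR.zero_mem_regularCoords zc.proj (mem_cotangent_extChartAt_target.1 hy)
  -- The unknown is the base point of `X`: `Y (h, w)` is the one whose first image is `w`. It is
  -- unique within `N`, which is why the scheme restricts the base point to a neighbourhood.
  obtain ⟨ε, hε, W, N, hW, hzW, hN, hzN, Y, hY, hNO, hYsol, hYuniq⟩ :=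
    exists_local_solution hO (g := fun p => (localScheme r f p).1)
      (fun p hp => (hGs p hp).fst.contDiffWithinAt) (hO0 _ (mem_extChartAt_target zc))
      (fun y hy => congrArg Prod.fst (hG0 y hy.1))
  have h0mem : (0 : ℝ) ∈ Ioo (-ε) ε := ⟨by linarith, hε⟩
  have hYO : ∀ t ∈ Ioo (-ε) ε, ∀ w ∈ W, (t, Y (t, w)) ∈ O := fun t ht w hw =>
    hNO t ht _ (hYsol t ht w hw).1
  have hYat : ∀ t ∈ Ioo (-ε) ε, ∀ w ∈ W, ContDiffAt ℝ ∞ Y (t, w) := fun t ht w hw =>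
    hY.contDiffAt ((isOpen_Ioo.prod hW).mem_nhds ⟨ht, hw⟩)
  let Ψ : ℝ × (E × (E →L[ℝ] ℝ)) → E × (E →L[ℝ] ℝ) := fun p => (localScheme r f (p.1, Y p)).2
  have hΨat : ∀ t ∈ Ioo (-ε) ε, ∀ w ∈ W, ContDiffAt ℝ ∞ Ψ (t, w) := fun t ht w hw =>
    ContDiffAt.snd (ContDiffAt.comp (t, w) (g := localScheme r f) (hGs _ (hYO t ht w hw))
      (contDiffAt_fst.prodMk (hYat t ht w hw)))
  have hscheme : ∀ z ∈ κ.source, ∀ t : ℝ, (t, κ z) ∈ O → ∃ X ∈ cotangentLiftDomain I U R,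
      X = (⟨z, t • hamiltonianVectorField I F z⟩ :
        TangentBundle (cotangentModel I) (CotangentBundle I M)) ∧
      (_root_.cotangentLift I R X).1 ∈ κ.source ∧ (_root_.cotangentLift I R X).2 ∈ κ.source ∧
      (κ (_root_.cotangentLift I R X).1, κ (_root_.cotangentLift I R X).2) =
        localScheme r f (t, κ z) := fun z hz t ht =>
    cotangentLift_smul_hamiltonianVectorField hR.isOpen hR.contMDiffOn hF z zc
      (mem_cotangent_extChartAt_source.1 hz) t ht.2
  have hsolpt : ∀ t ∈ Ioo (-ε) ε, ∀ w ∈ W, κ.symm (Y (t, w)) ∈ κ.source ∧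
      κ (κ.symm (Y (t, w))) = Y (t, w) := fun t ht w hw =>
    ⟨κ.map_target (hYO t ht w hw).1, κ.right_inv (hYO t ht w hw).1⟩
  -- `Ψ (t, w)` is the coordinate of an actual point, the second image under the lift, which lies in
  -- the chart domain by the choice of `O`.
  have hΨmem : ∀ t ∈ Ioo (-ε) ε, ∀ w ∈ W, Ψ (t, w) ∈ κ.target := by
    intro t ht w hw
    obtain ⟨h1, h2⟩ := hsolpt t ht w hw
    obtain ⟨X, -, -, -, h3, h4⟩ := hscheme _ h1 t (by rw [h2]; exact hYO t ht w hw)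
    rw [h2] at h4
    have h5 : Ψ (t, w) = κ (_root_.cotangentLift I R X).2 := (congrArg Prod.snd h4).symm
    rw [h5]
    exact κ.map_source h3
  have hY0 : ∀ w ∈ W, Y (0, w) = w := by
    intro w hw
    have h1 := (hYsol 0 h0mem w hw).2
    rw [hG0 _ (hYO 0 h0mem w hw).1] at h1
    exact h1
  have hΨ0 : ∀ w ∈ W, Ψ (0, w) = w := by
    intro w hw
    change (localScheme r f (0, Y (0, w))).2 = w
    rw [hG0 _ (hYO 0 h0mem w hw).1, hY0 w hw]
  have hψsm : ∀ t ∈ Ioo (-ε) ε, ∀ z ∈ κ.source ∩ κ ⁻¹' W,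
      ContMDiffAt (𝓘(ℝ, ℝ).prod (cotangentModel I)) (cotangentModel I) ∞
        (fun p : ℝ × CotangentBundle I M => κ.symm (Ψ (p.1, κ p.2))) (t, z) := by
    intro t ht z hz
    exact contMDiffAt_symm_comp_uncurry hz.1 (hΨat t ht _ hz.2) (hΨmem t ht _ hz.2)
  refine ⟨ε, hε, κ.source ∩ κ ⁻¹' W, κ.source ∩ κ ⁻¹' N,
    (continuousOn_extChartAt zc).isOpen_inter_preimage hsrcopen hW,
    ⟨mem_extChartAt_source zc, hzW⟩,
    (continuousOn_extChartAt zc).isOpen_inter_preimage hsrcopen hN,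
    ⟨mem_extChartAt_source zc, hzN⟩, fun t z => κ.symm (Ψ (t, κ z)),
    fun p hp => (hψsm p.1 hp.1 p.2 hp.2).contMDiffWithinAt, ?_, ?_, ?_⟩
  · intro t ht z₀ hz₀ z₁
    constructor
    · rintro ⟨X, -, hX1, hX2, hX3⟩
      obtain ⟨X', -, rfl, h1, h2, h3⟩ := hscheme X.proj hX2.1 t (hNO t ht _ hX2.2)
      have hXX : X = (⟨X.proj, t • hamiltonianVectorField I F X.proj⟩ :
          TangentBundle (cotangentModel I) (CotangentBundle I M)) := by
        rw [← hX3]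
      rw [← hXX, hX1] at h1 h2 h3
      have e1 : κ z₀ = (localScheme r f (t, κ X.proj)).1 := congrArg Prod.fst h3
      have e2 : κ z₁ = (localScheme r f (t, κ X.proj)).2 := congrArg Prod.snd h3
      -- The vector `X` is determined by its base point, and the base point by its first image `z₀`.
      have e3 := hYuniq t ht _ hX2.2 (by rw [← e1]; exact hz₀.2)
      rw [← e1] at e3
      change z₁ = κ.symm (localScheme r f (t, Y (t, κ z₀))).2
      rw [e3, ← e2]
      exact (κ.left_inv h2).symm
    · rintro rfl
      obtain ⟨h1, h2⟩ := hsolpt t ht _ hz₀.2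
      obtain ⟨hyN, hysol⟩ := hYsol t ht _ hz₀.2
      obtain ⟨X, hX, hXe, h4, h5, h6⟩ := hscheme _ h1 t (by rw [h2]; exact hYO t ht _ hz₀.2)
      rw [h2] at h6
      have e1 : κ (_root_.cotangentLift I R X).1 = (localScheme r f (t, Y (t, κ z₀))).1 :=
        congrArg Prod.fst h6
      have e2 : κ (_root_.cotangentLift I R X).2 = (localScheme r f (t, Y (t, κ z₀))).2 :=
        congrArg Prod.snd h6
      refine ⟨X, hX, Prod.ext ?_ ?_, ?_, ?_⟩
      · refine κ.injOn h4 hz₀.1 ?_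
        rw [e1]
        exact hysol
      · change _ = κ.symm (localScheme r f (t, Y (t, κ z₀))).2
        rw [← e2]
        exact (κ.left_inv h5).symm
      · rw [hXe]
        exact ⟨h1, by rw [mem_preimage]; exact h2.symm ▸ hyN⟩
      · rw [hXe]
  · intro z₀ hz₀
    have hT0 : κ z₀ ∈ κ.target := κ.map_source hz₀.1
    have hcd : ∀ t ∈ Ioo (-ε) ε, κ (κ.symm (Ψ (t, κ z₀))) = Ψ (t, κ z₀) := fun t ht =>
      κ.right_inv (hΨmem t ht _ hz₀.2)
    have hIoo : ∀ᶠ t in 𝓝 (0 : ℝ), t ∈ Ioo (-ε) ε := isOpen_Ioo.eventually_mem h0mem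
    have hcurve : ContMDiffAt 𝓘(ℝ, ℝ) (cotangentModel I) ∞
        (fun t => κ.symm (Ψ (t, κ z₀))) 0 :=
      (hψsm 0 h0mem z₀ hz₀).uncurry_left
    refine velocity_eq_of_hasDerivAt (y := zc) (w := localHamiltonian f (κ z₀)) hcurve ?_ hz₀.1 ?_
      (hamiltonianVectorField_coord hF z₀ zc (mem_cotangent_extChartAt_source.1 hz₀.1))
    · change κ.symm (Ψ (0, κ z₀)) = z₀
      rw [hΨ0 _ hz₀.2, κ.left_inv hz₀.1]
    · have hc : DifferentiableAt ℝ (fun t => Y (t, κ z₀)) 0 :=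
        DifferentiableAt.comp (0 : ℝ) ((hYat 0 h0mem _ hz₀.2).differentiableAt (by simp))
          (by fun_prop)
      have hd := hasDerivAt_localScheme (r := r) (hfs _ hT0)
        ((isOpen_extChartAt_target (I := I) zc.proj).eventually_mem
          (mem_cotangent_extChartAt_target.1 hT0) |>.mono fun q hq =>
            hR.isLocalDiscretization zc.proj hq) (c := fun t => Y (t, κ z₀)) (hY0 _ hz₀.2) hc
        (hIoo.mono fun t ht => (hYsol t ht _ hz₀.2).2)
      refine hd.congr_of_eventuallyEq ?_
      filter_upwards [hIoo] with t ht using hcd t ht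
  · intro t ht z₀ hz₀ v v'
    set w := κ z₀ with hw
    have hsm : ContMDiffAt (cotangentModel I) (cotangentModel I) ∞
        (fun z => κ.symm (Ψ (t, κ z))) z₀ :=
      (hψsm t ht z₀ hz₀).uncurry_right
    have hmem : κ.symm (Ψ (t, κ z₀)) ∈ κ.source := κ.map_target (hΨmem t ht _ hz₀.2)
    have hWev : ∀ᶠ w' in 𝓝 w, w' ∈ W := hW.eventually_mem hz₀.2
    have hwr : extChartAt (cotangentModel I) zc ∘ (fun z => κ.symm (Ψ (t, κ z))) ∘
        (extChartAt (cotangentModel I) zc).symm =ᶠ[𝓝 w] fun w' => Ψ (t, w') := by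
      filter_upwards [hWev, hTopen.eventually_mem (κ.map_source hz₀.1)] with w' h1 h2
      change κ (κ.symm (Ψ (t, κ (κ.symm w')))) = Ψ (t, w')
      rw [κ.right_inv h2, κ.right_inv (hΨmem t ht _ h1)]
    have dY : HasFDerivAt (fun w' => Y (t, w')) _ w :=
      HasFDerivAt.comp w (g := Y) ((hYat t ht _ hz₀.2).differentiableAt (by simp)).hasFDerivAt
        (hasFDerivAt_prodMk_right (𝕜 := ℝ) t w)
    have hGt := ContDiffAt.comp (Y (t, w)) (g := localScheme r f) (hGs _ (hYO t ht _ hz₀.2))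
      ((contDiffAt_const (c := t)).prodMk contDiffAt_id)
    have dG1 := (hGt.fst.differentiableAt (by simp)).hasFDerivAt.comp w dY
    have dG2 := (hGt.snd.differentiableAt (by simp)).hasFDerivAt.comp w dY
    -- With `G₁`, `G₂` the two components of the scheme, `G₁ ∘ Y = id` and `ψ = G₂ ∘ Y` in
    -- coordinates. Pulling `G₂*ω = G₁*ω` back by `Y` gives `ψ*ω = ω`.
    have eid := dG1.unique ((hasFDerivAt_id (𝕜 := ℝ) w).congr_of_eventuallyEq
      (hWev.mono fun w' hw' => (hYsol t ht w' hw').2))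
    have hcont : ContinuousAt (fun y : E × (E →L[ℝ] ℝ) => (t, y)) (Y (t, w)) := by fun_prop
    have hsympl := stdSymplecticForm_localScheme (r := r) (f := f) (h := t) (y := Y (t, w))
      ((hcont.eventually_mem (hO.mem_nhds (hYO t ht _ hz₀.2))).mono fun y hy => hrs (t, y) hy)
    refine symplecticForm_mfderiv hsm hz₀.1 hmem (hwr.fderiv_eq.trans dG2.fderiv) (fun u u' => ?_) v v'
    refine (hsympl _ _).trans ?_
    have e1 := DFunLike.congr_fun eid u
    have e2 := DFunLike.congr_fun eid u'
    exact congrArg₂ (fun a b => stdSymplecticForm E a b) e1 e2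

end SymplecticIntegratorTheorem

/-! ### Taylor coefficients depending on a parameter -/

section TaylorParam

variable {E F A : Type*} [NormedAddCommGroup E] [NormedSpace ℝ E]
  [NormedAddCommGroup F] [NormedSpace ℝ F] [NormedAddCommGroup A] [NormedSpace ℝ A]

theorem deriv_param_eventuallyEq {f : A × ℝ → F} {S : Set (A × ℝ)} (hS : IsOpen S)
    (hf : ContDiffOn ℝ ∞ f S) {p : A × ℝ} (hp : p ∈ S) :
    deriv (fun t => f (p.1, t)) =ᶠ[𝓝 p.2] fun t => fderiv ℝ f (p.1, t) (0, 1) := by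
  have hc : ContinuousAt (fun t : ℝ => (p.1, t)) p.2 := by fun_prop
  filter_upwards [hc (hS.mem_nhds hp)] with t ht
  have hd : HasFDerivAt f (fderiv ℝ f (p.1, t)) (p.1, t) :=
    ((hf.contDiffAt (hS.mem_nhds ht)).differentiableAt (by simp)).hasFDerivAt
  have hl : HasDerivAt (fun t : ℝ => (p.1, t)) ((0 : A), (1 : ℝ)) t :=
    (hasDerivAt_const t p.1).prodMk (hasDerivAt_id t)
  exact (hd.comp_hasDerivAt t hl).deriv

theorem contDiffOn_fderiv_apply {f : A × ℝ → F} {S : Set (A × ℝ)} (hS : IsOpen S)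
    (hf : ContDiffOn ℝ ∞ f S) (v : A × ℝ) : ContDiffOn ℝ ∞ (fun p => fderiv ℝ f p v) S :=
  (hf.fderiv_of_isOpen hS (by simp)).clm_apply contDiffOn_const

theorem fderiv_fderiv_apply {f : A → F} {p : A} (hf : ContDiffAt ℝ ∞ f p) (u v : A) :
    fderiv ℝ (fun p => fderiv ℝ f p v) p u = fderiv ℝ (fderiv ℝ f) p u v :=
  DFunLike.congr_fun (hf.hasFDerivAt_fderiv.clm_apply (hasFDerivAt_const v p)).fderiv u |>.trans
    (by simp)

/-- Induction on `i` with `f` varying: one derivative in `t` is absorbed by passing to `∂f/∂t`, and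
it is exchanged with the derivative in the parameter by symmetry of second derivatives. -/
theorem fderiv_iteratedDeriv_param (i : ℕ) (b : A) : ∀ {f : A × ℝ → F} {S : Set (A × ℝ)},
    IsOpen S → ContDiffOn ℝ ∞ f S → ∀ p ∈ S,
    fderiv ℝ (fun p : A × ℝ => iteratedDeriv i (fun t => f (p.1, t)) p.2) p (b, 0) =
      iteratedDeriv i (fun t => fderiv ℝ f (p.1, t) (b, 0)) p.2 := by
  induction i with
  | zero => intro f S _ _ p _; simp
  | succ i ih =>
    intro f S hS hf p hp
    have e : (fun p : A × ℝ => iteratedDeriv (i + 1) (fun t => f (p.1, t)) p.2) =ᶠ[𝓝 p]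
        fun p => iteratedDeriv i (fun t => fderiv ℝ f (p.1, t) (0, 1)) p.2 := by
      filter_upwards [hS.mem_nhds hp] with p hp
      rw [iteratedDeriv_succ']
      exact (deriv_param_eventuallyEq hS hf hp).iteratedDeriv_eq i
    rw [e.fderiv_eq, ih hS (contDiffOn_fderiv_apply hS hf _) p hp, iteratedDeriv_succ']
    refine Filter.EventuallyEq.iteratedDeriv_eq i ?_
    have hc : ContinuousAt (fun t : ℝ => (p.1, t)) p.2 := by fun_prop
    filter_upwards [deriv_param_eventuallyEq hS (contDiffOn_fderiv_apply hS hf (b, 0)) hp,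
      hc (hS.mem_nhds hp)] with t ht ht'
    have hft := hf.contDiffAt (hS.mem_nhds ht')
    rw [ht, fderiv_fderiv_apply hft, fderiv_fderiv_apply hft, fderiv_fderiv_symm hft]

/-- The derivative of the Taylor coefficients with respect to a parameter. -/
theorem fderiv_taylorCoeffs_param {k : ℕ} {f : A × ℝ → F} {S : Set (A × ℝ)}
    (hS : IsOpen S) (hf : ContDiffOn ℝ ∞ f S) {a : A} (ha : (a, (0 : ℝ)) ∈ S) (b : A) :
    fderiv ℝ (fun a : A => taylorCoeffs k (fun t => f (a, t))) a b =
      taylorCoeffs k (fun t => fderiv ℝ f (a, t) (b, 0)) := by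
  have hd : ∀ i : Fin (k + 1), HasFDerivAt (fun a : A => taylorCoeffs k (fun t => f (a, t)) i) _ a :=
    fun i => ((HasFDerivAt.comp a
      (g := fun p : A × ℝ => iteratedDeriv i (fun t => f (p.1, t)) p.2)
      (((contDiffOn_iteratedDeriv_param i hS hf).contDiffAt (hS.mem_nhds ha)).differentiableAt
        (by simp)).hasFDerivAt (hasFDerivAt_prodMk_left (𝕜 := ℝ) a (0 : ℝ))).const_smul
        ((((i : ℕ).factorial : ℝ))⁻¹))
  rw [(hasFDerivAt_pi.2 hd).fderiv]
  funext i
  change ((i : ℕ).factorial : ℝ)⁻¹ • fderiv ℝ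
    (fun p : A × ℝ => iteratedDeriv i (fun t => f (p.1, t)) p.2) (a, 0) (b, 0) = _
  rw [fderiv_iteratedDeriv_param i b hS hf _ ha]
  rfl

theorem taylorCoeffs_clm_comp {k : ℕ} (L : E →L[ℝ] F) {f : ℝ → E} (hf : ContDiffAt ℝ ∞ f 0)
    (i : Fin (k + 1)) : taylorCoeffs k (fun t => L (f t)) i = L (taylorCoeffs k f i) := by
  unfold taylorCoeffs
  rw [map_smul]
  congr 1
  have h := L.iteratedFDeriv_comp_left hf (i := (i : ℕ)) (by exact_mod_cast le_top)
  exact DFunLike.congr_fun h (fun _ => (1 : ℝ))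

theorem taylorCoeffs_prodMk {k : ℕ} {f : ℝ → E} {g : ℝ → F} (hf : ContDiffAt ℝ ∞ f 0)
    (hg : ContDiffAt ℝ ∞ g 0) :
    taylorCoeffs k (fun t => (f t, g t)) = fun i => (taylorCoeffs k f i, taylorCoeffs k g i) := by
  funext i
  have h1 := taylorCoeffs_clm_comp (k := k) (ContinuousLinearMap.fst ℝ E F) (hf.prodMk hg) i
  have h2 := taylorCoeffs_clm_comp (k := k) (ContinuousLinearMap.snd ℝ E F) (hf.prodMk hg) i
  exact Prod.ext h1.symm h2.symm

theorem taylorCurve_prodMk {k : ℕ} (a : Fin (k + 1) → E) (b : Fin (k + 1) → F) (t : ℝ) :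
    taylorCurve (fun i => (a i, b i)) t = (taylorCurve a t, taylorCurve b t) := by
  unfold taylorCurve
  exact Prod.ext (by simp [Prod.fst_sum]) (by simp [Prod.snd_sum])

theorem taylorCurve_add_smul {k : ℕ} (a b : Fin (k + 1) → E) (s t : ℝ) :
    taylorCurve (a + s • b) t = taylorCurve a t + s • taylorCurve b t := by
  unfold taylorCurve
  simp only [Pi.add_apply, Pi.smul_apply, smul_add, Finset.sum_add_distrib, Finset.smul_sum]
  congr 1
  exact Finset.sum_congr rfl fun i _ => smul_comm _ _ _

theorem taylorCurve_zero_left {k : ℕ} (t : ℝ) : taylorCurve (0 : Fin (k + 1) → E) t = 0 := by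
  simp [taylorCurve]

/-- The polynomial curve is linear in its coefficients, so its derivative along `b` is read off from
the line `a + s • b`. -/
theorem fderiv_taylorCurve_uncurry {k : ℕ} (a : Fin (k + 1) → E) (t : ℝ)
    (b : Fin (k + 1) → E) :
    fderiv ℝ (fun p : (Fin (k + 1) → E) × ℝ => taylorCurve p.1 p.2) (a, t) (b, 0) =
      taylorCurve b t := by
  have h1 : HasDerivAt (fun s : ℝ => taylorCurve (a + s • b) t) (taylorCurve b t) 0 := by
    simp only [taylorCurve_add_smul]
    simpa using ((hasDerivAt_id (0 : ℝ)).smul_const (taylorCurve b t)).const_add (taylorCurve a t)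
  have h2 : HasDerivAt (fun s : ℝ => (a + s • b, t)) (b, 0) 0 := by
    have := (((hasDerivAt_id (0 : ℝ)).smul_const b).const_add a).prodMk (hasDerivAt_const (0 : ℝ) t)
    simpa using this
  have h3 : HasFDerivAt (fun p : (Fin (k + 1) → E) × ℝ => taylorCurve p.1 p.2) _
      ((fun s : ℝ => (a + s • b, t)) 0) :=
    ((contDiff_taylorCurve_uncurry (E := E) (k := k)).differentiable (by simp) _).hasFDerivAt
  have h4 : HasDerivAt (fun s : ℝ => taylorCurve (a + s • b) t) _ 0 :=
    HasFDerivAt.comp_hasDerivAt (l := fun p : (Fin (k + 1) → E) × ℝ => taylorCurve p.1 p.2)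
      (f := fun s : ℝ => (a + s • b, t)) (0 : ℝ) h3 h2
  simpa using h4.unique h1

end TaylorParam

/-! ### Jets and their charts -/

section JetCharts

variable {E H : Type*} [NormedAddCommGroup E] [NormedSpace ℝ E] [TopologicalSpace H]
  {I : ModelWithCorners ℝ E H} {Q : Type*} [TopologicalSpace Q] [ChartedSpace H Q]
  [I.Boundaryless] [IsManifold I ∞ Q] {k : ℕ}

namespace HigherTangentBundle

theorem extChartAt_eq_jetChart (z : HigherTangentBundle I Q k) :
    extChartAt 𝓘(ℝ, Fin (k + 1) → E) z = jetChart k z.proj := by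
  rw [extChartAt, OpenPartialHomeomorph.extend, modelWithCornersSelf_partialEquiv,
    PartialEquiv.trans_refl]
  rfl

theorem mem_jetChart_source {x : Q} {z : HigherTangentBundle I Q k} :
    z ∈ (jetChart k x).source ↔ z.proj ∈ (extChartAt I x).source := by
  rw [extChartAt_source]
  rfl

theorem jetChart_jet {c : ℝ → Q} (hc : ContMDiffAt 𝓘(ℝ, ℝ) I ∞ c 0) {x : Q}
    (hx : c 0 ∈ (extChartAt I x).source) :
    jetChart k x (jet I k c) = taylorCoeffs k (extChartAt I x ∘ c) :=
  ((jet_eq_jet_iff_chart hc (contMDiffAt_curve _) (by rwa [extChartAt_source] at hx)).1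
    (jet_curve _).symm).2.symm

omit [I.Boundaryless] [IsManifold I ∞ Q] in
theorem jet_congr {c d : ℝ → Q} (hd : ContMDiffAt 𝓘(ℝ, ℝ) I ∞ d 0) (h : c =ᶠ[𝓝 0] d) :
    jet I k c = jet I k d :=
  (jet_eq_jet_iff (hd.congr_of_eventuallyEq h) hd).2
    ⟨h.eq_of_nhds, taylorCoeffs_congr (h.fun_comp _)⟩

theorem jetChart_apply_zero {x : Q} {z : HigherTangentBundle I Q k} :
    jetChart k x z 0 = extChartAt I x z.proj := by
  simp [jetChart, taylorCoeffs, curve_zero]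

/-- The zeroth Taylor coefficient of a jet is the coordinate of its base point, so near `z` the
projection is an inverse chart after a coordinate function. -/
theorem continuous_proj : Continuous (proj : HigherTangentBundle I Q k → Q) := by
  rw [continuous_iff_continuousAt]
  intro z
  have hz : z ∈ (extChartAt 𝓘(ℝ, Fin (k + 1) → E) z).source := mem_extChartAt_source z
  have hc := continuousAt_extChartAt (I := 𝓘(ℝ, Fin (k + 1) → E)) z
  have h0 : extChartAt 𝓘(ℝ, Fin (k + 1) → E) z z 0 = extChartAt I z.proj z.proj := by
    rw [extChartAt_eq_jetChart]; exact jetChart_apply_zero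
  have h : ContinuousAt (fun z' => (extChartAt I z.proj).symm
      (extChartAt 𝓘(ℝ, Fin (k + 1) → E) z z' 0)) z := by
    refine ContinuousAt.comp (g := (extChartAt I z.proj).symm) ?_
      ((continuous_apply (0 : Fin (k + 1))).continuousAt.comp hc)
    rw [h0]
    exact continuousAt_extChartAt_symm z.proj
  refine h.congr ?_
  filter_upwards [(isOpen_extChartAt_source (I := 𝓘(ℝ, Fin (k + 1) → E)) z).mem_nhds hz] with z' hz'
  rw [extChartAt_eq_jetChart] at hz' ⊢
  rw [jetChart_apply_zero, (extChartAt I z.proj).left_inv (mem_jetChart_source.1 hz')]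

end HigherTangentBundle

end JetCharts

/-! ### Smoothness from coordinate expressions -/

section WrittenSmooth

variable {E H : Type*} [NormedAddCommGroup E] [NormedSpace ℝ E] [TopologicalSpace H]
  {I : ModelWithCorners ℝ E H} {M : Type*} [TopologicalSpace M] [ChartedSpace H M]
  {E' H' : Type*} [NormedAddCommGroup E'] [NormedSpace ℝ E'] [TopologicalSpace H']
  {J : ModelWithCorners ℝ E' H'} {N : Type*} [TopologicalSpace N] [ChartedSpace H' N]
  [IsManifold I ∞ M] [IsManifold J ∞ N] [J.Boundaryless]

/-- A map is smooth if its coordinate expression is smooth. -/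
theorem contMDiffAt_of_written {f : M → N} {m x : M} {y : N} {g : E → E'}
    (hx : m ∈ (extChartAt I x).source) (hg : ContDiffAt ℝ ∞ g (extChartAt I x m))
    (h : ∀ᶠ m' in 𝓝 m, f m' ∈ (extChartAt J y).source ∧
      extChartAt J y (f m') = g (extChartAt I x m')) :
    ContMDiffAt I J ∞ f m := by
  obtain ⟨h1, h2⟩ := h.self_of_nhds
  have ht : g (extChartAt I x m) ∈ (extChartAt J y).target := h2 ▸ (extChartAt J y).map_source h1
  have h3 : ContMDiffAt I 𝓘(ℝ, E) ∞ (extChartAt I x) m :=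
    contMDiffAt_extChartAt' (by rwa [extChartAt_source] at hx)
  have h4 : ContMDiffAt I 𝓘(ℝ, E') ∞ (g ∘ extChartAt I x) m :=
    ContMDiffAt.comp (I' := 𝓘(ℝ, E)) m hg.contMDiffAt h3
  have h5 : ContMDiffAt I J ∞ ((extChartAt J y).symm ∘ (g ∘ extChartAt I x)) m :=
    ContMDiffAt.comp (I' := 𝓘(ℝ, E')) m ((contMDiffOn_extChartAt_symm y).contMDiffAt
      ((isOpen_extChartAt_target y).mem_nhds ht)) h4
  refine h5.congr_of_eventuallyEq ?_
  filter_upwards [h] with m' hm'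
  simp only [Function.comp_apply]
  rw [← hm'.2, (extChartAt J y).left_inv hm'.1]

end WrittenSmooth

/-! ### Prolongation of maps to higher-order tangent bundles -/

section HigherTangentMap

open HigherTangentBundle

variable {E H : Type*} [NormedAddCommGroup E] [NormedSpace ℝ E] [TopologicalSpace H]
  {I : ModelWithCorners ℝ E H} {Q : Type*} [TopologicalSpace Q] [ChartedSpace H Q]
  {E' H' : Type*} [NormedAddCommGroup E'] [NormedSpace ℝ E'] [TopologicalSpace H']
  {I' : ModelWithCorners ℝ E' H'} {Q' : Type*} [TopologicalSpace Q'] [ChartedSpace H' Q']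
  [I.Boundaryless] [IsManifold I ∞ Q] [I'.Boundaryless] [IsManifold I' ∞ Q'] {k : ℕ}

omit [I.Boundaryless] [IsManifold I ∞ Q] [I'.Boundaryless] [IsManifold I' ∞ Q'] in
theorem proj_higherTangentMap (F : Q' → Q) (z : HigherTangentBundle I' Q' k) :
    (higherTangentMap I k F z).proj = F z.proj := by
  unfold higherTangentMap
  rw [proj_jet, Function.comp_apply, curve_zero]

/-- The coordinate expression of `T⁽ᵏ⁾F`. -/
theorem jetChart_higherTangentMap {F : Q' → Q} {z : HigherTangentBundle I' Q' k} {x : Q'} {y : Q}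
    (hF : ContMDiffAt I' I ∞ F z.proj) (hx : z.proj ∈ (extChartAt I' x).source)
    (hy : F z.proj ∈ (extChartAt I y).source) :
    jetChart k y (higherTangentMap I k F z) =
      taylorCoeffs k ((extChartAt I y ∘ F ∘ (extChartAt I' x).symm) ∘
        taylorCurve (jetChart k x z)) := by
  have hc := z.contMDiffAt_curve
  have h0 := z.curve_zero
  have hFc : ContMDiffAt 𝓘(ℝ, ℝ) I ∞ (F ∘ z.curve) 0 :=
    ContMDiffAt.comp (0 : ℝ) (by rwa [h0]) hc
  have hxc : z.curve 0 ∈ (extChartAt I' x).source := by rwa [h0]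
  have hcs : ContDiffAt ℝ ∞ (extChartAt I' x ∘ z.curve) 0 :=
    contDiffAt_extChartAt_comp hc (by rwa [extChartAt_source] at hxc)
  unfold higherTangentMap
  rw [jetChart_jet hFc (by rwa [Function.comp_apply, h0])]
  have e : extChartAt I y ∘ F ∘ z.curve =ᶠ[𝓝 0]
      (extChartAt I y ∘ F ∘ (extChartAt I' x).symm) ∘ (extChartAt I' x ∘ z.curve) := by
    filter_upwards [hc.continuousAt.eventually_mem
      ((isOpen_extChartAt_source x).mem_nhds hxc)] with t ht
    simp only [Function.comp_apply, (extChartAt I' x).left_inv ht]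
  rw [taylorCoeffs_congr e]
  -- The `k`-jet of a composite depends only on the `k`-jet of the inner curve, which may therefore
  -- be replaced by its Taylor polynomial.
  refine taylorCoeffs_comp_congr hcs (contDiff_taylorCurve _).contDiffAt ?_ ?_
  · rw [Function.comp_apply, h0]
    exact contDiffAt_written hF hx hy
  · rw [taylorCoeffs_taylorCurve]
    rfl

/-- In jet charts `T⁽ᵏ⁾F` sends `a` to the Taylor coefficients of `t ↦ f(a(t))`, with `f` the
coordinate expression of `F`. These depend smoothly on `a` by `contDiffOn_taylorCoeffs_param`. -/
theorem contMDiffAt_higherTangentMap {F : Q' → Q} {U : Set Q'} (hU : IsOpen U)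
    (hF : ContMDiffOn I' I ∞ F U) {z : HigherTangentBundle I' Q' k} (hz : z.proj ∈ U) :
    ContMDiffAt 𝓘(ℝ, Fin (k + 1) → E') 𝓘(ℝ, Fin (k + 1) → E) ∞ (higherTangentMap I k F) z := by
  let x := z.proj
  let y := F x
  let f := extChartAt I y ∘ F ∘ (extChartAt I' x).symm
  have hxs : x ∈ (extChartAt I' x).source := mem_extChartAt_source x
  let V : Set Q' := (U ∩ F ⁻¹' (extChartAt I y).source) ∩ (extChartAt I' x).source
  have hV : IsOpen V := (hF.continuousOn.isOpen_inter_preimage hU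
    (isOpen_extChartAt_source y)).inter (isOpen_extChartAt_source x)
  have hxV : x ∈ V := ⟨⟨hz, mem_extChartAt_source (I := I) y⟩, hxs⟩
  let O : Set E' := (extChartAt I' x).target ∩ (extChartAt I' x).symm ⁻¹' V
  have hO : IsOpen O := (continuousOn_extChartAt_symm x).isOpen_inter_preimage
    (isOpen_extChartAt_target x) hV
  have hfO : ContDiffOn ℝ ∞ f O := by
    intro q hq
    have := contDiffAt_written (x := x) (y := y) (hF.contMDiffAt (hU.mem_nhds hq.2.1.1)) hq.2.2
      hq.2.1.2
    rw [(extChartAt I' x).right_inv hq.1] at this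
    exact this.contDiffWithinAt
  let S : Set ((Fin (k + 1) → E') × ℝ) := (fun p => taylorCurve p.1 p.2) ⁻¹' O
  have hS : IsOpen S := hO.preimage contDiff_taylorCurve_uncurry.continuous
  have hfS : ContDiffOn ℝ ∞ (fun p : (Fin (k + 1) → E') × ℝ => f (taylorCurve p.1 p.2)) S :=
    hfO.comp contDiff_taylorCurve_uncurry.contDiffOn fun p hp => hp
  have hg := contDiffOn_taylorCoeffs_param (k := k) hS hfS
  have hzS : (jetChart k x z, (0 : ℝ)) ∈ S := by
    change taylorCurve (jetChart k x z) 0 ∈ O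
    rw [taylorCurve_zero, jetChart_apply_zero]
    exact ⟨(extChartAt I' x).map_source hxs, by
      rw [mem_preimage, (extChartAt I' x).left_inv hxs]; exact hxV⟩
  have hcS : IsOpen {a : Fin (k + 1) → E' | (a, (0 : ℝ)) ∈ S} :=
    hS.preimage (by fun_prop)
  refine contMDiffAt_of_written (x := z) (y := higherTangentMap I k F z)
    (g := fun a => taylorCoeffs k (fun t => f (taylorCurve a t))) (mem_extChartAt_source z) ?_ ?_
  · rw [extChartAt_eq_jetChart]
    exact hg.contDiffAt (hcS.mem_nhds hzS)
  · filter_upwards [continuous_proj.continuousAt.eventually_mem (hV.mem_nhds hxV)] with z' hz'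
    rw [extChartAt_eq_jetChart, extChartAt_eq_jetChart, mem_jetChart_source, proj_higherTangentMap,
      proj_higherTangentMap]
    exact ⟨hz'.1.2, jetChart_higherTangentMap (hF.contMDiffAt (hU.mem_nhds hz'.1.1)) hz'.2 hz'.1.2⟩

end HigherTangentMap

/-! ### The canonical flip in coordinates -/

section HigherFlip

open HigherTangentBundle

variable {E H : Type*} [NormedAddCommGroup E] [NormedSpace ℝ E] [TopologicalSpace H]
  {I : ModelWithCorners ℝ E H} {Q : Type*} [TopologicalSpace Q] [ChartedSpace H Q]
  [I.Boundaryless] [IsManifold I ∞ Q] {k : ℕ}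

theorem velocity_symm_add_smul (y : Q) {q v : E} (hq : q ∈ (extChartAt I y).target) :
    velocity I (fun s : ℝ => (extChartAt I y).symm (q + s • v)) =
      (extChartAt I.tangent (⟨y, 0⟩ : TangentBundle I Q)).symm (q, v) := by
  have hl : HasDerivAt (fun s : ℝ => q + s • v) v 0 := by
    simpa using ((hasDerivAt_id (0 : ℝ)).smul_const v).const_add q
  have hls : ContDiffAt ℝ ∞ (fun s : ℝ => q + s • v) 0 := by fun_prop
  have hl0 : q + (0 : ℝ) • v = q := by simp
  have hm := (extChartAt I y).map_target hq
  have hc : ContMDiffAt 𝓘(ℝ, ℝ) I ∞ (fun s : ℝ => (extChartAt I y).symm (q + s • v)) 0 :=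
    ContMDiffAt.comp (I' := 𝓘(ℝ, E)) (0 : ℝ) (g := (extChartAt I y).symm)
      (f := fun s : ℝ => q + s • v) (by
        rw [hl0]
        exact (contMDiffOn_extChartAt_symm y).contMDiffAt
          ((isOpen_extChartAt_target y).mem_nhds hq)) hls.contMDiffAt
  rw [tangent_extChartAt_symm_apply _ hq]
  refine velocity_eq_of_hasDerivAt (y := y) (w := v) hc (by rw [hl0]) hm ?_
    (coordDeriv_coordDeriv hm (mem_extChartAt_source _) v)
  refine hl.congr_of_eventuallyEq ?_
  have hev := hls.continuousAt.eventually_mem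
    ((isOpen_extChartAt_target (I := I) y).mem_nhds (by rwa [hl0]))
  filter_upwards [hev] with s hs using (extChartAt I y).right_inv hs

theorem contMDiffAt_symm_taylorCurve_prodMk (x : Q) {a b : Fin (k + 1) → E}
    (ha : a 0 ∈ (extChartAt I x).target) :
    ContMDiffAt 𝓘(ℝ, ℝ) I.tangent ∞ ((extChartAt I.tangent (⟨x, 0⟩ : TangentBundle I Q)).symm ∘
      taylorCurve fun i => (a i, b i)) 0 :=
  contMDiffAt_symm_taylorCurve _ (mem_tangent_extChartAt_target.2 ha)

theorem proj_symm_taylorCurve_prodMk (x : Q) {a b : Fin (k + 1) → E}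
    (ha : a 0 ∈ (extChartAt I x).target) :
    (((extChartAt I.tangent (⟨x, 0⟩ : TangentBundle I Q)).symm ∘
      taylorCurve fun i => (a i, b i)) 0).proj = (extChartAt I x).symm (a 0) := by
  have h := tangent_extChartAt_symm_apply (⟨x, 0⟩ : TangentBundle I Q) (w := (a 0, b 0)) ha
  rw [Function.comp_apply, taylorCurve_zero, h]

/-- For fixed small `t`, the family is a straight line in `s` in the chart, with position `a(t)` and
velocity `b(t)`. The flip is thus the jet of the curve with coordinates `(a(t), b(t))`. -/
theorem higherFlip_eq_jet
    (X : TangentBundle 𝓘(ℝ, Fin (k + 1) → E) (HigherTangentBundle I Q k)) :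
    higherFlip I k X = jet I.tangent k
      ((extChartAt I.tangent (⟨X.proj.proj, 0⟩ : TangentBundle I Q)).symm ∘ taylorCurve fun i =>
        (jetChart k X.proj.proj X.proj i, tangentCoord 𝓘(ℝ, Fin (k + 1) → E) X.proj X.2 i)) := by
  have ha : jetChart k X.proj.proj X.proj 0 ∈ (extChartAt I X.proj.proj).target := by
    rw [jetChart_apply_zero]
    exact mem_extChartAt_target _
  refine jet_congr (contMDiffAt_symm_taylorCurve_prodMk _ ha) ?_
  have hev : ∀ᶠ t in 𝓝 (0 : ℝ),
      taylorCurve (jetChart k X.proj.proj X.proj) t ∈ (extChartAt I X.proj.proj).target :=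
    (contDiff_taylorCurve _).continuous.continuousAt.eventually_mem
      ((isOpen_extChartAt_target _).mem_nhds (by rwa [taylorCurve_zero]))
  filter_upwards [hev] with t ht
  unfold higherTangentFamily
  simp only [Function.comp_apply, taylorCurve_prodMk, taylorCurve_add_smul, extChartAt_eq_jetChart]
  exact velocity_symm_add_smul _ ht

theorem proj_proj_higherFlip
    (X : TangentBundle 𝓘(ℝ, Fin (k + 1) → E) (HigherTangentBundle I Q k)) :
    (higherFlip I k X).proj.proj = X.proj.proj := by
  unfold higherFlip
  rw [proj_jet]
  change higherTangentFamily I k X 0 0 = X.proj.proj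
  unfold higherTangentFamily
  rw [zero_smul, add_zero, taylorCurve_zero, extChartAt_eq_jetChart, jetChart_apply_zero,
    extChartAt_to_inv]

/-- The coordinate change of `T⁽ᵏ⁾Q`. -/
theorem jetChart_jetChart_symm (x y : Q) {a : Fin (k + 1) → E}
    (ha : a 0 ∈ (extChartAt I y).target)
    (hx : (extChartAt I y).symm (a 0) ∈ (extChartAt I x).source) :
    jetChart (I := I) k x ((jetChart k y).symm a) =
      taylorCoeffs k (fun t => (extChartAt I x ∘ (extChartAt I y).symm) (taylorCurve a t)) :=
  jetChart_jet (contMDiffAt_symm_taylorCurve y ha) (by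
    rwa [Function.comp_apply, taylorCurve_zero])

/-- With `g` the coordinate change of `Q`, that of `T⁽ᵏ⁾Q` takes Taylor coefficients of `g(a(t))`,
and its derivative is computed inside the Taylor coefficients. The curve `Dg(a(t)) b(t)` is also the
fibre part of the coordinate change of `TQ` along `(a(t), b(t))`, which is why `Φ⁽ᵏ⁾` looks the same
in all charts. -/
theorem coordDeriv_higherTangentBundle {p z : HigherTangentBundle I Q k}
    (hz : z.proj ∈ (extChartAt I p.proj).source) (b : Fin (k + 1) → E) :
    coordDeriv 𝓘(ℝ, Fin (k + 1) → E) z p z b =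
      taylorCoeffs k (fun t => fderiv ℝ (extChartAt I p.proj ∘ (extChartAt I z.proj).symm)
        (taylorCurve (jetChart k z.proj z) t) (taylorCurve b t)) := by
  let g := extChartAt I p.proj ∘ (extChartAt I z.proj).symm
  let O := ((extChartAt I z.proj).symm ≫ extChartAt I p.proj).source
  have hO : IsOpen O := isOpen_coordChange_source _ _
  have hg : ContDiffOn ℝ ∞ g O := contDiffOn_ext_coord_change p.proj z.proj
  let S : Set ((Fin (k + 1) → E) × ℝ) := (fun p => taylorCurve p.1 p.2) ⁻¹' O
  have hS : IsOpen S := hO.preimage contDiff_taylorCurve_uncurry.continuous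
  have hgS : ContDiffOn ℝ ∞ (fun p : (Fin (k + 1) → E) × ℝ => g (taylorCurve p.1 p.2)) S :=
    hg.comp contDiff_taylorCurve_uncurry.contDiffOn fun p hp => hp
  have hmemS : ∀ a : Fin (k + 1) → E, (a, (0 : ℝ)) ∈ S ↔ a 0 ∈ (extChartAt I z.proj).target ∧
      (extChartAt I z.proj).symm (a 0) ∈ (extChartAt I p.proj).source := by
    intro a
    change taylorCurve a 0 ∈ O ↔ _
    rw [taylorCurve_zero]
    exact Iff.rfl
  have hzS : (jetChart k z.proj z, (0 : ℝ)) ∈ S := by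
    rw [hmemS, jetChart_apply_zero, extChartAt_to_inv]
    exact ⟨mem_extChartAt_target _, hz⟩
  have hcS : IsOpen {a : Fin (k + 1) → E | (a, (0 : ℝ)) ∈ S} := hS.preimage (by fun_prop)
  unfold coordDeriv
  rw [extChartAt_eq_jetChart, extChartAt_eq_jetChart]
  have e : (jetChart (I := I) k p.proj ∘ (jetChart k z.proj).symm) =ᶠ[𝓝 (jetChart k z.proj z)]
      fun a => taylorCoeffs k (fun t => g (taylorCurve a t)) := by
    filter_upwards [hcS.mem_nhds hzS] with a ha
    exact jetChart_jetChart_symm (I := I) p.proj z.proj ((hmemS a).1 ha).1 ((hmemS a).1 ha).2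
  rw [e.fderiv_eq]
  refine (fderiv_taylorCoeffs_param hS hgS hzS b).trans (taylorCoeffs_congr ?_)
  have hc : ContinuousAt (fun t : ℝ => (jetChart k z.proj z, t)) 0 := by fun_prop
  filter_upwards [hc (hS.mem_nhds hzS)] with t ht
  have h1 : HasFDerivAt g _ (taylorCurve (jetChart k z.proj z) t) :=
    ((hg.contDiffAt (hO.mem_nhds ht)).differentiableAt (by simp)).hasFDerivAt
  have h2 : HasFDerivAt (fun p : (Fin (k + 1) → E) × ℝ => taylorCurve p.1 p.2) _
      (jetChart k z.proj z, t) :=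
    ((contDiff_taylorCurve_uncurry (E := E) (k := k)).differentiable (by simp) _).hasFDerivAt
  have h3 := (HasFDerivAt.comp (jetChart k z.proj z, t) (g := g) h1 h2).fderiv
  refine (DFunLike.congr_fun h3 (b, 0)).trans ?_
  exact congrArg _ (fderiv_taylorCurve_uncurry _ t b)

/-- In induced coordinates, `Φ⁽ᵏ⁾` is `(a, b) ↦ (aᵢ, bᵢ)ᵢ`. -/
theorem jetChart_higherFlip (p : HigherTangentBundle I Q k)
    {X : TangentBundle 𝓘(ℝ, Fin (k + 1) → E) (HigherTangentBundle I Q k)}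
    (hX : X.proj.proj ∈ (extChartAt I p.proj).source) :
    jetChart k (⟨p.proj, 0⟩ : TangentBundle I Q) (higherFlip I k X) = fun i =>
      (jetChart k p.proj X.proj i,
        coordDeriv 𝓘(ℝ, Fin (k + 1) → E) X.proj p X.proj X.2 i) := by
  set z := X.proj with hz
  set b : Fin (k + 1) → E := tangentCoord 𝓘(ℝ, Fin (k + 1) → E) X.proj X.2 with hb
  set a := jetChart k z.proj z with ha
  have ha0 : a 0 = extChartAt I z.proj z.proj := jetChart_apply_zero
  have hat : a 0 ∈ (extChartAt I z.proj).target := by rw [ha0]; exact mem_extChartAt_target _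
  have hsymm : (extChartAt I z.proj).symm (a 0) = z.proj := by rw [ha0, extChartAt_to_inv]
  let g := extChartAt I p.proj ∘ (extChartAt I z.proj).symm
  let O := ((extChartAt I z.proj).symm ≫ extChartAt I p.proj).source
  have hO : IsOpen O := isOpen_coordChange_source _ _
  have hg : ContDiffOn ℝ ∞ g O := contDiffOn_ext_coord_change p.proj z.proj
  have h0O : taylorCurve a 0 ∈ O := by
    rw [taylorCurve_zero]
    exact ⟨hat, by rw [mem_preimage]; exact hsymm.symm ▸ hX⟩
  have hev : ∀ᶠ t in 𝓝 (0 : ℝ), taylorCurve a t ∈ O :=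
    (contDiff_taylorCurve a).continuous.continuousAt.eventually_mem (hO.mem_nhds h0O)
  rw [higherFlip_eq_jet, jetChart_jet (contMDiffAt_symm_taylorCurve_prodMk _ hat)]
  -- The coordinate change of `TQ`, applied pointwise to the curve `(a(t), b(t))`.
  · have e : (extChartAt I.tangent (⟨p.proj, 0⟩ : TangentBundle I Q) ∘
        (extChartAt I.tangent (⟨z.proj, 0⟩ : TangentBundle I Q)).symm ∘
          taylorCurve fun i => (a i, b i)) =ᶠ[𝓝 0]
        fun t => (g (taylorCurve a t), fderiv ℝ g (taylorCurve a t) (taylorCurve b t)) := by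
      filter_upwards [hev] with t ht
      simp only [Function.comp_apply, taylorCurve_prodMk]
      exact tangent_coordChange_apply (⟨z.proj, 0⟩ : TangentBundle I Q) ⟨p.proj, 0⟩
        (w := (taylorCurve a t, taylorCurve b t)) ht.1 ht.2
    refine (taylorCoeffs_congr e).trans ?_
    have hP : ∀ c : Fin (k + 1) → E, ContDiffAt ℝ ∞ (taylorCurve c) 0 :=
      fun c => (contDiff_taylorCurve c).contDiffAt
    have hgO := hg.contDiffAt (hO.mem_nhds h0O)
    have h1 : ContDiffAt ℝ ∞ (fun t => g (taylorCurve a t)) 0 :=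
      ContDiffAt.comp (0 : ℝ) (g := g) hgO (hP a)
    have h2 : ContDiffAt ℝ ∞ (fun t => fderiv ℝ g (taylorCurve a t)) 0 :=
      ContDiffAt.comp (0 : ℝ) (g := fderiv ℝ g) (hgO.fderiv_right (by simp)) (hP a)
    rw [taylorCoeffs_prodMk h1 (h2.clm_apply (hP b))]
    have e1 := jetChart_jetChart_symm (k := k) p.proj z.proj hat (by rw [hsymm]; exact hX)
    have hl : (jetChart k z.proj).symm a = z := (jetChart k z.proj).left_inv
      (mem_jetChart_source.2 (mem_extChartAt_source (I := I) z.proj))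
    rw [hl] at e1
    have e2 := coordDeriv_higherTangentBundle (p := p) (z := z) hX b
    funext i
    exact Prod.ext (congrFun e1 i).symm (congrFun e2 i).symm
  · rw [mem_tangent_extChartAt_source]
    exact ((proj_symm_taylorCurve_prodMk z.proj hat).trans hsymm).symm ▸ hX

theorem mem_tangent_higherTangentBundle_source
    {p X : TangentBundle 𝓘(ℝ, Fin (k + 1) → E) (HigherTangentBundle I Q k)} :
    X ∈ (extChartAt 𝓘(ℝ, Fin (k + 1) → E).tangent p).source ↔
      X.proj.proj ∈ (extChartAt I p.proj.proj).source := by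
  rw [mem_tangent_extChartAt_source, extChartAt_eq_jetChart, mem_jetChart_source]

theorem jetChart_higherFlip_eq_extChartAt
    {p X : TangentBundle 𝓘(ℝ, Fin (k + 1) → E) (HigherTangentBundle I Q k)}
    (hX : X.proj.proj ∈ (extChartAt I p.proj.proj).source) :
    jetChart k (⟨p.proj.proj, 0⟩ : TangentBundle I Q) (higherFlip I k X) = fun i =>
      ((extChartAt 𝓘(ℝ, Fin (k + 1) → E).tangent p X).1 i,
        (extChartAt 𝓘(ℝ, Fin (k + 1) → E).tangent p X).2 i) := by
  rw [jetChart_higherFlip p.proj hX, tangent_extChartAt_apply, extChartAt_eq_jetChart]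

/-- In induced charts the map only rearranges coordinates. -/
theorem contMDiff_higherFlip :
    ContMDiff 𝓘(ℝ, Fin (k + 1) → E).tangent 𝓘(ℝ, Fin (k + 1) → E × E) ∞
      (higherFlip I k (Q := Q)) := by
  intro X
  have hg : ContDiff ℝ ∞ (fun (w : (Fin (k + 1) → E) × (Fin (k + 1) → E)) (i : Fin (k + 1)) =>
    (w.1 i, w.2 i)) := by fun_prop
  refine contMDiffAt_of_written (x := X) (g := fun w i => (w.1 i, w.2 i))
    (y := jet I.tangent k fun _ => (⟨X.proj.proj, 0⟩ : TangentBundle I Q)) (mem_extChartAt_source X)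
    hg.contDiffAt ?_
  filter_upwards [(isOpen_extChartAt_source (I := 𝓘(ℝ, Fin (k + 1) → E).tangent) X).mem_nhds
    (mem_extChartAt_source X)] with Y hY
  rw [mem_tangent_higherTangentBundle_source] at hY
  rw [extChartAt_eq_jetChart, proj_jet, mem_jetChart_source, mem_tangent_extChartAt_source,
    proj_proj_higherFlip]
  exact ⟨hY, jetChart_higherFlip_eq_extChartAt hY⟩

end HigherFlip

/-! ### The lift of a discretization map to the higher-order tangent bundle -/

section HigherLiftTheorem

open HigherTangentBundle

variable {E H : Type*} [NormedAddCommGroup E] [NormedSpace ℝ E] [TopologicalSpace H]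
  {I : ModelWithCorners ℝ E H} {Q : Type*} [TopologicalSpace Q] [ChartedSpace H Q]
  [I.Boundaryless] [IsManifold I ∞ Q] {k : ℕ}
  {U : Set (TangentBundle I Q)} {R : TangentBundle I Q → Q × Q}

/-- The linear map `(a, b) ↦ (aᵢ, bᵢ)ᵢ`. -/
def zipCoords (E : Type*) [NormedAddCommGroup E] [NormedSpace ℝ E] (k : ℕ) :
    (Fin (k + 1) → E) × (Fin (k + 1) → E) →L[ℝ] Fin (k + 1) → E × E :=
  ContinuousLinearMap.pi fun i =>
    ((ContinuousLinearMap.proj i).comp (ContinuousLinearMap.fst ℝ _ _)).prod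
      ((ContinuousLinearMap.proj i).comp (ContinuousLinearMap.snd ℝ _ _))

/-- The linear map `(aᵢ, bᵢ)ᵢ ↦ (a, b)`. -/
def unzipCoords (E : Type*) [NormedAddCommGroup E] [NormedSpace ℝ E] (k : ℕ) :
    (Fin (k + 1) → E × E) →L[ℝ] (Fin (k + 1) → E) × (Fin (k + 1) → E) :=
  (ContinuousLinearMap.pi fun i =>
    (ContinuousLinearMap.fst ℝ E E).comp (ContinuousLinearMap.proj i)).prod
  (ContinuousLinearMap.pi fun i =>
    (ContinuousLinearMap.snd ℝ E E).comp (ContinuousLinearMap.proj i))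

theorem jetChart_higherFlip_symm (z : HigherTangentBundle I Q k)
    {w : (Fin (k + 1) → E) × (Fin (k + 1) → E)} (hw : w.1 0 ∈ (extChartAt I z.proj).target)
    {X : TangentBundle 𝓘(ℝ, Fin (k + 1) → E) (HigherTangentBundle I Q k)}
    (hX : X = (extChartAt 𝓘(ℝ, Fin (k + 1) → E).tangent
      (⟨z, 0⟩ : TangentBundle 𝓘(ℝ, Fin (k + 1) → E) (HigherTangentBundle I Q k))).symm w) :
    (higherFlip I k X).proj.proj ∈ (extChartAt I z.proj).source ∧
    jetChart k (⟨z.proj, 0⟩ : TangentBundle I Q) (higherFlip I k X) = zipCoords E k w ∧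
    (higherFlip I k X).proj =
      (extChartAt I.tangent (⟨z.proj, 0⟩ : TangentBundle I Q)).symm (w.1 0, w.2 0) := by
  have hwt : w ∈ (extChartAt 𝓘(ℝ, Fin (k + 1) → E).tangent
      (⟨z, 0⟩ : TangentBundle 𝓘(ℝ, Fin (k + 1) → E) (HigherTangentBundle I Q k))).target := by
    rw [mem_tangent_extChartAt_target, extChartAt_eq_jetChart]
    exact hw
  have hXs := hX ▸ PartialEquiv.map_target _ hwt
  have hXp := mem_tangent_higherTangentBundle_source.1 hXs
  have hs : (higherFlip I k X).proj.proj ∈ (extChartAt I z.proj).source := by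
    rw [proj_proj_higherFlip]
    exact hXp
  have h1 : jetChart k (⟨z.proj, 0⟩ : TangentBundle I Q) (higherFlip I k X) = zipCoords E k w := by
    have h := jetChart_higherFlip_eq_extChartAt hXp
    have h2 : extChartAt 𝓘(ℝ, Fin (k + 1) → E).tangent
      (⟨z, 0⟩ : TangentBundle 𝓘(ℝ, Fin (k + 1) → E) (HigherTangentBundle I Q k)) X = w := by
      rw [hX, PartialEquiv.right_inv _ hwt]
    rw [h2] at h
    exact h
  refine ⟨hs, h1, ?_⟩
  have h2 := congrFun h1 0
  rw [jetChart_apply_zero] at h2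
  have h3 : (w.1 0, w.2 0) = extChartAt I.tangent (⟨z.proj, 0⟩ : TangentBundle I Q)
    (higherFlip I k X).proj := h2.symm
  rw [h3, PartialEquiv.left_inv _ (mem_tangent_extChartAt_source.2 hs)]

/-- The coordinate expression of `R⁽ᵏ⁾`. -/
theorem higherLift_coord (hU : IsOpen U) (hR : ContMDiffOn I.tangent (I.prod I) ∞ R U)
    (z : HigherTangentBundle I Q k)
    {w : (Fin (k + 1) → E) × (Fin (k + 1) → E)}
    (hw : (w.1 0, w.2 0) ∈ regularCoords U R z.proj z.proj z.proj)
    {X : TangentBundle 𝓘(ℝ, Fin (k + 1) → E) (HigherTangentBundle I Q k)}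
    (hX : X = (extChartAt 𝓘(ℝ, Fin (k + 1) → E).tangent
      (⟨z, 0⟩ : TangentBundle 𝓘(ℝ, Fin (k + 1) → E) (HigherTangentBundle I Q k))).symm w) :
    ((higherLift I k R X).1 ∈ (jetChart k z.proj).source ∧
      (higherLift I k R X).2 ∈ (jetChart k z.proj).source) ∧
    (jetChart k z.proj (higherLift I k R X).1, jetChart k z.proj (higherLift I k R X).2) =
      unzipCoords E k (taylorCoeffs k fun t => (extChartAt (I.prod I) (z.proj, z.proj) ∘ R ∘
        (extChartAt I.tangent (⟨z.proj, 0⟩ : TangentBundle I Q)).symm)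
          (taylorCurve (zipCoords E k w) t)) := by
  obtain ⟨h1, h2, h3⟩ := jetChart_higherFlip_symm z (mem_tangent_extChartAt_target.1 hw.1.1) hX
  have hr := contDiffAt_of_mem_regularCoords hU hR hw.1.1 hw.1.2
  have hmem := hw.1.2
  rw [← h3] at hmem
  have hs := hmem.2
  rw [mem_preimage, extChartAt_prod] at hs
  have hRs := hR.contMDiffAt (hU.mem_nhds hmem.1)
  have hc : ContDiffAt ℝ ∞ (fun t => (extChartAt (I.prod I) (z.proj, z.proj) ∘ R ∘
        (extChartAt I.tangent (⟨z.proj, 0⟩ : TangentBundle I Q)).symm)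
          (taylorCurve (zipCoords E k w) t)) 0 := by
    refine ContDiffAt.comp (0 : ℝ) (g := extChartAt (I.prod I) (z.proj, z.proj) ∘ R ∘
        (extChartAt I.tangent (⟨z.proj, 0⟩ : TangentBundle I Q)).symm)
      (f := taylorCurve (zipCoords E k w)) ?_ (contDiff_taylorCurve _).contDiffAt
    rw [taylorCurve_zero]
    exact hr
  have e1 := jetChart_higherTangentMap (k := k) (x := (⟨z.proj, 0⟩ : TangentBundle I Q))
    (y := z.proj) hRs.fst (mem_tangent_extChartAt_source.2 h1) hs.1
  have e2 := jetChart_higherTangentMap (k := k) (x := (⟨z.proj, 0⟩ : TangentBundle I Q))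
    (y := z.proj) hRs.snd (mem_tangent_extChartAt_source.2 h1) hs.2
  rw [h2] at e1 e2
  refine ⟨⟨?_, ?_⟩, Prod.ext (e1.trans ?_) (e2.trans ?_)⟩
  · rw [mem_jetChart_source]
    exact (proj_higherTangentMap (I := I) (fun v => (R v).1) (higherFlip I k X)).symm ▸ hs.1
  · rw [mem_jetChart_source]
    exact (proj_higherTangentMap (I := I) (fun v => (R v).2) (higherFlip I k X)).symm ▸ hs.2
  -- Taking a component is linear and so commutes with Taylor coefficients.
  · funext i
    refine Eq.trans ?_ (taylorCoeffs_clm_comp (ContinuousLinearMap.fst ℝ E E) hc i)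
    rw [extChartAt_prod]
    rfl
  · funext i
    refine Eq.trans ?_ (taylorCoeffs_clm_comp (ContinuousLinearMap.snd ℝ E E) hc i)
    rw [extChartAt_prod]
    rfl

theorem contMDiffAt_higherLift (hU : IsOpen U) (hR : ContMDiffOn I.tangent (I.prod I) ∞ R U)
    {X : TangentBundle 𝓘(ℝ, Fin (k + 1) → E) (HigherTangentBundle I Q k)}
    (hX : X ∈ higherLiftDomain I k U) :
    ContMDiffAt 𝓘(ℝ, Fin (k + 1) → E).tangent
      (𝓘(ℝ, Fin (k + 1) → E).prod 𝓘(ℝ, Fin (k + 1) → E)) ∞ (higherLift I k R) X := by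
  have h1 : ContMDiffOn I.tangent I ∞ (fun v => (R v).1) U := fun v hv => (hR v hv).fst
  have h2 : ContMDiffOn I.tangent I ∞ (fun v => (R v).2) U := fun v hv => (hR v hv).snd
  have hflip := (contMDiff_higherFlip (I := I) (Q := Q) (k := k)).contMDiffAt (x := X)
  have e1 := ContMDiffAt.comp X (g := higherTangentMap I k fun v => (R v).1)
    (f := higherFlip I k) (contMDiffAt_higherTangentMap hU h1 hX) hflip
  have e2 := ContMDiffAt.comp X (g := higherTangentMap I k fun v => (R v).2)
    (f := higherFlip I k) (contMDiffAt_higherTangentMap hU h2 hX) hflip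
  exact e1.prodMk e2

theorem isOpen_higherLiftDomain (hU : IsOpen U) : IsOpen (higherLiftDomain I k U) :=
  hU.preimage (continuous_proj.comp contMDiff_higherFlip.continuous)

theorem zero_eq_extChartAt_symm (z : HigherTangentBundle I Q k) :
    (⟨z, 0⟩ : TangentBundle 𝓘(ℝ, Fin (k + 1) → E) (HigherTangentBundle I Q k)) =
      (extChartAt 𝓘(ℝ, Fin (k + 1) → E).tangent
        (⟨z, 0⟩ : TangentBundle 𝓘(ℝ, Fin (k + 1) → E) (HigherTangentBundle I Q k))).symm
        (jetChart k z.proj z, 0) := by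
  have h := tangent_extChartAt_zero
    (⟨z, 0⟩ : TangentBundle 𝓘(ℝ, Fin (k + 1) → E) (HigherTangentBundle I Q k)) z
  rw [← extChartAt_eq_jetChart, ← h, extChartAt_to_inv]

theorem jetChart_zero_mem_target (z : HigherTangentBundle I Q k) :
    jetChart k z.proj z 0 ∈ (extChartAt I z.proj).target := by
  rw [jetChart_apply_zero]
  exact mem_extChartAt_target _

theorem proj_higherFlip_zero (z : HigherTangentBundle I Q k) :
    (higherFlip I k (⟨z, 0⟩ :
      TangentBundle 𝓘(ℝ, Fin (k + 1) → E) (HigherTangentBundle I Q k))).proj = ⟨z.proj, 0⟩ := by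
  refine (jetChart_higherFlip_symm z (w := (jetChart k z.proj z, 0))
    (jetChart_zero_mem_target z) (zero_eq_extChartAt_symm z)).2.2.trans ?_
  have h := tangent_extChartAt_symm_zero (⟨z.proj, 0⟩ : TangentBundle I Q)
    (jetChart_zero_mem_target z)
  refine h.trans ?_
  rw [jetChart_apply_zero, extChartAt_to_inv]

namespace IsDiscretizationMap

/-- For `b = 0` the curve `r(a(t), 0)` is `(a(t), a(t))` for small `t`, and the Taylor coefficients
of `a(t)` are `a`. -/
theorem higherLift_zero (hR : IsDiscretizationMap I U R) (z : HigherTangentBundle I Q k) :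
    _root_.higherLift I k R
      (⟨z, 0⟩ : TangentBundle 𝓘(ℝ, Fin (k + 1) → E) (HigherTangentBundle I Q k)) = (z, z) := by
  set a := jetChart k z.proj z with ha
  have hloc := hR.isLocalDiscretization z.proj (jetChart_zero_mem_target z)
  obtain ⟨⟨h1, h2⟩, h3⟩ := higherLift_coord hR.isOpen hR.contMDiffOn z (w := (a, 0))
    (hR.zero_mem_regularCoords z.proj (jetChart_zero_mem_target z)) (zero_eq_extChartAt_symm z)
  have hP : ContDiffAt ℝ ∞ (taylorCurve a) 0 := (contDiff_taylorCurve a).contDiffAt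
  have hc := hP.continuousAt
  rw [ContinuousAt, taylorCurve_zero] at hc
  have e : (fun t => (extChartAt (I.prod I) (z.proj, z.proj) ∘ R ∘
        (extChartAt I.tangent (⟨z.proj, 0⟩ : TangentBundle I Q)).symm)
          (taylorCurve (zipCoords E k (a, 0)) t)) =ᶠ[𝓝 0]
      fun t => (taylorCurve a t, taylorCurve a t) := by
    filter_upwards [hc.eventually hloc.apply_zero] with t ht
    have : taylorCurve (zipCoords E k (a, 0)) t = (taylorCurve a t, 0) :=
      (taylorCurve_prodMk a 0 t).trans (by rw [taylorCurve_zero_left])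
    rw [this, ht]
  rw [taylorCoeffs_congr e, taylorCoeffs_prodMk hP hP, taylorCoeffs_taylorCurve] at h3
  have hz : z ∈ (jetChart k z.proj).source :=
    mem_jetChart_source.2 (mem_extChartAt_source (I := I) z.proj)
  exact Prod.ext ((jetChart k z.proj).injOn h1 hz (congrArg Prod.fst h3))
    ((jetChart k z.proj).injOn h2 hz (congrArg Prod.snd h3))

/-- The derivative is taken inside the Taylor coefficients. The condition on `R`, applied along the
curve `(a(t), 0)` in the zero section, then leaves the Taylor coefficients of `b(t)`. -/
theorem fderiv_higherLift_sub [CompleteSpace E] (hR : IsDiscretizationMap I U R)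
    (z : HigherTangentBundle I Q k) (b : Fin (k + 1) → E) {d}
    (hd : fderiv ℝ (extChartAt (𝓘(ℝ, Fin (k + 1) → E).prod 𝓘(ℝ, Fin (k + 1) → E)) (z, z) ∘
      _root_.higherLift I k R ∘ (extChartAt 𝓘(ℝ, Fin (k + 1) → E).tangent
        (⟨z, 0⟩ : TangentBundle 𝓘(ℝ, Fin (k + 1) → E) (HigherTangentBundle I Q k))).symm)
      (extChartAt 𝓘(ℝ, Fin (k + 1) → E) z z, 0) (0, b) = d) : d.2 - d.1 = b := by
  let a := jetChart k z.proj z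
  let r := extChartAt (I.prod I) (z.proj, z.proj) ∘ R ∘
    (extChartAt I.tangent (⟨z.proj, 0⟩ : TangentBundle I Q)).symm
  let O := regularCoords U R z.proj z.proj z.proj
  have hO : IsOpen O := isOpen_regularCoords hR.isOpen hR.contMDiffOn _ _ _
  have hr : ∀ q ∈ O, ContDiffAt ℝ ∞ r q := fun q hq =>
    contDiffAt_of_mem_regularCoords hR.isOpen hR.contMDiffOn hq.1.1 hq.1.2
  let S : Set ((Fin (k + 1) → E × E) × ℝ) := (fun p => taylorCurve p.1 p.2) ⁻¹' O
  have hS : IsOpen S := hO.preimage contDiff_taylorCurve_uncurry.continuous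
  have hrS : ContDiffOn ℝ ∞ (fun p : (Fin (k + 1) → E × E) × ℝ => r (taylorCurve p.1 p.2)) S :=
    ContDiffOn.comp (g := r) (fun q hq => (hr q hq).contDiffWithinAt)
      contDiff_taylorCurve_uncurry.contDiffOn fun p hp => hp
  have h0O : (a 0, (0 : E)) ∈ O :=
    hR.zero_mem_regularCoords z.proj (jetChart_zero_mem_target z)
  let c := zipCoords E k (a, 0)
  have hcS : (c, (0 : ℝ)) ∈ S := by
    change taylorCurve c 0 ∈ O
    rw [taylorCurve_zero]
    exact h0O
  have hSc : IsOpen {c : Fin (k + 1) → E × E | (c, (0 : ℝ)) ∈ S} := hS.preimage (by fun_prop)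
  let T : (Fin (k + 1) → E × E) → Fin (k + 1) → E × E :=
    fun c => taylorCoeffs k fun t => r (taylorCurve c t)
  have hT : DifferentiableAt ℝ T c :=
    ((contDiffOn_taylorCoeffs_param (k := k) hS hrS).contDiffAt
      (hSc.mem_nhds hcS)).differentiableAt (by simp)
  have hD : HasFDerivAt (fun w => unzipCoords E k (T (zipCoords E k w)))
      ((unzipCoords E k).comp ((fderiv ℝ T c).comp (zipCoords E k))) (a, 0) :=
    (unzipCoords E k).hasFDerivAt.comp (a, (0 : Fin (k + 1) → E))
      (HasFDerivAt.comp (g := T) (a, (0 : Fin (k + 1) → E)) hT.hasFDerivAt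
        (zipCoords E k).hasFDerivAt)
  have hwr : extChartAt (𝓘(ℝ, Fin (k + 1) → E).prod 𝓘(ℝ, Fin (k + 1) → E)) (z, z) ∘
      _root_.higherLift I k R ∘ (extChartAt 𝓘(ℝ, Fin (k + 1) → E).tangent
        (⟨z, 0⟩ : TangentBundle 𝓘(ℝ, Fin (k + 1) → E) (HigherTangentBundle I Q k))).symm
      =ᶠ[𝓝 (a, 0)] fun w => unzipCoords E k (T (zipCoords E k w)) := by
    have hcont : ContinuousAt (fun w : (Fin (k + 1) → E) × (Fin (k + 1) → E) =>
      (w.1 0, w.2 0)) (a, 0) := by fun_prop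
    filter_upwards [hcont.eventually_mem (hO.mem_nhds h0O)] with w hw
    have h := (higherLift_coord hR.isOpen hR.contMDiffOn z hw rfl).2
    simp only [Function.comp_apply, extChartAt_prod, PartialEquiv.prod_coe]
    rw [extChartAt_eq_jetChart]
    exact h
  rw [extChartAt_eq_jetChart] at hd
  have hd' := (DFunLike.congr_fun (hwr.fderiv_eq.trans hD.fderiv) (0, b)).symm.trans hd
  -- Differentiation in the coefficients at `c = (a, 0)` along `(0, b)`, exchanged with the
  -- derivatives in `t`.
  have hsw : fderiv ℝ T c (zipCoords E k (0, b)) = taylorCoeffs k fun t =>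
      fderiv ℝ r (taylorCurve c t) (0, taylorCurve b t) := by
    refine (fderiv_taylorCoeffs_param hS hrS hcS _).trans (taylorCoeffs_congr ?_)
    have hcc : ContinuousAt (fun t : ℝ => (c, t)) 0 := by fun_prop
    filter_upwards [hcc (hS.mem_nhds hcS)] with t ht
    have h1 : HasFDerivAt r _ (taylorCurve c t) :=
      ((hr _ ht).differentiableAt (by simp)).hasFDerivAt
    have h2 : HasFDerivAt (fun p : (Fin (k + 1) → E × E) × ℝ => taylorCurve p.1 p.2) _ (c, t) :=
      ((contDiff_taylorCurve_uncurry (E := E × E) (k := k)).differentiable (by simp) _).hasFDerivAt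
    have h3 := (HasFDerivAt.comp (c, t) (g := r) h1 h2).fderiv
    refine (DFunLike.congr_fun h3 (zipCoords E k (0, b), 0)).trans ?_
    refine congrArg _ ((fderiv_taylorCurve_uncurry _ t _).trans ?_)
    exact (taylorCurve_prodMk 0 b t).trans (by rw [taylorCurve_zero_left])
  have hP : ∀ c : Fin (k + 1) → E, ContDiffAt ℝ ∞ (taylorCurve c) 0 :=
    fun c => (contDiff_taylorCurve c).contDiffAt
  have hPc : ContDiffAt ℝ ∞ (taylorCurve c) 0 := (contDiff_taylorCurve c).contDiffAt
  have hrc : ContDiffAt ℝ ∞ (fun t => fderiv ℝ r (taylorCurve c t) (0, taylorCurve b t)) 0 :=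
    (ContDiffAt.comp (0 : ℝ) (g := fderiv ℝ r) ((hr _ hcS).fderiv_right (by simp)) hPc).clm_apply
      (contDiffAt_const.prodMk (hP b))
  have hloc := hR.isLocalDiscretization z.proj (jetChart_zero_mem_target z)
  have hca := (hP a).continuousAt
  rw [ContinuousAt, taylorCurve_zero] at hca
  rw [← hd']
  funext i
  change (fderiv ℝ T c (zipCoords E k (0, b)) i).2 - (fderiv ℝ T c (zipCoords E k (0, b)) i).1 = b i
  rw [hsw]
  have h := taylorCoeffs_clm_comp (k := k)
    (ContinuousLinearMap.snd ℝ E E - ContinuousLinearMap.fst ℝ E E) hrc i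
  refine h.symm.trans ?_
  -- Taylor coefficients see only a neighbourhood of `t = 0`, and there `a(t)` stays where
  -- `fderiv_sub` holds.
  have e : (fun t => (ContinuousLinearMap.snd ℝ E E - ContinuousLinearMap.fst ℝ E E)
      (fderiv ℝ r (taylorCurve c t) (0, taylorCurve b t))) =ᶠ[𝓝 0] taylorCurve b := by
    filter_upwards [hca.eventually hloc.fderiv_sub] with t ht
    have : taylorCurve c t = (taylorCurve a t, 0) :=
      (taylorCurve_prodMk a 0 t).trans (by rw [taylorCurve_zero_left])
    rw [this]
    exact ht _
  rw [taylorCoeffs_congr e, taylorCoeffs_taylorCurve]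

/-- The lift of a discretization map to `T⁽ᵏ⁾Q` is a discretization map. -/
theorem higherLift [CompleteSpace E] (hR : IsDiscretizationMap I U R) :
    IsDiscretizationMap 𝓘(ℝ, Fin (k + 1) → E) (higherLiftDomain I k U)
      (_root_.higherLift I k R) := by
  have hmem : ∀ z : HigherTangentBundle I Q k, (⟨z, 0⟩ : TangentBundle 𝓘(ℝ, Fin (k + 1) → E)
      (HigherTangentBundle I Q k)) ∈ higherLiftDomain I k U := by
    intro z
    change (higherFlip I k _).proj ∈ U
    rw [proj_higherFlip_zero]
    exact hR.zero_mem _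
  refine ⟨isOpen_higherLiftDomain hR.isOpen, hmem,
    fun X hX => (contMDiffAt_higherLift hR.isOpen hR.contMDiffOn hX).contMDiffWithinAt,
    hR.higherLift_zero, fun z b => ?_⟩
  exact mfderiv_sub_of_fderiv (contMDiffAt_higherLift hR.isOpen hR.contMDiffOn (hmem z))
    (hR.higherLift_zero z) fun d hd => hR.fderiv_higherLift_sub z b hd

end IsDiscretizationMap

end HigherLiftTheorem

end

/-! ### The theorem -/

theorem mainTheorem2 {E H Q : Type*} [NormedAddCommGroup E] [NormedSpace ℝ E]
    [FiniteDimensional ℝ E] [TopologicalSpace H] (I : ModelWithCorners ℝ E H) [I.Boundaryless]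
    [TopologicalSpace Q] [ChartedSpace H Q] [IsManifold I ∞ Q] (k : ℕ)
    (U : Set (TangentBundle I Q)) (R : TangentBundle I Q → Q × Q)
    (hR : IsDiscretizationMap I U R) :
    IsDiscretizationMap (cotangentModel 𝓘(ℝ, Fin (k + 1) → E))
      (cotangentLiftDomain 𝓘(ℝ, Fin (k + 1) → E) (higherLiftDomain I k U) (higherLift I k R))
      (cotangentLift 𝓘(ℝ, Fin (k + 1) → E) (higherLift I k R)) ∧
    ∀ F : CotangentBundle 𝓘(ℝ, Fin (k + 1) → E) (HigherTangentBundle I Q k) → ℝ,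
      ContMDiff (cotangentModel 𝓘(ℝ, Fin (k + 1) → E)) 𝓘(ℝ, ℝ) ∞ F →
      GeneratesSymplecticIntegrator 𝓘(ℝ, Fin (k + 1) → E)
        (cotangentLiftDomain 𝓘(ℝ, Fin (k + 1) → E) (higherLiftDomain I k U) (higherLift I k R))
        (cotangentLift 𝓘(ℝ, Fin (k + 1) → E) (higherLift I k R)) F := by
  -- Completeness serves the smoothness of inversion and the inverse function theorem. Finite
  -- dimension itself is used for the invertibility of `ω`.
  have : CompleteSpace E := FiniteDimensional.complete ℝ E
  have hRk : IsDiscretizationMap 𝓘(ℝ, Fin (k + 1) → E) (higherLiftDomain I k U)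
    (higherLift I k R) := hR.higherLift
  exact ⟨hRk.cotangentLift, fun F hF => hRk.generatesSymplecticIntegrator hF⟩
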